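/- **Setting.** Consider a sequence of experiments $k=0,1,2,\dots$ with $n$ bins and data sizes (exposures) $m=m_k>0$, $m_k\to\infty$. There are two hypotheses. Under $H_0$ the mean bin counts are $\mu(\eta)=m\,\pi(\eta)$, with a nuisance parameter $\eta$ in a set of parameters in $\mathbb R^{q}$; under $H_1$ they are $\nu(\zeta)=m\,\tau(\zeta)$, with a nuisance parameter $\zeta$ in a set of parameters in $\mathbb R^{q^*}$. The per-unit means $\pi,\tau$ are positive and three times continuously differentiable in the parameters, and may depend on $k$. For data $x=(N_1,\dots,N_n)$ and predicted means $\lambda(\theta)$ let $T(\theta;x)$ be one of $$\sum_i 2\Big(\lambda_i-N_i+N_i\log\tfrac{N_i}{\lambda_i}\Big),\quad \sum_i\Big(\log\tfrac{\lambda_i}{N_i}+\tfrac{(N_i-\lambda_i)^2}{\lambda_i}\Big),\quad \sum_i\tfrac{(N_i-\lambda_i)^2}{\lambda_i},\quad \sum_i\tfrac{(N_i-\lambda_i)^2}{N_i}$$ (the Poisson, Gaussian, Pearson and Neyman forms), plus a smooth penalty $\chi^2_{\rm penalty}(\theta)\ge 0$ (possibly $0$, and possibly depending on $k$). Let $T^{\min}_{H}(x)=\inf_\theta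 T_H(\theta;x)$ and $\Delta T(x)=T^{\min}_{H_1}(x)-T^{\min}_{H_0}(x)$. Let $\chi^2_H(\theta;x)$ be the Pearson form without penalty and $D(x)=\min_\zeta\chi^2_{H_1}(\zeta;x)-\min_\eta\chi^2_{H_0}(\eta;x)$ (each minimum being read as an infimum if it is not attained), so that $D=\chi^2_{H_1}(\hat\zeta)-\chi^2_{H_0}(\hat\eta)$ for minimizers $\hat\zeta,\hat\eta$. **Assumptions ($H_0$ true).** The counts $N_i$ are independent, either all Poisson with mean $\mu^0_i$ or all $N(\mu^0_i,\mu^0_i)$, where $\mu^0=\mu(\eta^0)=m\pi^0$ and $\eta^0=\eta^0_k$ is the true parameter; $\pi^0$ is bounded and bounded away from $0$, and the penalty at $\eta^0$ is bounded. Further, $\zeta^0=\zeta^0_k$ minimizes $t(\zeta)=\sum_i(\pi^0_i-\tau_i(\zeta))^2/\tau_i(\zeta)$ regularly, uniformly in $k$: some ball of fixed radius about $\zeta^0$ lies in the parameter set, and on it the derivatives of $\tau$ of orders $1$ to $3$ and the penalty are bounded; $\tau^0=\tau(\zeta^0)$ is bounded away from $0$; for every $\varepsilon>0$, $\inf_{|\zeta-\zeta^0|\ge\varepsilon}t(\zeta)-t(\zeta^0)$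 is bounded below by a positive constant; the Hessian of $t$ at $\zeta^0$ is bounded below by a positive multiple of the identity. Finally [A0]: $\delta=\pi^0-\tau^0=O(1)$. Put $\nu^0=m\tau^0$, $\bar D=\min_\zeta\sum_i(\mu^0_i-\nu_i(\zeta))^2/\nu_i(\zeta)$, $D_1=m\sum_i\delta_i^2/\tau^0_i$, $D_2=2\sqrt m\sum_i(\delta_i/\tau^0_i)\sqrt m\,(N_i/m-\pi^0_i)$ and $s=\sum_i\delta_i^3/(\tau^0_i)^2$. Write $Y\approx N(a,v)$ if the Kolmogorov distance between the law of $Y=Y_k$ and $N(a_k,v_k)$ tends to $0$ as $k\to\infty$. **Conclusions ($H_0$ true).** 1. The minimum $\bar D$ is attained at $\zeta^0$, $D_1=\bar D=D(\mu^0)$, $\bar D=O(m)$, $D_2=O_p(\sqrt m)$, and any minimizers $\hat\zeta$ of $\chi^2_{H_1}(\cdot;X)$ satisfy $\hat\zeta-\zeta^0=O_p(m^{-1/2})$. 2. $D(X)=D_1+D_2+O_p(1)$. 3. $D_2/(2\sqrt m)\approx N(0,\bar D/m+s)$ and $D_1+D_2\approx N(\bar D,4\bar D+4ms)$. If $\bar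 D\to\infty$, then also $D(X)\approx N(\bar D,4\bar D+4ms)$. 4. For each of the four forms, $T^{\min}_{H_0}(X)$ differs from its Pearson form by $O_p(m^{-1/2})$. 5. Assume in addition CD3: $\mu^0_i-\nu^0_i=o(\mu^0_i)$ for every $i$. Then $ms=o(\bar D)$ and $D_1+D_2\approx N(\bar D,4\bar D)$. If moreover $\bar D\to\infty$, then $D(X)\approx N(\bar D,4\bar D)$, and for each of the four forms: $T^{\min}_{H_1}(X)$ differs from its Pearson form by $o_p$ of the latter, $\Delta T(X)-D(X)=o_p(D(X))$, and, with $\overline{\Delta T}_{H_0}=\Delta T(\mu^0)$, one has $\overline{\Delta T}_{H_0}\sim\bar D$ and $\Delta T(X)\approx N\big(\overline{\Delta T}_{H_0},\,4|\overline{\Delta T}_{H_0}|\big)$. **Conclusion ($H_1$ true).** If instead the data come from $H_1$ with true means $\nu(\zeta^0)$, and the assumptions above (CD3 and the divergence of the minimal deviation included) hold with the roles of $H_0$ and $H_1$ exchanged, then for each of the four forms $\Delta T(X)\approx N\big(\overline{\Delta T}_{H_1},\,4|\overline{\Delta T}_{H_1}|\big)$ with $\overline{\Delta T}_{H_1}=\Delta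 T(\nu(\zeta^0))$. -/

import Mathlib

open MeasureTheory ProbabilityTheory Filter Topology Asymptotics

/-- A hypothesis (a framework of models) for `n` bins, in a sequence of experiments `k = 0, 1, 2, …`.
It has a `q`-dimensional nuisance parameter `θ` ranging over `params`, the per-unit-of-exposure mean
count `rate k θ i` of bin `i` (positive and three times continuously differentiable in `θ`), and a
nonnegative smooth penalty term `pen k θ` (zero when no prior knowledge on `θ` is used). The
dependence on `k` allows the per-unit means to vary with the data size. -/
structure BinModel (n : ℕ) where
  q : ℕ
  params : Set (EuclideanSpace ℝ (Fin q))
  rate : ℕ → EuclideanSpace ℝ (Fin q) → Fin n → ℝ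
  pen : ℕ → EuclideanSpace ℝ (Fin q) → ℝ
  rate_pos : ∀ k, ∀ θ ∈ params, ∀ i, 0 < rate k θ i
  rate_smooth : ∀ k i, ContDiffOn ℝ 3 (fun θ => rate k θ i) params
  pen_nonneg : ∀ k, ∀ θ ∈ params, 0 ≤ pen k θ
  pen_smooth : ∀ k, ContDiffOn ℝ 3 (pen k) params

/-- The four forms of the deviation statistic. -/
inductive Form where
  | poisson
  | gaussian
  | pearson
  | neyman

/-- Contribution of a bin with observed count `N` and predicted mean `l`. -/
noncomputable def Form.term : Form → ℝ → ℝ → ℝ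
  | .poisson, N, l => 2 * (l - N + N * Real.log (N / l))
  | .gaussian, N, l => Real.log (l / N) + (N - l) ^ 2 / l
  | .pearson, N, l => (N - l) ^ 2 / l
  | .neyman, N, l => (N - l) ^ 2 / N

namespace BinModel

variable {n : ℕ}

/-- The nuisance parameter vectors of a model. -/
abbrev Param (M : BinModel n) : Type := EuclideanSpace ℝ (Fin M.q)

/-- Mean bin counts: exposure times per-unit mean counts. -/
noncomputable def mean (M : BinModel n) (m : ℕ → ℝ) (k : ℕ) (θ : M.Param) : Fin n → ℝ :=
  fun i => m k * M.rate k θ i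

/-- The Pearson chi-square of the data `x` (without penalty). -/
noncomputable def chiSq (M : BinModel n) (m : ℕ → ℝ) (k : ℕ) (θ : M.Param) (x : Fin n → ℝ) : ℝ :=
  ∑ i, (x i - M.mean m k θ i) ^ 2 / M.mean m k θ i

/-- The Pearson chi-square minimized over the nuisance parameter. -/
noncomputable def chiSqMin (M : BinModel n) (m : ℕ → ℝ) (k : ℕ) (x : Fin n → ℝ) : ℝ :=
  ⨅ θ : M.params, M.chiSq m k θ x

/-- The deviation statistic `T(θ; x)` of the given form, penalty included. -/
noncomputable def T (M : BinModel n) (m : ℕ → ℝ) (v : Form) (k : ℕ) (θ : M.Param)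
    (x : Fin n → ℝ) : ℝ :=
  (∑ i, v.term (x i) (M.mean m k θ i)) + M.pen k θ

/-- `T(θ; x)` minimized over the nuisance parameter. -/
noncomputable def Tmin (M : BinModel n) (m : ℕ → ℝ) (v : Form) (k : ℕ) (x : Fin n → ℝ) : ℝ :=
  ⨅ θ : M.params, M.T m v k θ x

/-- The per-unit Pearson deviation between the per-unit means `p` and the model at `θ`. -/
noncomputable def deviation (M : BinModel n) (k : ℕ) (p : Fin n → ℝ) (θ : M.Param) : ℝ :=
  ∑ i, (p i - M.rate k θ i) ^ 2 / M.rate k θ i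

/-- `a k` is the true nuisance parameter; the true per-unit means are stable as the data size grows
(neither tending to zero nor to infinity), and the penalty at the truth stays bounded. -/
structure IsTruth (M : BinModel n) (a : ℕ → M.Param) : Prop where
  mem : ∀ k, a k ∈ M.params
  rate_bounds : ∃ c C : ℝ, 0 < c ∧ ∀ k i, c ≤ M.rate k (a k) i ∧ M.rate k (a k) i ≤ C
  pen_bound : ∃ C : ℝ, ∀ k, M.pen k (a k) ≤ C

/-- `b k` is the nuisance parameter for which the model is the closest to the per-unit means `p k`
in Pearson deviation. It is a regular minimizer, uniformly in `k`: interior, with bounded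
derivatives near it, unique in the sense of being well separated, and with nonsingular Hessian. -/
structure IsBestFit (M : BinModel n) (p : ℕ → Fin n → ℝ) (b : ℕ → M.Param) : Prop where
  smooth_near : ∃ r C : ℝ, 0 < r ∧ ∀ k, Metric.ball (b k) r ⊆ M.params ∧
    ∀ θ ∈ Metric.ball (b k) r, M.pen k θ ≤ C ∧
      ∀ i, ∀ j ∈ Finset.Icc 1 3, ‖iteratedFDeriv ℝ j (fun θ => M.rate k θ i) θ‖ ≤ C
  rate_lower : ∃ c : ℝ, 0 < c ∧ ∀ k i, c ≤ M.rate k (b k) i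
  separated : ∀ ε : ℝ, 0 < ε → ∃ κ : ℝ, 0 < κ ∧ ∀ k, ∀ θ ∈ M.params, ε ≤ ‖θ - b k‖ →
    M.deviation k (p k) (b k) + κ ≤ M.deviation k (p k) θ
  hessian : ∃ c : ℝ, 0 < c ∧ ∀ k, ∀ v : M.Param,
    c * ‖v‖ ^ 2 ≤ iteratedFDeriv ℝ 2 (M.deviation k (p k)) (b k) ![v, v]

end BinModel

/-- `ΔT(x) = T_{H₁}^min(x) - T_{H₀}^min(x)`. -/
noncomputable def DeltaT {n : ℕ} (H₀ H₁ : BinModel n) (m : ℕ → ℝ) (v : Form) (k : ℕ)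
    (x : Fin n → ℝ) : ℝ :=
  H₁.Tmin m v k x - H₀.Tmin m v k x

/-- `D(x) = χ²_{H₁}(ζ̂) - χ²_{H₀}(η̂)`, the difference of the minimized Pearson chi-squares. -/
noncomputable def pearsonD {n : ℕ} (H₀ H₁ : BinModel n) (m : ℕ → ℝ) (k : ℕ)
    (x : Fin n → ℝ) : ℝ :=
  H₁.chiSqMin m k x - H₀.chiSqMin m k x

section Leading

variable {n : ℕ} (H₀ H₁ : BinModel n) (m : ℕ → ℝ) (η₀ : ℕ → H₀.Param) (ζ₀ : ℕ → H₁.Param)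

/-- `δ = π⁰ - τ⁰`. -/
noncomputable def rateDiff (k : ℕ) (i : Fin n) : ℝ :=
  H₀.rate k (η₀ k) i - H₁.rate k (ζ₀ k) i

/-- `D̄ = min_ν ∑ (μ⁰ᵢ - νᵢ)² / νᵢ`. -/
noncomputable def Dbar (k : ℕ) : ℝ := H₁.chiSqMin m k (H₀.mean m k (η₀ k))

/-- `D₁ = m δᵀ diag(τ⁰)⁻¹ δ`. -/
noncomputable def D₁ (k : ℕ) : ℝ :=
  m k * ∑ i, rateDiff H₀ H₁ η₀ ζ₀ k i ^ 2 / H₁.rate k (ζ₀ k) i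

/-- `D₂ = 2 √m δᵀ diag(τ⁰)⁻¹ √m (x / m - π⁰)`. -/
noncomputable def D₂ (k : ℕ) (x : Fin n → ℝ) : ℝ :=
  2 * √(m k) * ∑ i, rateDiff H₀ H₁ η₀ ζ₀ k i / H₁.rate k (ζ₀ k) i *
    (√(m k) * (x i / m k - H₀.rate k (η₀ k) i))

/-- `s = ∑ (π⁰ᵢ - τ⁰ᵢ)³ / (τ⁰ᵢ)²`. -/
noncomputable def sTerm (k : ℕ) : ℝ :=
  ∑ i, rateDiff H₀ H₁ η₀ ζ₀ k i ^ 3 / H₁.rate k (ζ₀ k) i ^ 2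

end Leading

section Stochastic

variable {Ω : ℕ → Type*} [∀ k, MeasurableSpace (Ω k)] (P : ∀ k, Measure (Ω k))

/-- The bin counts of experiment `k` are independent, with Poisson laws of means `l k i` (for all
bins and experiments) or with normal laws of means and variances `l k i`. -/
structure IsCountData {n : ℕ} (X : ∀ k, Ω k → Fin n → ℝ) (l : ℕ → Fin n → ℝ) : Prop where
  indep : ∀ k, iIndepFun (fun i ω => X k ω i) (P k)
  law : (∀ k i, HasLaw (fun ω => X k ω i)
      ((poissonMeasure (l k i).toNNReal).map (fun N : ℕ => (N : ℝ))) (P k)) ∨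
    (∀ k i, HasLaw (fun ω => X k ω i) (gaussianReal (l k i) (l k i).toNNReal) (P k))

/-- `Y = O_p(r)`. -/
def IsBigOInProb (Y : ∀ k, Ω k → ℝ) (r : ℕ → ℝ) : Prop :=
  ∀ ε : ℝ, 0 < ε → ∃ C : ℝ, ∀ᶠ k in atTop, (P k).real {ω | C * r k < |Y k ω|} ≤ ε

/-- `Y = o_p(R)`. -/
def IsLittleOInProb (Y R : ∀ k, Ω k → ℝ) : Prop :=
  ∀ ε : ℝ, 0 < ε → Tendsto (fun k => (P k).real {ω | ε * |R k ω| < |Y k ω|}) atTop (𝓝 0)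

/-- `Y` is asymptotically distributed as `N(a, v)`: the Kolmogorov distance (the supremum distance
of the distribution functions) between the law of `Y k` and `N(a k, v k)` tends to zero. -/
def ApproxNormal (Y : ∀ k, Ω k → ℝ) (a v : ℕ → ℝ) : Prop :=
  ∀ ε : ℝ, 0 < ε → ∀ᶠ k in atTop, ∀ t : ℝ,
    |(P k).real {ω | Y k ω ≤ t} - (gaussianReal (a k) (v k).toNNReal).real (Set.Iic t)| ≤ ε

end Stochastic

/-! Randomness is confined to one kind of event: every count lies within K√m of its mean. The
central limit theorem makes its probability as close to 1 as desired for large K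
(`IsCountData.exists_near`). Each O_p or o_p claim thus reduces to a deterministic estimate, uniform
over the data x in that box, and each normal limit to such an estimate plus the central limit
theorem for a single linear form of the counts.

Leading terms. The Pearson chi-square at ζ⁰ equals exactly D₁ + D₂(x) + ∑ (xᵢ - μ⁰ᵢ)²/ν⁰ᵢ, and the
last sum is bounded on the box. Minimizing over ζ changes this by O(1) only: the per-unit deviation
grows quadratically around ζ⁰ and stays away from its minimum elsewhere, while moving the per-unit
data by η = K/√m changes its increments near ζ⁰ by at most Bη‖ζ - ζ⁰‖. Completing the square, the
gain is at most a multiple of η², a constant after multiplication by m (`exists_perturbed_growth`,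
`exists_chiSq_growth`). The minimum under H₀ lies between 0 and its bounded value at the truth. The
variance of D₂ is 4m ∑ (δ/τ⁰)² π⁰, which is 4D̄ + 4ms because π⁰ = τ⁰ + δ.

The four forms. In terms of the relative error u = λ/N - 1, any form differs from Pearson's in a bin
by at most 6|u|(1 + Nu²) for |u| ≤ 1/2, and every form is at least Nu²/(2(1 + |u|)) - 1. The latter
forces Nu² to be of order at most 1 + D̄ for all parameters that compete for the minimum, provided
that (1 + D̄)/m → 0. The forms then differ by a multiple of (1 + D̄)√((1 + D̄)/m). This is
O(m^{-1/2}) for the true hypothesis, whose own minimal deviation is 0, and o(D̄) for the other one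
under CD3 when D̄ diverges.

The centre. An error o(D̄) need not be small against the standard deviation 2√D̄, so the law of ΔT
does not follow from that of D. Instead `eventually_abs_Tmin_sub_le` compares the minimum of one
form at x with the minimum of the same form at μ⁰. At a fixed ζ the difference is D₂ up to terms
controlled by u² and ‖ζ - ζ⁰‖; competing parameters satisfy m‖ζ - ζ⁰‖² = o(D̄), so these terms are
o(√D̄), and `abs_ciInf_sub_ciInf_sub_le` passes to the infima. Hence ΔT(μ⁰) is the natural centre.
Exchanging the hypotheses only reverses the sign of ΔT. -/

/-! ### The standard normal distribution function and Pólya's theorem -/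

/-- Weights of a standard normal interval are at most its length. -/
lemma stdGaussian_Iic_sub_le {s t : ℝ} (hst : s ≤ t) :
    (gaussianReal 0 1).real (Set.Iic t) - (gaussianReal 0 1).real (Set.Iic s) ≤ t - s := by
  have h1 : (gaussianReal 0 1).real (Set.Iic t) - (gaussianReal 0 1).real (Set.Iic s)
      = (gaussianReal 0 1).real (Set.Ioc s t) := by
    rw [← measureReal_sdiff (Set.Iic_subset_Iic.2 hst) measurableSet_Iic, Set.Iic_sdiff_Iic]
  rw [h1, measureReal_def, gaussianReal_apply 0 one_ne_zero]
  refine ENNReal.toReal_le_of_le_ofReal (by linarith) ?_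
  calc ∫⁻ x in Set.Ioc s t, gaussianPDF 0 1 x ≤ ∫⁻ _ in Set.Ioc s t, 1 := by
        refine lintegral_mono fun x => ?_
        rw [gaussianPDF, ← ENNReal.ofReal_one]
        refine ENNReal.ofReal_le_ofReal ?_
        rw [gaussianPDFReal]
        refine mul_le_one₀ (inv_le_one_of_one_le₀ ?_) (Real.exp_nonneg _)
          (Real.exp_le_one_iff.2 ?_)
        · rw [Real.one_le_sqrt]
          have := Real.pi_gt_three
          simp only [NNReal.coe_one]
          linarith
        · exact div_nonpos_of_nonpos_of_nonneg (neg_nonpos.2 (sq_nonneg _)) (by positivity)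
    _ = ENNReal.ofReal (t - s) := by simp

lemma abs_stdGaussian_Iic_sub_le (s t : ℝ) :
    |(gaussianReal 0 1).real (Set.Iic s) - (gaussianReal 0 1).real (Set.Iic t)| ≤ |s - t| := by
  have mono : ∀ {a b : ℝ}, a ≤ b →
      (gaussianReal 0 1).real (Set.Iic a) ≤ (gaussianReal 0 1).real (Set.Iic b) :=
    fun h => measureReal_mono (Set.Iic_subset_Iic.2 h)
  rcases le_total s t with h | h
  · rw [abs_sub_comm, abs_sub_comm s, abs_of_nonneg (sub_nonneg.2 (mono h)),
      abs_of_nonneg (sub_nonneg.2 h)]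
    exact stdGaussian_Iic_sub_le h
  · rw [abs_of_nonneg (sub_nonneg.2 (mono h)), abs_of_nonneg (sub_nonneg.2 h)]
    exact stdGaussian_Iic_sub_le h

lemma gaussianReal_Iic_eq_std (a t : ℝ) {s : ℝ} (hs : 0 < s) :
    (gaussianReal a (s ^ 2).toNNReal).real (Set.Iic t) =
      (gaussianReal 0 1).real (Set.Iic ((t - a) / s)) := by
  have h : (gaussianReal 0 1).map (fun x => s * x + a) = gaussianReal a (s ^ 2).toNNReal := by
    have h2 : (fun x : ℝ => s * x + a) = (fun x => x + a) ∘ (fun x => s * x) := rfl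
    rw [h2, ← Measure.map_map (by fun_prop) (by fun_prop), gaussianReal_map_const_mul,
      gaussianReal_map_add_const]
    congr 1
    · simp
    · ext; simp [sq_nonneg]
  rw [← h, map_measureReal_apply (by fun_prop) measurableSet_Iic]
  congr 1
  ext x
  simp only [Set.mem_preimage, Set.mem_Iic, le_div_iff₀ hs]
  constructor <;> intro h <;> linarith

lemma continuous_stdGaussian_Iic : Continuous fun t : ℝ => (gaussianReal 0 1).real (Set.Iic t) := by
  refine LipschitzWith.continuous (K := 1) (LipschitzWith.of_dist_le_mul fun s t => ?_)
  simpa [Real.dist_eq] using abs_stdGaussian_Iic_sub_le s t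

lemma exists_stdGaussian_Iic_eq {c : ℝ} (h0 : 0 < c) (h1 : c < 1) :
    ∃ t : ℝ, (gaussianReal 0 1).real (Set.Iic t) = c := by
  have e : ∀ t, cdf (gaussianReal 0 1) t = (gaussianReal 0 1).real (Set.Iic t) :=
    fun t => cdf_eq_real _ t
  obtain ⟨a, ha⟩ := ((tendsto_cdf_atBot (gaussianReal 0 1)).eventually (gt_mem_nhds h0)).exists
  obtain ⟨b, hb⟩ := ((tendsto_cdf_atTop (gaussianReal 0 1)).eventually (lt_mem_nhds h1)).exists
  rw [e] at ha hb
  exact mem_range_of_exists_le_of_exists_ge continuous_stdGaussian_Iic ⟨a, ha.le⟩ ⟨b, hb.le⟩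

/-- **Pólya's theorem** for the standard normal limit: pointwise convergence of monotone functions
with values in the unit interval to the normal distribution function is uniform. -/
lemma eventually_forall_abs_sub_stdGaussian_Iic_le {F : ℕ → ℝ → ℝ} (hF : ∀ k, Monotone (F k))
    (h0 : ∀ k t, 0 ≤ F k t) (h1 : ∀ k t, F k t ≤ 1)
    (hlim : ∀ t, Tendsto (fun k => F k t) atTop (𝓝 ((gaussianReal 0 1).real (Set.Iic t))))
    {ε : ℝ} (hε : 0 < ε) :
    ∀ᶠ k in atTop, ∀ t, |F k t - (gaussianReal 0 1).real (Set.Iic t)| ≤ ε := by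
  set Φ : ℝ → ℝ := fun t => (gaussianReal 0 1).real (Set.Iic t) with hΦ
  have mono : Monotone Φ := fun a b h => measureReal_mono (Set.Iic_subset_Iic.2 h)
  -- The values of Φ are cut into N steps of height at most ε/2; the other ε/2 pays for convergence
  -- at the grid points.
  obtain ⟨N, hN⟩ := exists_nat_gt (2 / ε)
  have hN0 : (0 : ℝ) < N := lt_trans (by positivity) hN
  have hNε : 1 / (N : ℝ) ≤ ε / 2 := by
    rw [div_le_div_iff₀ hN0 (by norm_num)]
    rw [div_lt_iff₀ hε] at hN
    linarith
  -- The quantiles of order j/N; outside 0 < j < N the value is arbitrary.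
  have ht : ∀ j : ℕ, ∃ t, 0 < j → j < N → Φ t = j / N := by
    intro j
    by_cases hj : 0 < j ∧ j < N
    · obtain ⟨t, ht⟩ := exists_stdGaussian_Iic_eq (c := j / N)
        (div_pos (by exact_mod_cast hj.1) hN0)
        ((div_lt_one hN0).2 (by exact_mod_cast hj.2))
      exact ⟨t, fun _ _ => ht⟩
    · exact ⟨0, fun a b => absurd ⟨a, b⟩ hj⟩
  choose t ht using ht
  have hev : ∀ᶠ k in atTop, ∀ j ∈ Finset.range N, |F k (t j) - Φ (t j)| < ε / 2 := by
    rw [Filter.eventually_all_finset]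
    intro j _
    have := (hlim (t j)).eventually (Metric.ball_mem_nhds _ (half_pos hε))
    filter_upwards [this] with k hk
    simpa [Real.dist_eq] using hk
  filter_upwards [hev] with k hk x
  have hx0 : 0 ≤ Φ x := measureReal_nonneg
  have hx1 : Φ x ≤ 1 := measureReal_le_one
  have hNx : 0 ≤ N * Φ x := by positivity
  change |F k x - Φ x| ≤ ε
  rw [abs_le]
  constructor
  · -- lower bound, by the largest grid value strictly below `Φ x`
    by_cases hc : Φ x ≤ 1 / N
    · have := h0 k x
      linarith
    push Not at hc
    obtain ⟨j, hj⟩ : ∃ j, j = ⌈N * Φ x⌉₊ - 1 := ⟨_, rfl⟩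
    have hgt : 1 < N * Φ x := by rwa [div_lt_iff₀' hN0] at hc
    have hce : 1 < ⌈N * Φ x⌉₊ := Nat.lt_ceil.2 (by simpa using hgt)
    have hceN : ⌈N * Φ x⌉₊ ≤ N := Nat.ceil_le.2 (by nlinarith)
    have hj1 : (j : ℝ) + 1 = ⌈N * Φ x⌉₊ := by
      have : j + 1 = ⌈N * Φ x⌉₊ := by omega
      exact_mod_cast this
    have hup := Nat.le_ceil (N * Φ x)
    have hlo := Nat.ceil_lt_add_one hNx
    have hΦt := ht j (by omega) (by omega)
    have hlt : Φ (t j) < Φ x := by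
      rw [hΦt, div_lt_iff₀' hN0]; linarith
    have htx : t j ≤ x := le_of_lt (mono.reflect_lt hlt)
    have h2 := hF k htx
    have h3 := (abs_lt.1 (hk j (Finset.mem_range.2 (by omega)))).1
    have h4 : Φ x ≤ j / N + 1 / N := by
      rw [← add_div, le_div_iff₀' hN0]; linarith
    linarith
  -- Upper bound, by the smallest grid value strictly above `Φ x`. If that value would be at least
  -- 1, then `Φ x` is within 1/N of 1 and `F k x ≤ 1` suffices.
  · by_cases hc : ⌊N * Φ x⌋₊ + 1 < N
    · obtain ⟨j, hj⟩ : ∃ j, j = ⌊N * Φ x⌋₊ + 1 := ⟨_, rfl⟩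
      rw [← hj] at hc
      have hup := Nat.lt_floor_add_one (N * Φ x)
      have hlo := Nat.floor_le hNx
      have hj1 : (j : ℝ) = ⌊N * Φ x⌋₊ + 1 := by rw [hj]; push_cast; rfl
      have hΦt := ht j (by omega) (by omega)
      have hlt : Φ x < Φ (t j) := by
        rw [hΦt, lt_div_iff₀' hN0]; linarith
      have h2 := hF k (le_of_lt (mono.reflect_lt hlt))
      have h3 := (abs_lt.1 (hk j (Finset.mem_range.2 (by omega)))).2
      have h4 : (j : ℝ) / N - 1 / N ≤ Φ x := by
        rw [← sub_div, div_le_iff₀' hN0]; linarith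
      linarith
    · have hlo := Nat.floor_le hNx
      have h5 : (N : ℝ) ≤ ⌊N * Φ x⌋₊ + 1 := by
        have : N ≤ ⌊N * Φ x⌋₊ + 1 := by omega
        exact_mod_cast this
      have h6 : 1 - 1 / (N : ℝ) ≤ Φ x := by
        have : 1 - 1 / (N : ℝ) = (N - 1) / N := by field_simp
        rw [this, div_le_iff₀' hN0]; linarith
      have := h1 k x
      linarith

/-! ### Central limit theorem for weighted standardized counts -/

section CentralLimit

open Complex in
-- The remainder of the exponential series after three terms is at most |y|³ exp |y|, and e < 3.
lemma norm_cexp_mul_I_taylor_le {y : ℝ} (hy : |y| ≤ 1) :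
    ‖cexp (y * I) - (1 + y * I - y ^ 2 / 2)‖ ≤ 3 * |y| ^ 3 := by
  have h := norm_exp_sub_sum_le_norm_mul_exp (y * I) 3
  have hs : ∑ m ∈ Finset.range 3, ((y : ℂ) * I) ^ m / m.factorial = 1 + y * I - y ^ 2 / 2 := by
    simp [Finset.sum_range_succ, Nat.factorial, mul_pow]
    ring
  have hn : ‖(y : ℂ) * I‖ = |y| := by simp
  rw [hs, hn] at h
  refine h.trans ?_
  rw [mul_comm]
  gcongr
  calc Real.exp |y| ≤ Real.exp 1 := Real.exp_le_exp.2 hy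
    _ ≤ 3 := Real.exp_one_lt_three.le

open Complex in
/-- Characteristic function of a standardized Poisson variable, multiplied by a weight. -/
lemma exists_charFun_poisson_standardized {l w t : ℝ} (hl : 0 < l) (hwt : |w * t| ≤ √l) :
    ∃ r : ℂ, charFun (((poissonMeasure l.toNNReal).map (fun N : ℕ => (N : ℝ))).map
        (fun x => w * ((x - l) / √l))) t = cexp (-((w * t : ℝ) : ℂ) ^ 2 / 2 + r) ∧
      ‖r‖ ≤ 3 * |w * t| ^ 3 / √l := by
  have hs : 0 < √l := Real.sqrt_pos.2 hl
  have hss : √l * √l = l := Real.mul_self_sqrt hl.le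
  have hmap : (fun x => w * ((x - l) / √l)) = (fun x : ℝ => x + (-(w * √l))) ∘
      (fun x => (w / √l) * x) := by
    ext x
    simp only [Function.comp]
    have : l / √l = √l := by rw [div_eq_iff hs.ne']; exact hss.symm
    rw [sub_div, this]; ring
  set y : ℝ := w / √l * t with hy
  have hyw : y * √l = w * t := by rw [hy]; field_simp
  have hya : |y| * √l = |w * t| := by rw [← hyw, abs_mul y, abs_of_pos hs]
  have hy1 : |y| ≤ 1 := by
    by_contra hcon
    push Not at hcon
    nlinarith
  -- The exponent of the Poisson characteristic function is l(exp(iy) - 1); centring subtracts ily,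
  -- and ly² = (wt)², so what is left beyond -(wt)²/2 is l times the third-order Taylor remainder.
  refine ⟨l * (cexp (y * I) - (1 + y * I - y ^ 2 / 2)), ?_, ?_⟩
  · rw [hmap, ← Measure.map_map (by fun_prop) (by fun_prop), charFun_map_add_const,
      charFun_map_mul, charFun_map_cast_poissonMeasure, ← Complex.exp_add]
    congr 1
    have h1 : ((l.toNNReal : ℝ) : ℂ) = (l : ℂ) := by rw [Real.coe_toNNReal _ hl.le]
    have h1' : ((l.toNNReal : NNReal) : ℂ) = (l : ℂ) := h1
    have h2 : (l : ℂ) = (√l : ℂ) * (√l : ℂ) := by rw [← Complex.ofReal_mul, hss]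
    have h3 : ((w * t : ℝ) : ℂ) = (y : ℂ) * (√l : ℂ) := by rw [← Complex.ofReal_mul, hyw]
    have h4 : (((inner ℝ (-(w * √l)) t : ℝ)) : ℂ) = -((y : ℂ) * (√l : ℂ) * (√l : ℂ)) := by
      rw [← h3, ← Complex.ofReal_mul, ← Complex.ofReal_neg]
      congr 1
      rw [Real.inner_apply]; ring
    rw [h1', h4, h3, h2]
    ring
  · rw [norm_mul, Complex.norm_real, Real.norm_of_nonneg hl.le]
    calc l * ‖cexp (y * I) - (1 + y * I - y ^ 2 / 2)‖ ≤ l * (3 * |y| ^ 3) := by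
          gcongr; exact norm_cexp_mul_I_taylor_le hy1
      _ = 3 * |w * t| ^ 3 / √l := by
          rw [eq_div_iff hs.ne', ← hya]
          calc l * (3 * |y| ^ 3) * √l = √l * √l * (3 * |y| ^ 3) * √l := by rw [hss]
            _ = _ := by ring

open Complex in
/-- Characteristic function of a standardized normal variable, multiplied by a weight. -/
lemma charFun_gaussian_standardized {l w t : ℝ} (hl : 0 < l) :
    charFun ((gaussianReal l l.toNNReal).map (fun x => w * ((x - l) / √l))) t =
      cexp (-((w * t : ℝ) : ℂ) ^ 2 / 2) := by
  have hs : 0 < √l := Real.sqrt_pos.2 hl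
  have hmap : (fun x => w * ((x - l) / √l)) = (fun x : ℝ => w * x) ∘ (fun x => x / √l) ∘
      (fun x => x - l) := rfl
  rw [hmap, ← Measure.map_map (by fun_prop) (by fun_prop),
    ← Measure.map_map (by fun_prop) (by fun_prop), gaussianReal_map_sub_const,
    gaussianReal_map_div_const, charFun_map_mul, charFun_gaussianReal]
  congr 1
  have : l.toNNReal / NNReal.mk (√l ^ 2) (sq_nonneg _) = 1 := by
    ext
    simp [Real.sq_sqrt hl.le, hl.le, hl.ne']
  rw [this]
  simp
  ring

variable {n : ℕ} {Ω : ℕ → Type*} [∀ k, MeasurableSpace (Ω k)] {P : ∀ k, Measure (Ω k)}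
  {X : ∀ k, Ω k → Fin n → ℝ} {l : ℕ → Fin n → ℝ}

lemma IsCountData.aemeasurable (h : IsCountData P X l) (k : ℕ) (i : Fin n) :
    AEMeasurable (fun ω => X k ω i) (P k) := by
  rcases h.law with h | h
  · exact (h k i).aemeasurable
  · exact (h k i).aemeasurable

lemma IsCountData.aemeasurable_sum (h : IsCountData P X l) (w : Fin n → ℝ) (k : ℕ) :
    AEMeasurable (fun ω => ∑ i, w i * ((X k ω i - l k i) / √(l k i))) (P k) :=
  Finset.aemeasurable_fun_sum _ fun i _ =>
    (((h.aemeasurable k i).sub_const _).div_const _).const_mul _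

open Complex in
lemma IsCountData.exists_charFun (h : IsCountData P X l) {k : ℕ} {i : Fin n} {w t : ℝ}
    (hl : 0 < l k i) (hwt : |w * t| ≤ √(l k i)) :
    ∃ r : ℂ, charFun ((P k).map (fun ω => w * ((X k ω i - l k i) / √(l k i)))) t =
      cexp (-((w * t : ℝ) : ℂ) ^ 2 / 2 + r) ∧ ‖r‖ ≤ 3 * |w * t| ^ 3 / √(l k i) := by
  have hm : (P k).map (fun ω => w * ((X k ω i - l k i) / √(l k i))) =
      ((P k).map (fun ω => X k ω i)).map (fun x => w * ((x - l k i) / √(l k i))) := by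
    rw [AEMeasurable.map_map_of_aemeasurable (by fun_prop) (h.aemeasurable k i)]
    rfl
  rw [hm]
  rcases h.law with h | h
  · rw [(h k i).map_eq]
    exact exists_charFun_poisson_standardized hl hwt
  · rw [(h k i).map_eq, charFun_gaussian_standardized hl]
    exact ⟨0, by simp, by simp; positivity⟩

variable [∀ k, IsProbabilityMeasure (P k)]

open Complex in
/-- Central limit theorem for unit-norm combinations of the standardized counts. -/
lemma IsCountData.approxNormal_sum (h : IsCountData P X l) (hl0 : ∀ k i, 0 < l k i)
    (hl : ∀ i, Tendsto (fun k => l k i) atTop atTop) {w : ℕ → Fin n → ℝ}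
    (hw : ∀ k, ∑ i, w k i ^ 2 = 1) :
    ApproxNormal P (fun k ω => ∑ i, w k i * ((X k ω i - l k i) / √(l k i)))
      (fun _ => 0) (fun _ => 1) := by
  have hmeas := fun k => h.aemeasurable_sum (w k) k
  have hw1 : ∀ k i, |w k i| ≤ 1 := by
    intro k i
    rw [← sq_le_one_iff_abs_le_one, ← hw k]
    exact Finset.single_le_sum (f := fun i => w k i ^ 2) (fun _ _ => sq_nonneg _)
      (Finset.mem_univ i)
  have hchar : ∀ t : ℝ, Tendsto (fun k => charFun ((P k).map
      (fun ω => ∑ i, w k i * ((X k ω i - l k i) / √(l k i)))) t) atTop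
      (𝓝 (charFun (gaussianReal 0 1) t)) := by
    intro t
    have hsq : ∀ i, Tendsto (fun k => √(l k i)) atTop atTop :=
      fun i => Real.tendsto_sqrt_atTop.comp (hl i)
    have hbig : ∀ᶠ k in atTop, ∀ i, |t| ≤ √(l k i) :=
      eventually_all.2 fun i => (hsq i).eventually_ge_atTop _
    -- The remainders are chosen for every k, with value 0 while some mean is still too small for
    -- the Taylor bound; this affects finitely many k only.
    have hr : ∀ k, ∃ r : Fin n → ℂ, (∀ i, |t| ≤ √(l k i)) → ∀ i,
        charFun ((P k).map (fun ω => w k i * ((X k ω i - l k i) / √(l k i)))) t =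
          cexp (-((w k i * t : ℝ) : ℂ) ^ 2 / 2 + r i) ∧ ‖r i‖ ≤ 3 * |t| ^ 3 / √(l k i) := by
      intro k
      by_cases hk : ∀ i, |t| ≤ √(l k i)
      · have hle : ∀ i, |w k i * t| ≤ |t| := fun i => by
          rw [abs_mul]; exact mul_le_of_le_one_left (abs_nonneg _) (hw1 k i)
        choose r hr using fun i => h.exists_charFun (w := w k i) (t := t) (hl0 k i)
          ((hle i).trans (hk i))
        refine ⟨r, fun _ i => ⟨(hr i).1, (hr i).2.trans ?_⟩⟩
        have := hle i
        gcongr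
      · exact ⟨0, fun h => absurd h hk⟩
    choose r hr using hr
    have hr0 : Tendsto (fun k => ∑ i, r k i) atTop (𝓝 0) := by
      rw [← Finset.sum_const_zero (s := (Finset.univ : Finset (Fin n)))]
      refine tendsto_finsetSum _ fun i _ => ?_
      refine squeeze_zero_norm' (a := fun k => 3 * |t| ^ 3 / √(l k i)) ?_
        (tendsto_const_nhds.div_atTop (hsq i))
      filter_upwards [hbig] with k hk
      exact (hr k hk i).2
    have hlim : Tendsto (fun k => cexp (-(t : ℂ) ^ 2 / 2 + ∑ i, r k i)) atTop
        (𝓝 (charFun (gaussianReal 0 1) t)) := by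
      have : charFun (gaussianReal 0 1) t = cexp (-(t : ℂ) ^ 2 / 2 + 0) := by
        rw [charFun_gaussianReal]; congr 1; simp; ring
      rw [this]
      exact (continuous_exp.tendsto _).comp (hr0.const_add _)
    refine hlim.congr' ?_
    filter_upwards [hbig] with k hk
    have hind : iIndepFun (fun i ω => w k i * ((X k ω i - l k i) / √(l k i))) (P k) :=
      (h.indep k).comp (fun i x => w k i * ((x - l k i) / √(l k i))) (fun i => by fun_prop)
    rw [hind.charFun_map_fun_sum_eq_prod (fun i =>
      (((h.aemeasurable k i).sub_const _).div_const _).const_mul _), Finset.prod_apply]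
    rw [Finset.prod_congr rfl fun i _ => (hr k hk i).1, ← Complex.exp_sum,
      Finset.sum_add_distrib]
    congr 2
    have : ∑ i, ((w k i : ℂ)) ^ 2 = 1 := by exact_mod_cast hw k
    calc -(t : ℂ) ^ 2 / 2 = -(t : ℂ) ^ 2 / 2 * ∑ i, ((w k i : ℂ)) ^ 2 := by rw [this, mul_one]
      _ = ∑ i, -((w k i * t : ℝ) : ℂ) ^ 2 / 2 := by
        rw [Finset.mul_sum]
        refine Finset.sum_congr rfl fun i _ => ?_
        push_cast
        ring
  have hprob : ∀ k, IsProbabilityMeasure ((P k).map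
      (fun ω => ∑ i, w k i * ((X k ω i - l k i) / √(l k i)))) :=
    fun k => Measure.isProbabilityMeasure_map (hmeas k)
  let μs : ℕ → ProbabilityMeasure ℝ := fun k => ⟨_, hprob k⟩
  let μ₀ : ProbabilityMeasure ℝ := ⟨gaussianReal 0 1, inferInstance⟩
  -- Lévy's continuity theorem; the weights and laws vary with k, so the counts form an array rather
  -- than a single sequence of sums.
  have hconv : Tendsto μs atTop (𝓝 μ₀) :=
    ProbabilityMeasure.tendsto_of_tendsto_charFun hchar
  have hcdf : ∀ t : ℝ, Tendsto (fun k => (P k).real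
      {ω | ∑ i, w k i * ((X k ω i - l k i) / √(l k i)) ≤ t}) atTop
      (𝓝 ((gaussianReal 0 1).real (Set.Iic t))) := by
    intro t
    have hfr : (μ₀ : Measure ℝ) (frontier (Set.Iic t)) = 0 := by
      have := nullSingletonClass_gaussianReal (μ := 0) (v := 1) one_ne_zero
      rw [frontier_Iic]
      change gaussianReal 0 1 {t} = 0
      exact measure_singleton t
    have := ProbabilityMeasure.tendsto_measure_of_null_frontier_of_tendsto' hconv hfr
    have h2 := (ENNReal.tendsto_toReal (measure_ne_top (μ₀ : Measure ℝ) (Set.Iic t))).comp this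
    refine h2.congr fun k => ?_
    change ((P k).map _ (Set.Iic t)).toReal = _
    rw [Measure.map_apply_of_aemeasurable (hmeas k) measurableSet_Iic]
    rfl
  intro ε hε
  have := eventually_forall_abs_sub_stdGaussian_Iic_le
    (F := fun k t => (P k).real {ω | ∑ i, w k i * ((X k ω i - l k i) / √(l k i)) ≤ t})
    (fun k a b hab => measureReal_mono fun ω (hω : _ ≤ _) => hω.trans hab)
    (fun _ _ => measureReal_nonneg) (fun _ _ => measureReal_le_one) hcdf hε
  simpa using this

lemma ApproxNormal.isBigOInProb {Z : ∀ k, Ω k → ℝ} (hZ : ApproxNormal P Z (fun _ => 0) fun _ => 1)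
    (hm : ∀ k, AEMeasurable (Z k) (P k)) : IsBigOInProb P Z fun _ => 1 := by
  intro ε hε
  have e : ∀ t, cdf (gaussianReal 0 1) t = (gaussianReal 0 1).real (Set.Iic t) :=
    fun t => cdf_eq_real _ t
  -- Four quarters of ε: two normal tails and two errors of the distribution function, at -K and at
  -- K.
  have hbot := ((tendsto_cdf_atBot (gaussianReal 0 1)).comp tendsto_neg_atTop_atBot).eventually
    (gt_mem_nhds (show (0 : ℝ) < ε / 4 by linarith))
  have htop := (tendsto_cdf_atTop (gaussianReal 0 1)).eventually
    (lt_mem_nhds (show (1 : ℝ) - ε / 4 < 1 by linarith))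
  obtain ⟨K, hK1, hK2⟩ := (hbot.and htop).exists
  simp only [Function.comp, e] at hK1 hK2
  refine ⟨K, ?_⟩
  filter_upwards [hZ (ε / 4) (by linarith)] with k hk
  simp only [Real.toNNReal_one] at hk
  have h1 := (abs_le.1 (hk (-K))).2
  have h2 := (abs_le.1 (hk K)).1
  have hc : (P k).real {ω | K < Z k ω} = 1 - (P k).real {ω | Z k ω ≤ K} := by
    have hn : NullMeasurableSet {ω | Z k ω ≤ K} (P k) :=
      (hm k).nullMeasurable measurableSet_Iic
    rw [← probReal_compl_eq_one_sub₀ hn]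
    congr 1
    ext ω
    simp
  calc (P k).real {ω | K * 1 < |Z k ω|}
      ≤ (P k).real ({ω | Z k ω ≤ -K} ∪ {ω | K < Z k ω}) := by
        refine measureReal_mono fun ω hω => ?_
        rw [Set.mem_ofPred_eq, mul_one, lt_abs] at hω
        rcases hω with h | h
        · exact Or.inr h
        · exact Or.inl (by simp only [Set.mem_ofPred_eq]; linarith)
    _ ≤ (P k).real {ω | Z k ω ≤ -K} + (P k).real {ω | K < Z k ω} := measureReal_union_le _ _
    _ ≤ ε := by rw [hc]; linarith

/-- A location-scale image of an asymptotically standard normal sequence, perturbed by a term of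
smaller order than the scale. The perturbed variable need not be measurable and the scale may
vanish. -/
lemma approxNormal_of_eq_add {Y Z R : ∀ k, Ω k → ℝ} {a s v : ℕ → ℝ}
    (hZ : (∀ k, s k = 0) ∨ ApproxNormal P Z (fun _ => 0) fun _ => 1) (hs : ∀ k, 0 ≤ s k)
    (hR : ∀ ε : ℝ, 0 < ε → ∀ᶠ k in atTop, (P k).real {ω | ε * s k < |R k ω|} ≤ ε)
    (hY : ∀ k ω, Y k ω = a k + s k * Z k ω + R k ω) (hv : ∀ᶠ k in atTop, v k = s k ^ 2) :
    ApproxNormal P Y a v := by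
  intro ε hε
  have hZ' : ∀ᶠ k in atTop, 0 < s k → ∀ t : ℝ,
      |(P k).real {ω | Z k ω ≤ t} - (gaussianReal 0 (1 : ℝ).toNNReal).real (Set.Iic t)| ≤ ε / 3 := by
    rcases hZ with h0 | hZ
    · exact Eventually.of_forall fun k hk => absurd (h0 k) hk.ne'
    · exact (hZ (ε / 3) (by linarith)).mono fun k hk _ => hk
  filter_upwards [hZ', hR (ε / 3) (by linarith), hv] with k hk hRk hvk t
  rw [hvk]
  set B := {ω | ε / 3 * s k < |R k ω|} with hB
  -- At scale 0 the target law is the point mass at `a k`, and outside `B` the remainder is exactly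
  -- 0, so Y equals `a k` there.
  rcases (hs k).eq_or_lt with h0 | hpos
  · have hdir : (gaussianReal (a k) (s k ^ 2).toNNReal).real (Set.Iic t) =
        if a k ≤ t then 1 else 0 := by
      rw [← h0]
      simp [measureReal_def, Set.indicator_apply]
      split_ifs <;> simp
    rw [hdir]
    have hRz : ∀ ω, ω ∉ B → Y k ω = a k := by
      intro ω hω
      simp only [hB, Set.mem_ofPred_eq, ← h0, mul_zero, not_lt] at hω
      rw [hY, ← h0, abs_nonpos_iff.1 hω]
      ring
    split_ifs with hat
    · have h1 : (1 : ℝ) ≤ (P k).real {ω | Y k ω ≤ t} + (P k).real B := by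
        rw [← probReal_univ (μ := P k)]
        refine (measureReal_mono fun ω _ => ?_).trans (measureReal_union_le _ _)
        by_cases hω : ω ∈ B
        · exact Or.inr hω
        · exact Or.inl (by rw [Set.mem_ofPred_eq, hRz ω hω]; exact hat)
      have h2 : (P k).real {ω | Y k ω ≤ t} ≤ 1 := measureReal_le_one
      rw [abs_le]; constructor <;> linarith
    · have h1 : (P k).real {ω | Y k ω ≤ t} ≤ (P k).real B := by
        refine measureReal_mono fun ω hω => ?_
        by_contra hB'
        rw [Set.mem_ofPred_eq, hRz ω hB'] at hω
        exact hat hω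
      have h2 : 0 ≤ (P k).real {ω | Y k ω ≤ t} := measureReal_nonneg
      rw [abs_le]; constructor <;> linarith
  · rw [gaussianReal_Iic_eq_std _ _ hpos]
    set u := (t - a k) / s k with hu
    have hut : u * s k = t - a k := by rw [hu]; field_simp
    replace hk := hk hpos
    simp only [Real.toNNReal_one] at hk
    -- Outside `B`, the event Y ≤ t lies between Z ≤ u - ε/3 and Z ≤ u + ε/3. The three thirds of ε
    -- are the probability of `B`, the error for Z, and the Lipschitz bound for the shift of u.
    have hup : (P k).real {ω | Y k ω ≤ t} ≤
        (P k).real {ω | Z k ω ≤ u + ε / 3} + (P k).real B := by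
      refine (measureReal_mono fun ω hω => ?_).trans (measureReal_union_le _ _)
      by_cases hωB : ω ∈ B
      · exact Or.inr hωB
      · left
        simp only [hB, Set.mem_ofPred_eq, not_lt] at hωB hω ⊢
        have := (abs_le.1 hωB).1
        rw [hY] at hω
        have h3 : s k * Z k ω ≤ s k * (u + ε / 3) := by nlinarith
        exact le_of_mul_le_mul_left h3 hpos
    have hlo : (P k).real {ω | Z k ω ≤ u - ε / 3} ≤
        (P k).real {ω | Y k ω ≤ t} + (P k).real B := by
      refine (measureReal_mono fun ω hω => ?_).trans (measureReal_union_le _ _)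
      by_cases hωB : ω ∈ B
      · exact Or.inr hωB
      · left
        simp only [hB, Set.mem_ofPred_eq, not_lt] at hωB hω ⊢
        have := (abs_le.1 hωB).2
        rw [hY]
        nlinarith
    have e1 := (abs_le.1 (hk (u + ε / 3))).2
    have e2 := (abs_le.1 (hk (u - ε / 3))).1
    have l1 := stdGaussian_Iic_sub_le (show u ≤ u + ε / 3 by linarith)
    have l2 := stdGaussian_Iic_sub_le (show u - ε / 3 ≤ u by linarith)
    rw [abs_le]
    constructor <;> linarith

/-- With probability close to one, the counts are within a multiple of the square root of the
exposure of their means. -/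
lemma IsCountData.exists_near (h : IsCountData P X l) {m : ℕ → ℝ} (hm0 : ∀ k, 0 < m k)
    (hm : Tendsto m atTop atTop) {c C : ℝ} (hc : 0 < c)
    (hlb : ∀ k i, m k * c ≤ l k i ∧ l k i ≤ m k * C) {ε : ℝ} (hε : 0 < ε) :
    ∃ K : ℝ, 0 < K ∧ ∀ᶠ k in atTop,
      (P k).real {ω | ¬ ∀ i, |X k ω i - l k i| ≤ K * √(m k)} ≤ ε := by
  have hl0 : ∀ k i, 0 < l k i := fun k i => (mul_pos (hm0 k) hc).trans_le (hlb k i).1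
  have hl : ∀ i, Tendsto (fun k => l k i) atTop atTop := fun i =>
    tendsto_atTop_mono (fun k => (hlb k i).1) (hm.atTop_mul_const hc)
  -- A union bound over n bins; n + 1 keeps the quotient meaningful for n = 0.
  have hε' : 0 < ε / (n + 1) := by positivity
  have hone : ∀ i : Fin n, ∃ K : ℝ, ∀ᶠ k in atTop,
      (P k).real {ω | K < |(X k ω i - l k i) / √(l k i)|} ≤ ε / (n + 1) := by
    intro i
    -- A coordinate vector as weight singles out bin i.
    have hclt := h.approxNormal_sum hl0 hl (w := fun _ j => if j = i then 1 else 0)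
      (fun k => by simp)
    obtain ⟨K, hK⟩ := hclt.isBigOInProb (fun k => h.aemeasurable_sum _ k) _ hε'
    refine ⟨K, ?_⟩
    filter_upwards [hK] with k hk
    simpa using hk
  choose K hK using hone
  have hKC : ∀ i, |K i| * √C ≤ 1 + ∑ i, |K i| * √C := fun i =>
    (Finset.single_le_sum (f := fun i => |K i| * √C) (fun _ _ => by positivity)
      (Finset.mem_univ i)).trans (by linarith)
  refine ⟨1 + ∑ i, |K i| * √C, by positivity, ?_⟩
  filter_upwards [eventually_all.2 hK] with k hk
  calc (P k).real {ω | ¬ ∀ i, |X k ω i - l k i| ≤ (1 + ∑ i, |K i| * √C) * √(m k)}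
      ≤ (P k).real (⋃ i, {ω | K i < |(X k ω i - l k i) / √(l k i)|}) := by
        refine measureReal_mono fun ω hω => ?_
        simp only [Set.mem_ofPred_eq, not_forall, not_le, Set.mem_iUnion] at hω ⊢
        obtain ⟨i, hi⟩ := hω
        refine ⟨i, ?_⟩
        by_contra hcon
        push Not at hcon
        have hs : 0 < √(l k i) := Real.sqrt_pos.2 (hl0 k i)
        rw [abs_div, abs_of_pos hs, div_le_iff₀ hs] at hcon
        have h2 : √(l k i) ≤ √C * √(m k) := by
          rw [mul_comm, ← Real.sqrt_mul (hm0 k).le]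
          exact Real.sqrt_le_sqrt (hlb k i).2
        have : |X k ω i - l k i| ≤ (1 + ∑ i, |K i| * √C) * √(m k) := by
          calc |X k ω i - l k i| ≤ K i * √(l k i) := hcon
            _ ≤ |K i| * (√C * √(m k)) := by gcongr; exact le_abs_self _
            _ = |K i| * √C * √(m k) := by ring
            _ ≤ _ := by gcongr; exact hKC i
        linarith
    _ ≤ ∑ i, (P k).real {ω | K i < |(X k ω i - l k i) / √(l k i)|} :=
        measureReal_iUnion_fintype_le _
    _ ≤ ∑ _i : Fin n, ε / (n + 1) := Finset.sum_le_sum fun i _ => hk i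
    _ ≤ ε := by
        rw [Finset.sum_const, Finset.card_univ, Fintype.card_fin, nsmul_eq_mul, mul_div_assoc',
          div_le_iff₀ (by positivity)]
        nlinarith

end CentralLimit

/-! ### From deterministic estimates on likely events to stochastic orders -/

section GoodEvents

variable {Ω : ℕ → Type*} [∀ k, MeasurableSpace (Ω k)] {P : ∀ k, Measure (Ω k)}
  [∀ k, IsProbabilityMeasure (P k)] {G : ℝ → ∀ k, Set (Ω k)}

/-- K is fixed by the tolerated probability ε before the estimate is used, so the constant C and the
threshold in k may depend on K. -/
lemma isBigOInProb_of_good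
    (hG : ∀ ε : ℝ, 0 < ε → ∃ K : ℝ, 0 < K ∧ ∀ᶠ k in atTop, (P k).real (G K k)ᶜ ≤ ε)
    {Y : ∀ k, Ω k → ℝ} {r : ℕ → ℝ}
    (h : ∀ K : ℝ, 0 < K → ∃ C : ℝ, ∀ᶠ k in atTop, ∀ ω ∈ G K k, |Y k ω| ≤ C * r k) :
    IsBigOInProb P Y r := by
  intro ε hε
  obtain ⟨K, hK0, hK⟩ := hG ε hε
  obtain ⟨C, hC⟩ := h K hK0
  refine ⟨C, ?_⟩
  filter_upwards [hK, hC] with k h1 h2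
  refine (measureReal_mono fun ω hω hωG => ?_).trans h1
  exact absurd (h2 ω hωG) (not_le.2 hω)

lemma eventually_prob_le_of_good
    (hG : ∀ ε : ℝ, 0 < ε → ∃ K : ℝ, 0 < K ∧ ∀ᶠ k in atTop, (P k).real (G K k)ᶜ ≤ ε)
    {Y R : ∀ k, Ω k → ℝ}
    (h : ∀ K : ℝ, 0 < K → ∀ ε : ℝ, 0 < ε → ∀ᶠ k in atTop, ∀ ω ∈ G K k,
      |Y k ω| ≤ ε * R k ω) {ε ε' : ℝ} (hε : 0 < ε) (hε' : 0 < ε') :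
    ∀ᶠ k in atTop, (P k).real {ω | ε * R k ω < |Y k ω|} ≤ ε' := by
  obtain ⟨K, hK0, hK⟩ := hG ε' hε'
  filter_upwards [hK, h K hK0 ε hε] with k h1 h2
  refine (measureReal_mono fun ω hω hωG => ?_).trans h1
  exact absurd (h2 ω hωG) (not_le.2 hω)

lemma isLittleOInProb_of_good
    (hG : ∀ ε : ℝ, 0 < ε → ∃ K : ℝ, 0 < K ∧ ∀ᶠ k in atTop, (P k).real (G K k)ᶜ ≤ ε)
    {Y R : ∀ k, Ω k → ℝ}
    (h : ∀ K : ℝ, 0 < K → ∀ ε : ℝ, 0 < ε → ∀ᶠ k in atTop, ∀ ω ∈ G K k,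
      |Y k ω| ≤ ε * |R k ω|) : IsLittleOInProb P Y R := by
  intro ε hε
  rw [Metric.tendsto_nhds]
  intro ε' hε'
  filter_upwards [eventually_prob_le_of_good hG (R := fun k ω => |R k ω|) h hε (half_pos hε')]
    with k hk
  rw [Real.dist_eq, sub_zero, abs_of_nonneg measureReal_nonneg]
  linarith

/-- Asymptotic normality from a linear approximation, valid on events of probability close to one,
with a scale `σ` that may be replaced by an equivalent one. -/
lemma approxNormal_of_good
    (hG : ∀ ε : ℝ, 0 < ε → ∃ K : ℝ, 0 < K ∧ ∀ᶠ k in atTop, (P k).real (G K k)ᶜ ≤ ε)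
    {Y Z : ∀ k, Ω k → ℝ} {a σ s v : ℕ → ℝ}
    (hZ : (∀ k, s k = 0) ∨ ApproxNormal P Z (fun _ => 0) fun _ => 1)
    (hZb : ∀ K : ℝ, 0 < K → ∃ C : ℝ, ∀ᶠ k in atTop, ∀ ω ∈ G K k, |Z k ω| ≤ C)
    (hs : ∀ k, 0 ≤ s k) (hσ : ∀ ε : ℝ, 0 < ε → ∀ᶠ k in atTop, |σ k - s k| ≤ ε * s k)
    (hY : ∀ K : ℝ, 0 < K → ∀ ε : ℝ, 0 < ε → ∀ᶠ k in atTop, ∀ ω ∈ G K k,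
      |Y k ω - (a k + σ k * Z k ω)| ≤ ε * s k)
    (hv : ∀ᶠ k in atTop, v k = s k ^ 2) : ApproxNormal P Y a v := by
  refine approxNormal_of_eq_add (R := fun k ω => Y k ω - (a k + s k * Z k ω)) hZ hs
    (fun ε hε => ?_) (fun k ω => by ring) hv
  refine eventually_prob_le_of_good hG (R := fun k _ => s k) (fun K hK ε hε => ?_) hε hε
  obtain ⟨C, hC⟩ := hZb K hK
  have hC0 : 0 < |C| + 1 := by positivity
  filter_upwards [hC, hσ (ε / (2 * (|C| + 1))) (by positivity), hY K hK (ε / 2) (by linarith)]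
    with k h1 h2 h3 ω hω
  have e : Y k ω - (a k + s k * Z k ω) =
      (Y k ω - (a k + σ k * Z k ω)) + (σ k - s k) * Z k ω := by ring
  rw [e]
  refine (abs_add_le _ _).trans ?_
  have h4 : |(σ k - s k) * Z k ω| ≤ ε / 2 * s k := by
    rw [abs_mul]
    have h5 : |Z k ω| ≤ |C| + 1 := (h1 ω hω).trans (by linarith [le_abs_self C])
    calc |σ k - s k| * |Z k ω| ≤ ε / (2 * (|C| + 1)) * s k * (|C| + 1) := by
          have := hs k
          gcongr
      _ = ε / 2 * s k := by field_simp
  linarith [h3 ω hω]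

end GoodEvents

/-! ### Estimates for the contribution of one bin -/

section Terms

/-- With s = √(1 + u), the bound log s ≤ s - 1 gives u - log(1 + u) ≥ (s - 1)², while u = (s - 1)(s
+ 1) and (s + 1)² ≤ 4(1 + |u|). The bound is quadratic for small u and linear for large u, as the
coercivity of the Poisson form requires. -/
lemma sq_div_le_sub_log {u : ℝ} (hu : -1 < u) :
    u ^ 2 / (4 * (1 + |u|)) ≤ u - Real.log (1 + u) := by
  have h1 : 0 < 1 + u := by linarith
  set s := √(1 + u) with hs
  have hs0 : 0 < s := Real.sqrt_pos.2 h1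
  have hss : s * s = 1 + u := Real.mul_self_sqrt h1.le
  have hlog : Real.log (1 + u) ≤ 2 * (s - 1) := by
    have : Real.log (1 + u) = 2 * Real.log s := by
      rw [← hss, Real.log_mul hs0.ne' hs0.ne']; ring
    rw [this]
    have := Real.log_le_sub_one_of_pos hs0
    linarith
  have hu' : u = (s - 1) * (s + 1) := by linarith
  have h3 : u ^ 2 / (4 * (1 + |u|)) ≤ (s - 1) ^ 2 := by
    rw [div_le_iff₀ (by positivity)]
    have h4 : (s + 1) ^ 2 ≤ 4 * (1 + |u|) := by
      have := le_abs_self u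
      nlinarith [sq_nonneg (s - 1), abs_nonneg u]
    calc u ^ 2 = (s - 1) ^ 2 * (s + 1) ^ 2 := by rw [hu']; ring
      _ ≤ _ := by gcongr
  nlinarith

/-- Tail of the logarithmic series at -u, whose geometric factor 1/(1 - |u|) is at most 2. -/
lemma abs_log_one_add_le {u : ℝ} (hu : |u| ≤ 1 / 2) : |Real.log (1 + u)| ≤ 2 * |u| := by
  have h := Real.abs_log_sub_add_sum_range_le (x := -u) (by rw [abs_neg]; linarith) 0
  simp only [Finset.range_zero, Finset.sum_empty, zero_add, sub_neg_eq_add, abs_neg, pow_one] at h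
  refine h.trans ?_
  rw [div_le_iff₀ (by linarith)]
  nlinarith [abs_nonneg u]

lemma abs_log_one_add_sub_le {u : ℝ} (hu : |u| ≤ 1 / 2) :
    |Real.log (1 + u) - (u - u ^ 2 / 2)| ≤ 2 * |u| ^ 3 := by
  have h := Real.abs_log_sub_add_sum_range_le (x := -u) (by rw [abs_neg]; linarith) 2
  simp only [Finset.sum_range_succ, Finset.range_zero, Finset.sum_empty, zero_add, sub_neg_eq_add,
    abs_neg] at h
  have e : Real.log (1 + u) - (u - u ^ 2 / 2) =
      (-u) ^ 1 / ((0 : ℕ) + 1) + (-u) ^ (1 + 1) / ((1 : ℕ) + 1) + Real.log (1 + u) := by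
    push_cast; ring
  rw [e]
  refine h.trans ?_
  rw [div_le_iff₀ (by linarith)]
  have : 0 ≤ |u| ^ 3 := by positivity
  norm_num
  nlinarith

/-- Writing the prediction as N(1 + u) turns each form into N times a function of u (plus log(1 + u)
for the Gaussian form), in which the forms can be compared. -/
lemma Form.term_poisson_eq {N u : ℝ} (hN : 0 < N) (hu : -1 < u) :
    Form.term .poisson N (N * (1 + u)) = 2 * N * (u - Real.log (1 + u)) := by
  have h1 : (1 + u) ≠ 0 := by linarith
  have : N / (N * (1 + u)) = (1 + u)⁻¹ := by field_simp
  simp only [Form.term]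
  rw [this, Real.log_inv]
  ring

lemma Form.term_pearson_eq {N u : ℝ} (hN : 0 < N) (hu : -1 < u) :
    Form.term .pearson N (N * (1 + u)) = N * u ^ 2 / (1 + u) := by
  have h1 : (1 + u) ≠ 0 := by linarith
  simp only [Form.term]
  field_simp
  ring

lemma Form.term_gaussian_eq {N u : ℝ} (hN : 0 < N) (hu : -1 < u) :
    Form.term .gaussian N (N * (1 + u)) = Real.log (1 + u) + N * u ^ 2 / (1 + u) := by
  rw [← Form.term_pearson_eq hN hu]
  simp only [Form.term]
  congr 2
  field_simp

lemma Form.term_neyman_eq {N u : ℝ} (hN : 0 < N) :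
    Form.term .neyman N (N * (1 + u)) = N * u ^ 2 := by
  simp only [Form.term]
  field_simp
  ring

lemma sq_div_one_add_le {N u : ℝ} (hN : 0 < N) (hu : -1 < u) :
    N * u ^ 2 / (2 * (1 + |u|)) ≤ N * u ^ 2 / (1 + u) := by
  have := le_abs_self u
  have h1 : 0 < 1 + u := by linarith
  refine div_le_div_of_nonneg_left (by positivity) h1 (by linarith [abs_nonneg u])

/-- Lower bound for the contribution of a bin, common to the four forms. -/
lemma Form.le_term {N u : ℝ} (v : Form) (hN : 2 ≤ N) (hu : -1 < u) :
    N * u ^ 2 / (2 * (1 + |u|)) - 1 ≤ v.term N (N * (1 + u)) := by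
  have hN0 : 0 < N := by linarith
  have h1 : 0 < 1 + u := by linarith
  have hp := sq_div_one_add_le hN0 hu
  cases v with
  | poisson =>
    rw [Form.term_poisson_eq hN0 hu]
    have := sq_div_le_sub_log hu
    have e : N * u ^ 2 / (2 * (1 + |u|)) = 2 * N * (u ^ 2 / (4 * (1 + |u|))) := by
      field_simp; ring
    rw [e]
    have := mul_le_mul_of_nonneg_left this (show 0 ≤ 2 * N by linarith)
    linarith
  | gaussian =>
    rw [Form.term_gaussian_eq hN0 hu]
    rcases le_total 0 u with h0 | h0
    · have := Real.log_nonneg (show 1 ≤ 1 + u by linarith)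
      linarith
    -- Only here is the term -1 needed, since the logarithm is negative. After clearing 1 + u, it
    -- suffices that 1 + 2u + Nu²/2 ≥ (1 + u)², which is where N ≥ 2 enters.
    · have hl : u / (1 + u) ≤ Real.log (1 + u) := by
        have := Real.one_sub_inv_le_log_of_pos h1
        have e : u / (1 + u) = 1 - (1 + u)⁻¹ := by field_simp; ring
        linarith
      have habs : |u| = -u := abs_of_nonpos h0
      have h2 : N * u ^ 2 / (2 * (1 + |u|)) ≤ N * u ^ 2 / 2 := by
        refine div_le_div_of_nonneg_left (by positivity) (by norm_num) (by linarith [abs_nonneg u])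
      have h3 : N * u ^ 2 / 2 - 1 ≤ (u + N * u ^ 2) / (1 + u) := by
        rw [le_div_iff₀ h1]
        nlinarith [sq_nonneg (u * N + 2), mul_nonneg hN0.le (sq_nonneg u), mul_nonneg (neg_nonneg.2 h0) (mul_nonneg hN0.le (sq_nonneg u)), sq_nonneg u]
      rw [add_div] at h3
      linarith
  | pearson =>
    rw [Form.term_pearson_eq hN0 hu]
    linarith
  | neyman =>
    rw [Form.term_neyman_eq hN0]
    have : N * u ^ 2 / (2 * (1 + |u|)) ≤ N * u ^ 2 :=
      div_le_self (by positivity) (by linarith [abs_nonneg u])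
    linarith

lemma abs_inv_one_add_le {u : ℝ} (hu : |u| ≤ 1 / 2) : |(1 + u)⁻¹| ≤ 2 := by
  have := (abs_le.1 hu).1
  rw [abs_of_pos (by rw [inv_pos]; linarith)]
  exact inv_le_of_inv_le₀ (by norm_num) (by norm_num; linarith)

/-- The four forms agree to leading order for predictions close to the observed count. -/
lemma Form.abs_term_sub_pearson_le {N u : ℝ} (v : Form) (hN : 0 < N) (hu : |u| ≤ 1 / 2) :
    |v.term N (N * (1 + u)) - Form.term .pearson N (N * (1 + u))| ≤
      6 * |u| * (1 + N * u ^ 2) := by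
  have hu1 : -1 < u := by linarith [(abs_le.1 hu).1]
  have h1 : (1 + u) ≠ 0 := by linarith
  have hinv := abs_inv_one_add_le hu
  have hcube : N * |u| ^ 3 = |u| * (N * u ^ 2) := by rw [← sq_abs u]; ring
  have hnn : 0 ≤ |u| * (N * u ^ 2) := by positivity
  have hdiff : |u ^ 3 * (1 + u)⁻¹| ≤ 2 * |u| ^ 3 := by
    rw [abs_mul, abs_pow]
    nlinarith [show 0 ≤ |u| ^ 3 by positivity]
  rw [Form.term_pearson_eq hN hu1]
  cases v with
  | poisson =>
    rw [Form.term_poisson_eq hN hu1]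
    have e : 2 * N * (u - Real.log (1 + u)) - N * u ^ 2 / (1 + u) =
        N * (-2 * (Real.log (1 + u) - (u - u ^ 2 / 2)) + u ^ 3 * (1 + u)⁻¹) := by
      field_simp; ring
    rw [e, abs_mul, abs_of_pos hN]
    have h2 := abs_log_one_add_sub_le hu
    have h3 : |-2 * (Real.log (1 + u) - (u - u ^ 2 / 2)) + u ^ 3 * (1 + u)⁻¹| ≤ 6 * |u| ^ 3 := by
      refine (abs_add_le _ _).trans ?_
      rw [abs_mul, abs_neg, abs_two]
      linarith
    calc _ ≤ N * (6 * |u| ^ 3) := by gcongr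
      _ ≤ _ := by nlinarith [abs_nonneg u]
  | gaussian =>
    rw [Form.term_gaussian_eq hN hu1, add_sub_cancel_right]
    refine (abs_log_one_add_le hu).trans ?_
    nlinarith [abs_nonneg u]
  | pearson =>
    rw [Form.term_pearson_eq hN hu1, sub_self, abs_zero]
    positivity
  | neyman =>
    rw [Form.term_neyman_eq hN]
    have e : N * u ^ 2 - N * u ^ 2 / (1 + u) = N * (u ^ 3 * (1 + u)⁻¹) := by
      field_simp; ring
    rw [e, abs_mul, abs_of_pos hN]
    calc _ ≤ N * (2 * |u| ^ 3) := by gcongr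
      _ ≤ _ := by nlinarith [abs_nonneg u]

/-- First-order expansion of the contribution of a bin in the observed count. -/
lemma Form.abs_term_sub_term_le {N u e : ℝ} (v : Form) (hN : 0 < N) (hu : |u| ≤ 1 / 2)
    (he : |e| ≤ 1 / 2) :
    |v.term (N * (1 + e)) (N * (1 + u)) - v.term N (N * (1 + u)) -
        2 * (N - N * (1 + u)) / (N * (1 + u)) * (N * e)| ≤
      5 * N * |e| * u ^ 2 + 5 * N * e ^ 2 + 2 * |e| := by
  have hu1 : -1 < u := by linarith [(abs_le.1 hu).1]
  have he1 : -1 < e := by linarith [(abs_le.1 he).1]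
  have h1 : 0 < (1 + u) := by linarith
  have h2 : 0 < (1 + e) := by linarith
  have hinv := abs_inv_one_add_le hu
  have hinve := abs_inv_one_add_le he
  have hA : 0 ≤ N * |e| * u ^ 2 := by positivity
  have hB : 0 ≤ N * e ^ 2 := by positivity
  -- The derivative in the data of the Pearson term serves all forms: the Poisson derivative -2
  -- log(1 + u) and the Neyman derivative 1 - (1 + u)² differ from -2u/(1 + u) by O(u²), and the
  -- extra Gaussian logarithm contributes at most 2|e|.
  have hlin : 2 * (N - N * (1 + u)) / (N * (1 + u)) * (N * e) = -(2 * N * e * (u * (1 + u)⁻¹)) := by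
    field_simp; ring
  have hpear : Form.term .pearson (N * (1 + e)) (N * (1 + u)) - Form.term .pearson N (N * (1 + u)) -
      2 * (N - N * (1 + u)) / (N * (1 + u)) * (N * e) = N * e ^ 2 * (1 + u)⁻¹ := by
    simp only [Form.term]
    field_simp; ring
  have hpear' : |N * e ^ 2 * (1 + u)⁻¹| ≤ 2 * (N * e ^ 2) := by
    rw [abs_mul, abs_of_nonneg hB]
    nlinarith
  cases v with
  | poisson =>
    have h0 : Form.term .poisson (N * (1 + e)) (N * (1 + u)) -
        Form.term .poisson N (N * (1 + u)) = -(2 * N * e * Real.log (1 + u)) +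
          2 * N * ((1 + e) * Real.log (1 + e) - e) := by
      simp only [Form.term]
      have l1 : Real.log (N * (1 + e) / (N * (1 + u))) = Real.log (1 + e) - Real.log (1 + u) := by
        rw [mul_div_mul_left _ _ hN.ne', Real.log_div h2.ne' h1.ne']
      have l2 : Real.log (N / (N * (1 + u))) = -Real.log (1 + u) := by
        have : N / (N * (1 + u)) = (1 + u)⁻¹ := by field_simp
        rw [this, Real.log_inv]
      rw [l1, l2]
      ring
    rw [h0, hlin]
    have hl1 : u * (1 + u)⁻¹ ≤ Real.log (1 + u) := by
      have := Real.one_sub_inv_le_log_of_pos h1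
      have e : u * (1 + u)⁻¹ = 1 - (1 + u)⁻¹ := by field_simp; ring
      linarith
    have hl2 : Real.log (1 + u) - u * (1 + u)⁻¹ ≤ 2 * u ^ 2 := by
      have h3 := Real.log_le_sub_one_of_pos h1
      have h4 : u - u * (1 + u)⁻¹ = u ^ 2 * (1 + u)⁻¹ := by field_simp; ring
      have h5 := le_of_abs_le hinv
      nlinarith [sq_nonneg u]
    have he3 : 0 ≤ (1 + e) * Real.log (1 + e) - e := by
      have := Real.one_sub_inv_le_log_of_pos h2
      have h6 : (1 + e) * (1 - (1 + e)⁻¹) = e := by field_simp; ring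
      nlinarith
    have he4 : (1 + e) * Real.log (1 + e) - e ≤ e ^ 2 := by
      have := Real.log_le_sub_one_of_pos h2
      nlinarith
    have e5 : -(2 * N * e * Real.log (1 + u)) + 2 * N * ((1 + e) * Real.log (1 + e) - e) -
        -(2 * N * e * (u * (1 + u)⁻¹)) = -(2 * N) * e * (Real.log (1 + u) - u * (1 + u)⁻¹) +
          2 * N * ((1 + e) * Real.log (1 + e) - e) := by ring
    rw [e5]
    refine (abs_add_le _ _).trans ?_
    rw [abs_mul, abs_mul (-(2 * N)), abs_neg, abs_of_pos (show 0 < 2 * N by linarith),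
      abs_of_nonneg (sub_nonneg.2 hl1), abs_of_nonneg (mul_nonneg (by linarith) he3)]
    have k1 : 2 * N * |e| * (Real.log (1 + u) - u * (1 + u)⁻¹) ≤ 2 * N * |e| * (2 * u ^ 2) := by
      gcongr
    have k2 : 2 * N * ((1 + e) * Real.log (1 + e) - e) ≤ 2 * N * e ^ 2 := by gcongr
    nlinarith [abs_nonneg e]
  | gaussian =>
    have h0 : Form.term .gaussian (N * (1 + e)) (N * (1 + u)) -
        Form.term .gaussian N (N * (1 + u)) -
          2 * (N - N * (1 + u)) / (N * (1 + u)) * (N * e) =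
        -Real.log (1 + e) + N * e ^ 2 * (1 + u)⁻¹ := by
      rw [← hpear]
      simp only [Form.term]
      have l1 : Real.log (N * (1 + u) / (N * (1 + e))) = Real.log (1 + u) - Real.log (1 + e) := by
        rw [mul_div_mul_left _ _ hN.ne', Real.log_div h1.ne' h2.ne']
      have l2 : Real.log (N * (1 + u) / N) = Real.log (1 + u) := by
        rw [mul_div_cancel_left₀ _ hN.ne']
      rw [l1, l2]
      ring
    rw [h0]
    refine (abs_add_le _ _).trans ?_
    rw [abs_neg]
    have := abs_log_one_add_le he
    linarith
  | pearson =>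
    rw [hpear]
    linarith [abs_nonneg e]
  | neyman =>
    have h0 : Form.term .neyman (N * (1 + e)) (N * (1 + u)) -
        Form.term .neyman N (N * (1 + u)) -
          2 * (N - N * (1 + u)) / (N * (1 + u)) * (N * e) =
        N * e * (-(u ^ 2 * (1 + 2 * (1 + u)⁻¹)) + e * ((1 + u) ^ 2 * (1 + e)⁻¹)) := by
      simp only [Form.term]
      field_simp; ring
    rw [h0, abs_mul, abs_mul, abs_of_pos hN]
    have k1 : |-(u ^ 2 * (1 + 2 * (1 + u)⁻¹)) + e * ((1 + u) ^ 2 * (1 + e)⁻¹)| ≤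
        5 * u ^ 2 + 5 * |e| := by
      refine (abs_add_le _ _).trans ?_
      rw [abs_neg, abs_mul, abs_mul, abs_mul, abs_of_nonneg (sq_nonneg u),
        abs_of_nonneg (sq_nonneg (1 + u))]
      have j1 : |1 + 2 * (1 + u)⁻¹| ≤ 5 := by
        refine (abs_add_le _ _).trans ?_
        rw [abs_mul, abs_one, abs_two]
        linarith
      have j2 : (1 + u) ^ 2 * |(1 + e)⁻¹| ≤ 5 := by
        have : (1 + u) ^ 2 ≤ 9 / 4 := by nlinarith [(abs_le.1 hu).2]
        nlinarith [abs_nonneg ((1 + e)⁻¹), sq_nonneg (1 + u)]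
      nlinarith [sq_nonneg u, abs_nonneg e]
    calc N * |e| * _ ≤ N * |e| * (5 * u ^ 2 + 5 * |e|) := by gcongr
      _ = 5 * N * |e| * u ^ 2 + 5 * N * e ^ 2 := by rw [← sq_abs e]; ring
      _ ≤ _ := by linarith [abs_nonneg e]

end Terms

/-! ### Comparison of infima -/

/-- Comparison of infima of two functions that differ by nearly a constant, wherever one of them
does not exceed its value at a reference point. -/
lemma abs_ciInf_sub_ciInf_sub_le {ι : Type*} {f g : ι → ℝ} {d e : ℝ} (a : ι)
    (hf : BddBelow (Set.range f)) (hg : BddBelow (Set.range g))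
    (h : ∀ t, f t ≤ f a ∨ g t ≤ g a → |f t - g t - d| ≤ e) :
    |(⨅ t, f t) - (⨅ t, g t) - d| ≤ e := by
  have : Nonempty ι := ⟨a⟩
  have ha := abs_le.1 (h a (Or.inl le_rfl))
  rw [abs_le]
  constructor
  · have h1 : (⨅ t, g t) + d - e ≤ ⨅ t, f t := by
      refine le_ciInf fun t => ?_
      -- Points where f exceeds `f a` need no estimate of their own: the bound at a already covers
      -- them.
      by_cases ht : f t ≤ f a
      · have := (abs_le.1 (h t (Or.inl ht))).1
        have := ciInf_le hg t
        linarith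
      · push Not at ht
        have := ciInf_le hg a
        linarith
    linarith
  · have h1 : (⨅ t, f t) - d - e ≤ ⨅ t, g t := by
      refine le_ciInf fun t => ?_
      by_cases ht : g t ≤ g a
      · have := (abs_le.1 (h t (Or.inr ht))).2
        have := ciInf_le hf t
        linarith
      · push Not at ht
        have := ciInf_le hf a
        linarith
    linarith

/-! ### Comparison of the four deviation statistics of a model -/

namespace BinModel

variable {n : ℕ} (M : BinModel n) {m : ℕ → ℝ} {k : ℕ} {θ : M.Param} {x : Fin n → ℝ}

lemma mean_pos (hm : 0 < m k) (hθ : θ ∈ M.params) (i : Fin n) : 0 < M.mean m k θ i :=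
  mul_pos hm (M.rate_pos k θ hθ i)

lemma exists_mean_eq (hm : 0 < m k) (hθ : θ ∈ M.params) {N : ℝ} (hN : 0 < N) (i : Fin n) :
    ∃ u : ℝ, -1 < u ∧ M.mean m k θ i = N * (1 + u) := by
  refine ⟨M.mean m k θ i / N - 1, ?_, by field_simp; ring⟩
  have := div_pos (M.mean_pos hm hθ i) hN
  linarith

lemma neg_one_le_term (hm : 0 < m k) (hθ : θ ∈ M.params) (v : Form) {N : ℝ} (hN : 2 ≤ N)
    (i : Fin n) : -1 ≤ v.term N (M.mean m k θ i) := by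
  obtain ⟨u, hu, he⟩ := M.exists_mean_eq hm hθ (show 0 < N by linarith) i
  rw [he]
  refine le_trans ?_ (v.le_term hN hu)
  have : 0 ≤ N * u ^ 2 / (2 * (1 + |u|)) := by positivity
  linarith

lemma neg_le_T (hm : 0 < m k) (hθ : θ ∈ M.params) (v : Form) (hx : ∀ i, 2 ≤ x i) :
    -(n : ℝ) ≤ M.T m v k θ x := by
  have h1 : ∑ _i : Fin n, (-1 : ℝ) ≤ ∑ i, v.term (x i) (M.mean m k θ i) :=
    Finset.sum_le_sum fun i _ => M.neg_one_le_term hm hθ v (hx i) i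
  have h2 := M.pen_nonneg k θ hθ
  simp at h1
  unfold T
  linarith

/-- An infimum of reals is meaningful only with a lower bound; counts of at least 2 provide it for
every form, the Gaussian logarithm included. -/
lemma bddBelow_T (hm : 0 < m k) (v : Form) (hx : ∀ i, 2 ≤ x i) :
    BddBelow (Set.range fun θ : M.params => M.T m v k θ x) := by
  refine ⟨-(n : ℝ), ?_⟩
  rintro _ ⟨θ, rfl⟩
  exact M.neg_le_T hm θ.2 v hx

lemma chiSq_nonneg (hm : 0 < m k) (hθ : θ ∈ M.params) : 0 ≤ M.chiSq m k θ x :=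
  Finset.sum_nonneg fun i _ => div_nonneg (sq_nonneg _) (M.mean_pos hm hθ i).le

lemma bddBelow_chiSq (hm : 0 < m k) (x : Fin n → ℝ) :
    BddBelow (Set.range fun θ : M.params => M.chiSq m k θ x) := by
  refine ⟨0, ?_⟩
  rintro _ ⟨θ, rfl⟩
  exact M.chiSq_nonneg hm θ.2

lemma T_pearson_eq : M.T m .pearson k θ x = M.chiSq m k θ x + M.pen k θ := rfl

/-- A parameter with a small deviation predicts means close to the data. -/
lemma exists_mean_eq_of_T_le (hm : 0 < m k) (hθ : θ ∈ M.params) (v : Form) {A B : ℝ}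
    (hx : ∀ i, A ≤ x i) (hA : 2 ≤ A) (hT : M.T m v k θ x ≤ B) (hB : 12 * (B + n + 1) ≤ A)
    (i : Fin n) :
    ∃ u : ℝ, |u| ≤ 1 / 2 ∧ M.mean m k θ i = x i * (1 + u) ∧ x i * u ^ 2 ≤ 3 * (B + n + 1) := by
  have hx2 : ∀ i, 2 ≤ x i := fun i => hA.trans (hx i)
  have hxi : 0 < x i := by linarith [hx2 i]
  obtain ⟨u, hu, he⟩ := M.exists_mean_eq hm hθ hxi i
  -- Each contribution is at least -1; adding 1 to all of them makes one bin bounded by the total,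
  -- at the cost of n.
  have h1 : v.term (x i) (M.mean m k θ i) + 1 ≤ ∑ j, (v.term (x j) (M.mean m k θ j) + 1) :=
    Finset.single_le_sum (f := fun j => v.term (x j) (M.mean m k θ j) + 1)
      (fun j _ => by linarith [M.neg_one_le_term hm hθ v (hx2 j) j]) (Finset.mem_univ i)
  rw [Finset.sum_add_distrib] at h1
  simp only [Finset.sum_const, Finset.card_univ, Fintype.card_fin, nsmul_eq_mul, mul_one] at h1
  have h2 := M.pen_nonneg k θ hθ
  unfold T at hT
  have h3 := v.le_term (hx2 i) hu
  rw [← he] at h3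
  set Q := B + n + 1 with hQ
  have h4 : x i * u ^ 2 / (2 * (1 + |u|)) ≤ Q := by linarith
  rw [div_le_iff₀ (by positivity)] at h4
  -- The factor 12 yields 6u² ≤ 1 + |u|, which holds exactly for |u| ≤ 1/2.
  have h5 : |u| ≤ 1 / 2 := by
    by_contra hcon
    push Not at hcon
    have h6 := hx i
    have h7 : x i * (6 * u ^ 2) ≤ x i * (1 + |u|) := by nlinarith [abs_nonneg u]
    have h8 := le_of_mul_le_mul_left h7 hxi
    rw [← sq_abs] at h8
    nlinarith
  have hQ0 : 0 ≤ Q := by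
    by_contra hcon
    push Not at hcon
    have : 0 ≤ x i * u ^ 2 := by positivity
    nlinarith [abs_nonneg u]
  exact ⟨u, h5, he, by nlinarith⟩

/-- In each bin Nu² ≤ 3Q with Q = B + n + 1, so |u| ≤ 2√(Q/A) and 6|u|(1 + Nu²) ≤ 6 · 2√(Q/A) · 4Q.
The sublevel condition concerns a second form `w` because comparing infima involves sublevel sets of
both functions. -/
lemma abs_T_sub_T_pearson_le (hm : 0 < m k) (hθ : θ ∈ M.params) (v w : Form) {A B : ℝ}
    (hx : ∀ i, A ≤ x i) (hA : 2 ≤ A) (hT : M.T m w k θ x ≤ B) (hB0 : 0 ≤ B)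
    (hB : 12 * (B + n + 1) ≤ A) :
    |M.T m v k θ x - M.T m .pearson k θ x| ≤
      n * (48 * (B + n + 1) * √((B + n + 1) / A)) := by
  set Q := B + n + 1 with hQ
  have hQ1 : 1 ≤ Q := by have : (0 : ℝ) ≤ n := n.cast_nonneg; linarith
  have hA0 : 0 < A := by linarith
  have e : M.T m v k θ x - M.T m .pearson k θ x = ∑ i, (v.term (x i) (M.mean m k θ i) -
      Form.term .pearson (x i) (M.mean m k θ i)) := by
    unfold T
    rw [Finset.sum_sub_distrib]; ring
  rw [e]
  refine (Finset.abs_sum_le_sum_abs _ _).trans ?_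
  calc ∑ i, |v.term (x i) (M.mean m k θ i) - Form.term .pearson (x i) (M.mean m k θ i)|
      ≤ ∑ _i : Fin n, 48 * Q * √(Q / A) := by
        refine Finset.sum_le_sum fun i _ => ?_
        obtain ⟨u, hu, he, hxu⟩ := M.exists_mean_eq_of_T_le hm hθ w hx hA hT hB i
        have hxi : 0 < x i := by linarith [hx i]
        rw [he]
        refine (v.abs_term_sub_pearson_le hxi hu).trans ?_
        have hu2 : |u| ≤ 2 * √(Q / A) := by
          rw [show (2 : ℝ) * √(Q / A) = √(4 * (Q / A)) by
            rw [Real.sqrt_mul (by norm_num), show (4 : ℝ) = 2 ^ 2 by norm_num,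
              Real.sqrt_sq (by norm_num)]]
          refine Real.abs_le_sqrt ?_
          rw [mul_div_assoc', le_div_iff₀ hA0]
          nlinarith [sq_nonneg u, hx i]
        calc 6 * |u| * (1 + x i * u ^ 2) ≤ 6 * (2 * √(Q / A)) * (4 * Q) := by
              gcongr
              linarith
          _ = 48 * Q * √(Q / A) := by ring
    _ = n * (48 * Q * √(Q / A)) := by simp

/-- The minimized deviations of the four forms are close if the data are well fitted. -/
lemma abs_Tmin_sub_Tmin_pearson_le (hm : 0 < m k) (hθ : θ ∈ M.params) (v : Form) {A B : ℝ}
    (hx : ∀ i, A ≤ x i) (hA : 2 ≤ A) (hT : ∀ w : Form, M.T m w k θ x ≤ B) (hB0 : 0 ≤ B)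
    (hB : 12 * (B + n + 1) ≤ A) :
    |M.Tmin m v k x - M.Tmin m .pearson k x| ≤ n * (48 * (B + n + 1) * √((B + n + 1) / A)) := by
  have hx2 : ∀ i, 2 ≤ x i := fun i => hA.trans (hx i)
  have := abs_ciInf_sub_ciInf_sub_le (d := 0) (e := n * (48 * (B + n + 1) * √((B + n + 1) / A)))
    (⟨θ, hθ⟩ : M.params) (M.bddBelow_T hm v hx2) (M.bddBelow_T hm .pearson hx2) ?_
  · simpa [Tmin] using this
  · rintro t (ht | ht)
    · rw [sub_zero]
      exact M.abs_T_sub_T_pearson_le hm t.2 v v hx hA (ht.trans (hT v)) hB0 hB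
    · rw [sub_zero]
      exact M.abs_T_sub_T_pearson_le hm t.2 v .pearson hx hA (ht.trans (hT _)) hB0 hB

/-- Bound for the deviation of any form by the Pearson chi-square, near the data. -/
lemma T_le_chiSq (hm : 0 < m k) (hθ : θ ∈ M.params) (v : Form) (hx : ∀ i, 0 < x i)
    (hu : ∀ i, |M.mean m k θ i - x i| ≤ x i / 2) :
    M.T m v k θ x ≤ 7 * M.chiSq m k θ x + M.pen k θ + 3 * n := by
  have h : ∀ i, v.term (x i) (M.mean m k θ i) ≤
      7 * ((x i - M.mean m k θ i) ^ 2 / M.mean m k θ i) + 3 := by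
    intro i
    obtain ⟨u, hu1, he⟩ := M.exists_mean_eq hm hθ (hx i) i
    have hui := hu i
    rw [he] at hui ⊢
    have hu2 : |u| ≤ 1 / 2 := by
      rw [show x i * (1 + u) - x i = x i * u by ring, abs_mul, abs_of_pos (hx i)] at hui
      have := hx i
      nlinarith
    have h1 := le_of_abs_le (v.abs_term_sub_pearson_le (hx i) hu2)
    have h2 := Form.term_pearson_eq (hx i) hu1
    have h3 : Form.term .pearson (x i) (x i * (1 + u)) =
      (x i - x i * (1 + u)) ^ 2 / (x i * (1 + u)) := rfl
    rw [← h3]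
    have hxi := hx i
    have h4 : x i * u ^ 2 ≤ 2 * Form.term .pearson (x i) (x i * (1 + u)) := by
      rw [h2, mul_div_assoc', le_div_iff₀ (by linarith)]
      have : 0 ≤ x i * u ^ 2 := by positivity
      nlinarith [(abs_le.1 hu2).2]
    have h5 : 6 * |u| * (1 + x i * u ^ 2) ≤ 3 * (1 + x i * u ^ 2) := by
      have : 0 ≤ 1 + x i * u ^ 2 := by positivity
      nlinarith
    linarith
  have h2 := Finset.sum_le_sum fun i (_ : i ∈ Finset.univ) => h i
  rw [Finset.sum_add_distrib, ← Finset.mul_sum] at h2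
  simp only [Finset.sum_const, Finset.card_univ, Fintype.card_fin, nsmul_eq_mul] at h2
  unfold T chiSq
  linarith

end BinModel

/-! ### Taylor expansion along lines -/

section Calculus

/-- Second-order Taylor lower bound on the unit interval. -/
lemma taylor_lower_bound {g g₁ g₂ g₃ : ℝ → ℝ} {K : ℝ}
    (h₁ : ∀ s ∈ Set.Icc (0 : ℝ) 1, HasDerivAt g (g₁ s) s)
    (h₂ : ∀ s ∈ Set.Icc (0 : ℝ) 1, HasDerivAt g₁ (g₂ s) s)
    (h₃ : ∀ s ∈ Set.Icc (0 : ℝ) 1, HasDerivAt g₂ (g₃ s) s)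
    (hK : ∀ s ∈ Set.Icc (0 : ℝ) 1, |g₃ s| ≤ K) :
    g 0 + g₁ 0 + (g₂ 0 - K) / 2 ≤ g 1 := by
  have hK0 : 0 ≤ K := (abs_nonneg _).trans (hK 0 (by simp))
  have mono : ∀ {f f' : ℝ → ℝ}, (∀ s ∈ Set.Icc (0 : ℝ) 1, HasDerivAt f (f' s) s) →
      (∀ s ∈ Set.Icc (0 : ℝ) 1, 0 ≤ f' s) → ∀ s ∈ Set.Icc (0 : ℝ) 1, f 0 ≤ f s := by
    intro f f' hf hf' s hs
    have : MonotoneOn f (Set.Icc 0 1) := by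
      refine monotoneOn_of_deriv_nonneg (convex_Icc 0 1)
        (fun x hx => (hf x hx).continuousAt.continuousWithinAt)
        (fun x hx => (hf x (interior_subset hx)).differentiableAt.differentiableWithinAt)
        (fun x hx => ?_)
      rw [(hf x (interior_subset hx)).deriv]
      exact hf' x (interior_subset hx)
    exact this (by simp) hs hs.1
  have e2 : ∀ s ∈ Set.Icc (0 : ℝ) 1, g₂ 0 - K ≤ g₂ s := by
    intro s hs
    have := mono (f := fun s => g₂ s + K * s) (f' := fun s => g₃ s + K)
      (fun s hs => ((h₃ s hs).add ((hasDerivAt_id s).const_mul K)).congr_deriv (by simp))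
      (fun s hs => by linarith [(abs_le.1 (hK s hs)).1]) s hs
    simp only [mul_zero, add_zero] at this
    nlinarith [hs.2, hs.1]
  have e1 : ∀ s ∈ Set.Icc (0 : ℝ) 1, g₁ 0 + (g₂ 0 - K) * s ≤ g₁ s := by
    intro s hs
    have := mono (f := fun s => g₁ s - (g₂ 0 - K) * s) (f' := fun s => g₂ s - (g₂ 0 - K))
      (fun s hs => ((h₂ s hs).sub ((hasDerivAt_id s).const_mul (g₂ 0 - K))).congr_deriv (by simp))
      (fun s hs => by linarith [e2 s hs]) s hs
    simp only [mul_zero, sub_zero] at this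
    linarith
  have := mono (f := fun s => g s - (g₁ 0 * s + (g₂ 0 - K) / 2 * s ^ 2))
    (f' := fun s => g₁ s - (g₁ 0 + (g₂ 0 - K) * s))
    (fun s hs => by
      have := (h₁ s hs).sub (((hasDerivAt_id s).const_mul (g₁ 0)).add
        (((hasDerivAt_id s).pow 2).const_mul ((g₂ 0 - K) / 2)))
      refine this.congr_deriv ?_
      simp
      ring)
    (fun s hs => by linarith [e1 s hs]) 1 (by simp)
  simp at this
  linarith

variable {E : Type*} [NormedAddCommGroup E] [NormedSpace ℝ E]

/-- Derivatives of a function along a line. -/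
lemma exists_line_derivs {f : E → ℝ} {b h : E} {r : ℝ}
    (hf : ContDiffOn ℝ 3 f (Metric.ball b r)) :
    ∃ f₁ f₂ f₃ : ℝ → ℝ, (∀ s : ℝ, b + s • h ∈ Metric.ball b r →
      HasDerivAt (fun s : ℝ => f (b + s • h)) (f₁ s) s ∧ HasDerivAt f₁ (f₂ s) s ∧
      HasDerivAt f₂ (f₃ s) s ∧
      |f₁ s| ≤ ‖iteratedFDeriv ℝ 1 f (b + s • h)‖ * ‖h‖ ∧
      |f₂ s| ≤ ‖iteratedFDeriv ℝ 2 f (b + s • h)‖ * ‖h‖ ^ 2 ∧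
      |f₃ s| ≤ ‖iteratedFDeriv ℝ 3 f (b + s • h)‖ * ‖h‖ ^ 3) ∧
      f₂ 0 = iteratedFDeriv ℝ 2 f b ![h, h] := by
  refine ⟨fun s => fderiv ℝ f (b + s • h) h, fun s => fderiv ℝ (fderiv ℝ f) (b + s • h) h h,
    fun s => fderiv ℝ (fderiv ℝ (fderiv ℝ f)) (b + s • h) h h h, ?_, ?_⟩
  · intro s hs
    have hline : HasDerivAt (fun s : ℝ => b + s • h) h s := by
      simpa using ((hasDerivAt_id s).smul_const h).const_add b
    have c0 : ContDiffAt ℝ 3 f (b + s • h) := hf.contDiffAt (Metric.isOpen_ball.mem_nhds hs)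
    have c1 : ContDiffAt ℝ 2 (fderiv ℝ f) (b + s • h) := c0.fderiv_right (by norm_num)
    have c2 : ContDiffAt ℝ 1 (fderiv ℝ (fderiv ℝ f)) (b + s • h) := c1.fderiv_right (by norm_num)
    refine ⟨?_, ?_, ?_, ?_, ?_, ?_⟩
    · exact (c0.differentiableAt (by norm_num)).hasFDerivAt.comp_hasDerivAt s hline
    · have := (c1.differentiableAt (by norm_num)).hasFDerivAt.comp_hasDerivAt s hline
      simpa using this.clm_apply (hasDerivAt_const s h)
    · have := (c2.differentiableAt (by norm_num)).hasFDerivAt.comp_hasDerivAt s hline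
      have h2 := (this.clm_apply (hasDerivAt_const s h)).clm_apply (hasDerivAt_const s h)
      simpa using h2
    · have := (iteratedFDeriv ℝ 1 f (b + s • h)).le_opNorm fun _ => h
      simpa [iteratedFDeriv_succ_apply_right] using this
    · have := (iteratedFDeriv ℝ 2 f (b + s • h)).le_opNorm fun _ => h
      simpa [iteratedFDeriv_succ_apply_right, Fin.init] using this
    · have := (iteratedFDeriv ℝ 3 f (b + s • h)).le_opNorm fun _ => h
      simpa [iteratedFDeriv_succ_apply_right, Fin.init] using this
  · simp only [zero_smul, add_zero]
    rw [iteratedFDeriv_two_apply]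
    rfl

end Calculus

/-- First three derivatives of a Pearson term along a curve of predictions. -/
lemma hasDerivAt_pearson {p : ℝ} {f f₁ f₂ f₃ : ℝ → ℝ} {s : ℝ} (hf : f s ≠ 0)
    (h₁ : HasDerivAt f (f₁ s) s) (h₂ : HasDerivAt f₁ (f₂ s) s) (h₃ : HasDerivAt f₂ (f₃ s) s) :
    HasDerivAt (fun s => (p - f s) ^ 2 / f s) (f₁ s - p ^ 2 * (f₁ s / f s ^ 2)) s ∧
    HasDerivAt (fun s => f₁ s - p ^ 2 * (f₁ s / f s ^ 2))
      (f₂ s - p ^ 2 * (f₂ s / f s ^ 2 - 2 * f₁ s ^ 2 / f s ^ 3)) s ∧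
    HasDerivAt (fun s => f₂ s - p ^ 2 * (f₂ s / f s ^ 2 - 2 * f₁ s ^ 2 / f s ^ 3))
      (f₃ s - p ^ 2 * (f₃ s / f s ^ 2 - 6 * f₁ s * f₂ s / f s ^ 3 + 6 * f₁ s ^ 3 / f s ^ 4)) s := by
  refine ⟨?_, ?_, ?_⟩
  · refine (((h₁.const_sub p).pow 2).div h₁ hf).congr_deriv ?_
    simp
    field_simp
    ring
  · refine (h₂.sub ((h₂.div (h₁.pow 2) (pow_ne_zero 2 hf)).const_mul (p ^ 2))).congr_deriv ?_
    simp only [Nat.cast_ofNat, Nat.add_one_sub_one, pow_one, Pi.pow_apply]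
    field_simp
  · refine (h₃.sub (((h₃.div (h₁.pow 2) (pow_ne_zero 2 hf)).sub
      (((h₂.pow 2).const_mul 2).div (h₁.pow 3) (pow_ne_zero 3 hf))).const_mul (p ^ 2))).congr_deriv ?_
    simp only [Nat.cast_ofNat, Nat.add_one_sub_one, pow_one, Pi.pow_apply]
    field_simp
    ring

/-- The bound depends only on bounds shared by all experiments, which makes the radius of quadratic
growth uniform in k. -/
lemma abs_pearson_third_deriv_le {p f f₁ f₂ f₃ a c C D : ℝ} (ha : 0 ≤ a) (hc : 0 < c) (hC : 0 ≤ C)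
    (hp : |p| ≤ D) (hf : c ≤ f) (h₁ : |f₁| ≤ C * a) (h₂ : |f₂| ≤ C * a ^ 2)
    (h₃ : |f₃| ≤ C * a ^ 3) :
    |f₃ - p ^ 2 * (f₃ / f ^ 2 - 6 * f₁ * f₂ / f ^ 3 + 6 * f₁ ^ 3 / f ^ 4)| ≤
      (C + D ^ 2 * (C / c ^ 2 + 6 * C * C / c ^ 3 + 6 * C ^ 3 / c ^ 4)) * a ^ 3 := by
  have hf0 : 0 < f := hc.trans_le hf
  have hp2 : p ^ 2 ≤ D ^ 2 := by
    rw [← sq_abs p]; gcongr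
  have e1 : |f₃ / f ^ 2| ≤ C * a ^ 3 / c ^ 2 := by
    rw [abs_div, abs_of_pos (pow_pos hf0 2)]; gcongr
  have e2 : |6 * f₁ * f₂ / f ^ 3| ≤ 6 * (C * a) * (C * a ^ 2) / c ^ 3 := by
    rw [abs_div, abs_of_pos (pow_pos hf0 3), abs_mul, abs_mul, abs_of_pos (show (0 : ℝ) < 6 by norm_num)]
    gcongr
  have e3 : |6 * f₁ ^ 3 / f ^ 4| ≤ 6 * (C * a) ^ 3 / c ^ 4 := by
    rw [abs_div, abs_of_pos (pow_pos hf0 4), abs_mul, abs_pow, abs_of_pos (show (0 : ℝ) < 6 by norm_num)]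
    gcongr
  have e4 : |f₃ / f ^ 2 - 6 * f₁ * f₂ / f ^ 3 + 6 * f₁ ^ 3 / f ^ 4| ≤
      C * a ^ 3 / c ^ 2 + 6 * (C * a) * (C * a ^ 2) / c ^ 3 + 6 * (C * a) ^ 3 / c ^ 4 :=
    (abs_add_le _ _).trans (add_le_add ((abs_sub _ _).trans (add_le_add e1 e2)) e3)
  calc _ ≤ |f₃| + |p ^ 2 * (f₃ / f ^ 2 - 6 * f₁ * f₂ / f ^ 3 + 6 * f₁ ^ 3 / f ^ 4)| := abs_sub _ _
    _ ≤ C * a ^ 3 + D ^ 2 * (C * a ^ 3 / c ^ 2 + 6 * (C * a) * (C * a ^ 2) / c ^ 3 +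
          6 * (C * a) ^ 3 / c ^ 4) := by
        rw [abs_mul, abs_of_nonneg (sq_nonneg p)]
        gcongr
    _ = _ := by ring

/-! ### Quadratic growth of the deviation at the best fit -/

namespace BinModel

variable {n : ℕ} {M : BinModel n} {p : ℕ → Fin n → ℝ} {b : ℕ → M.Param}

lemma IsBestFit.mem (h : M.IsBestFit p b) (k : ℕ) : b k ∈ M.params := by
  obtain ⟨r, C, hr, hrC⟩ := h.smooth_near
  exact (hrC k).1 (Metric.mem_ball_self hr)

lemma IsBestFit.deviation_le (h : M.IsBestFit p b) (k : ℕ) {θ : M.Param} (hθ : θ ∈ M.params) :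
    M.deviation k (p k) (b k) ≤ M.deviation k (p k) θ := by
  by_cases he : θ = b k
  · rw [he]
  · obtain ⟨κ, hκ, hs⟩ := h.separated ‖θ - b k‖ (norm_pos_iff.2 (sub_ne_zero.2 he))
    linarith [hs k θ hθ le_rfl]

/-- Around the best fit the rates are Lipschitz and bounded below, uniformly in the experiment. -/
lemma IsBestFit.exists_rate_bounds (h : M.IsBestFit p b) :
    ∃ r c C : ℝ, 0 < r ∧ 0 < c ∧ 0 < C ∧ ∀ k, Metric.ball (b k) r ⊆ M.params ∧
      ∀ θ ∈ Metric.ball (b k) r, M.pen k θ ≤ C ∧ ∀ i, c ≤ M.rate k θ i ∧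
        |M.rate k θ i - M.rate k (b k) i| ≤ C * ‖θ - b k‖ ∧
        ∀ j ∈ Finset.Icc 1 3, ‖iteratedFDeriv ℝ j (fun θ => M.rate k θ i) θ‖ ≤ C := by
  obtain ⟨r, C, hr, hrC⟩ := h.smooth_near
  obtain ⟨c, hc, hcb⟩ := h.rate_lower
  set D := max C 1 with hD
  have hD1 : 1 ≤ D := le_max_right _ _
  have hCD : C ≤ D := le_max_left _ _
  -- On this radius a D-Lipschitz rate drops by at most c/2.
  refine ⟨min r (c / (2 * D)), c / 2, D, by positivity, by positivity, by linarith, fun k => ?_⟩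
  have hsub : Metric.ball (b k) (min r (c / (2 * D))) ⊆ Metric.ball (b k) r :=
    Metric.ball_subset_ball (min_le_left _ _)
  refine ⟨hsub.trans (hrC k).1, fun θ hθ => ?_⟩
  have h2 := (hrC k).2 θ (hsub hθ)
  refine ⟨h2.1.trans hCD, fun i => ?_⟩
  have hlip : |M.rate k θ i - M.rate k (b k) i| ≤ D * ‖θ - b k‖ := by
    refine Convex.norm_image_sub_le_of_norm_fderiv_le (𝕜 := ℝ) (f := fun θ => M.rate k θ i)
      (s := Metric.ball (b k) r) (fun y hy => ?_) (fun y hy => ?_) (convex_ball _ _)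
      (Metric.mem_ball_self hr) (hsub hθ)
    · exact ((((M.rate_smooth k i).mono (hrC k).1).contDiffAt
        (Metric.isOpen_ball.mem_nhds hy)).differentiableAt (by norm_num))
    · rw [← norm_iteratedFDeriv_zero (𝕜 := ℝ) (f := fderiv ℝ _), norm_iteratedFDeriv_fderiv]
      exact (((hrC k).2 y hy).2 i 1 (by simp)).trans hCD
  refine ⟨?_, hlip, fun j hj => (h2.2 i j hj).trans hCD⟩
  have hn : ‖θ - b k‖ ≤ c / (2 * D) := by
    rw [Metric.mem_ball, dist_eq_norm] at hθ
    exact hθ.le.trans (min_le_right _ _)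
  have h3 : D * ‖θ - b k‖ ≤ c / 2 := by
    calc D * ‖θ - b k‖ ≤ D * (c / (2 * D)) := by gcongr
      _ = c / 2 := by field_simp
  linarith [(abs_le.1 hlip).1, hcb k i]

lemma contDiffOn_deviation (M : BinModel n) (k : ℕ) (q : Fin n → ℝ) {s : Set M.Param}
    (hs : s ⊆ M.params) : ContDiffOn ℝ 3 (M.deviation k q) s := by
  unfold deviation
  refine ContDiffOn.sum fun i _ => ?_
  have hr := (M.rate_smooth k i).mono hs
  exact ((contDiffOn_const.sub hr).pow 2).div hr fun θ hθ => (M.rate_pos k θ (hs hθ) i).ne'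

/-- Quadratic growth of the deviation at the best fit, uniformly in the experiment. -/
lemma IsBestFit.exists_quadratic_growth (h : M.IsBestFit p b) {D : ℝ}
    (hp : ∀ k i, |p k i| ≤ D) :
    ∃ r c : ℝ, 0 < r ∧ 0 < c ∧ ∀ k, ∀ θ : M.Param, ‖θ - b k‖ < r →
      M.deviation k (p k) (b k) + c * ‖θ - b k‖ ^ 2 ≤ M.deviation k (p k) θ := by
  obtain ⟨r, c, C, hr, hc, hC, hb⟩ := h.exists_rate_bounds
  obtain ⟨a, ha, hess⟩ := h.hessian
  set K := n * (C + D ^ 2 * (C / c ^ 2 + 6 * C * C / c ^ 3 + 6 * C ^ 3 / c ^ 4)) with hK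
  have hK0 : 0 ≤ K := by positivity
  -- Within a/(2(K + 1)) the cubic error K‖v‖³ is at most a/2 ‖v‖²; half of the remaining a/2 is the
  -- growth constant.
  refine ⟨min r (a / (2 * (K + 1))), a / 4, by positivity, by positivity, fun k θ hθ => ?_⟩
  set v := θ - b k with hv
  have hvr : ‖v‖ < r := hθ.trans_le (min_le_left _ _)
  have hva : ‖v‖ < a / (2 * (K + 1)) := hθ.trans_le (min_le_right _ _)
  have hball : ∀ s ∈ Set.Icc (0 : ℝ) 1, b k + s • v ∈ Metric.ball (b k) r := by
    intro s hs
    rw [Metric.mem_ball, dist_eq_norm, add_sub_cancel_left, norm_smul, Real.norm_of_nonneg hs.1]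
    nlinarith [hs.2, norm_nonneg v]
  have hopen : ∀ᶠ s : ℝ in 𝓝 0, b k + s • v ∈ Metric.ball (b k) r := by
    have : Continuous fun s : ℝ => b k + s • v := by fun_prop
    exact this.continuousAt.eventually (Metric.isOpen_ball.mem_nhds (hball 0 (by simp)))
  -- Two descriptions of the same derivatives: those assembled from the rates give the third-order
  -- bound, those of the whole deviation give the Hessian. Uniqueness of derivatives identifies
  -- them.
  choose f₁ f₂ f₃ hf using fun i => exists_line_derivs (h := v)
    ((M.rate_smooth k i).mono (hb k).1)
  obtain ⟨F₁, F₂, F₃, hF, hF2⟩ := exists_line_derivs (h := v)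
    (M.contDiffOn_deviation k (p k) (hb k).1)
  have hpear := fun i s (hs : b k + s • v ∈ Metric.ball (b k) r) =>
    hasDerivAt_pearson (p := p k i) (f := fun s : ℝ => M.rate k (b k + s • v) i) (s := s)
      (hc.trans_le (((hb k).2 _ hs).2 i).1).ne' ((hf i).1 s hs).1 ((hf i).1 s hs).2.1
      ((hf i).1 s hs).2.2.1
  have d1 := fun s hs => HasDerivAt.fun_sum fun i (_ : i ∈ Finset.univ) => (hpear i s hs).1
  have d2 := fun s hs => HasDerivAt.fun_sum fun i (_ : i ∈ Finset.univ) => (hpear i s hs).2.1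
  have d3 := fun s hs => HasDerivAt.fun_sum fun i (_ : i ∈ Finset.univ) => (hpear i s hs).2.2
  have key := taylor_lower_bound (K := K * ‖v‖ ^ 3) (fun s hs => d1 s (hball s hs))
    (fun s hs => d2 s (hball s hs)) (fun s hs => d3 s (hball s hs)) ?_
  -- The best fit is an interior minimum, so the first-order term vanishes.
  · have z1 : ∑ i, (f₁ i 0 - p k i ^ 2 * (f₁ i 0 / M.rate k (b k + (0 : ℝ) • v) i ^ 2)) = 0 := by
      refine IsLocalMin.hasDerivAt_eq_zero ?_ (d1 0 (hball 0 (by simp)))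
      filter_upwards [hopen] with s hs
      have := h.deviation_le k ((hb k).1 hs)
      simpa [deviation] using this
    have z2 : ∑ i, (f₂ i 0 - p k i ^ 2 * (f₂ i 0 / M.rate k (b k + (0 : ℝ) • v) i ^ 2 -
        2 * f₁ i 0 ^ 2 / M.rate k (b k + (0 : ℝ) • v) i ^ 3)) = F₂ 0 := by
      have hev : F₁ =ᶠ[𝓝 0] fun s => ∑ i, (f₁ i s - p k i ^ 2 *
          (f₁ i s / M.rate k (b k + s • v) i ^ 2)) := by
        filter_upwards [hopen] with s hs
        exact (hF s hs).1.unique (d1 s hs)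
      exact ((d2 0 (hball 0 (by simp))).congr_of_eventuallyEq hev).unique
        (hF 0 (hball 0 (by simp))).2.1
    rw [z1, z2, hF2] at key
    have hq := hess k v
    have e0 : ∑ i, (p k i - M.rate k (b k + (0 : ℝ) • v) i) ^ 2 / M.rate k (b k + (0 : ℝ) • v) i =
        M.deviation k (p k) (b k) := by simp [deviation]
    have e1 : ∑ i, (p k i - M.rate k (b k + (1 : ℝ) • v) i) ^ 2 / M.rate k (b k + (1 : ℝ) • v) i =
        M.deviation k (p k) θ := by simp [deviation, hv]
    rw [e0, e1] at key
    have hcub : K * ‖v‖ ^ 3 ≤ a / 2 * ‖v‖ ^ 2 := by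
      have h1 : K * ‖v‖ ≤ a / 2 := by
        rw [lt_div_iff₀ (by positivity)] at hva
        nlinarith [norm_nonneg v]
      calc K * ‖v‖ ^ 3 = K * ‖v‖ * ‖v‖ ^ 2 := by ring
        _ ≤ _ := by gcongr
    linarith
  · intro s hs
    have hs' := hball s hs
    refine (Finset.abs_sum_le_sum_abs _ _).trans ?_
    calc _ ≤ ∑ _i : Fin n, (C + D ^ 2 * (C / c ^ 2 + 6 * C * C / c ^ 3 + 6 * C ^ 3 / c ^ 4)) *
          ‖v‖ ^ 3 := by
          refine Finset.sum_le_sum fun i _ => ?_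
          have hd := (((hb k).2 _ hs').2 i).2.2
          obtain ⟨-, -, -, b1, b2, b3⟩ := (hf i).1 s hs'
          refine abs_pearson_third_deriv_le (norm_nonneg v) hc hC.le (hp k i)
            (((hb k).2 _ hs').2 i).1 (b1.trans ?_) (b2.trans ?_) (b3.trans ?_)
          · gcongr; exact hd 1 (by simp)
          · gcongr; exact hd 2 (by simp)
          · gcongr; exact hd 3 (by simp)
      _ = K * ‖v‖ ^ 3 := by simp [hK]; ring

end BinModel

/-! ### Stability of the deviation under perturbation of the data -/

namespace BinModel

variable {n : ℕ} {M : BinModel n} {p : ℕ → Fin n → ℝ} {b : ℕ → M.Param} {m : ℕ → ℝ}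

lemma chiSq_eq_mul_deviation {k : ℕ} (hm : 0 < m k) (θ : M.Param) (x : Fin n → ℝ) :
    M.chiSq m k θ x = m k * M.deviation k (fun i => x i / m k) θ := by
  unfold chiSq deviation mean
  rw [Finset.mul_sum]
  refine Finset.sum_congr rfl fun i _ => ?_
  by_cases h : M.rate k θ i = 0
  · simp [h]
  · field_simp

lemma deviation_nonneg {k : ℕ} {θ : M.Param} (hθ : θ ∈ M.params) (q : Fin n → ℝ) :
    0 ≤ M.deviation k q θ :=
  Finset.sum_nonneg fun i _ => div_nonneg (sq_nonneg _) (M.rate_pos k θ hθ i).le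

lemma sq_sub_le_rate_mul_deviation {k : ℕ} {θ : M.Param} (hθ : θ ∈ M.params) (q : Fin n → ℝ)
    (i : Fin n) : (q i - M.rate k θ i) ^ 2 ≤ M.rate k θ i * M.deviation k q θ := by
  have h0 := M.rate_pos k θ hθ i
  have h1 : (q i - M.rate k θ i) ^ 2 / M.rate k θ i ≤ M.deviation k q θ :=
    Finset.single_le_sum (f := fun i => (q i - M.rate k θ i) ^ 2 / M.rate k θ i)
      (fun j _ => div_nonneg (sq_nonneg _) (M.rate_pos k θ hθ j).le) (Finset.mem_univ i)
  rwa [div_le_iff₀' h0] at h1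

/-- Rates are bounded in terms of the deviation. -/
lemma rate_le_of_deviation_le {k : ℕ} {θ : M.Param} (hθ : θ ∈ M.params) {q : Fin n → ℝ} {S C : ℝ}
    (hS : M.deviation k q θ ≤ S) {i : Fin n} (hq : q i ≤ C) : M.rate k θ i ≤ S + 2 * C := by
  have h0 := M.rate_pos k θ hθ i
  have h1 := (M.sq_sub_le_rate_mul_deviation hθ q i).trans (mul_le_mul_of_nonneg_left hS h0.le)
  have h2 : M.rate k θ i * M.rate k θ i ≤ M.rate k θ i * (S + 2 * C) := by
    nlinarith [sq_nonneg (q i)]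
  exact le_of_mul_le_mul_left h2 h0

/-- Stability of the deviation far from the best fit under perturbations of the data. -/
lemma deviation_ge_of_near {k : ℕ} {θ : M.Param} (hθ : θ ∈ M.params) {q y : Fin n → ℝ}
    {c C η : ℝ} (hc : 0 < c) (hq : ∀ i, c ≤ q i ∧ q i ≤ C) (hη : η ≤ c / 2)
    (hy : ∀ i, |y i - q i| ≤ η) :
    (1 - 2 * (η / c)) * M.deviation k q θ - n * (6 * (η / c) * C) ≤ M.deviation k y θ := by
  -- Far from the best fit the rates λ may be arbitrarily small, so the loss in q²/λ must be
  -- multiplicative. In y²/λ - 2y + λ with e = η/c one has y² ≥ (1 - 2e)q² and y ≤ (1 + e)q; the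
  -- linear terms cost 4eq + 2eq.
  have h : ∀ i, (1 - 2 * (η / c)) * ((q i - M.rate k θ i) ^ 2 / M.rate k θ i) - 6 * (η / c) * C ≤
      (y i - M.rate k θ i) ^ 2 / M.rate k θ i := by
    intro i
    have ht := M.rate_pos k θ hθ i
    have hyi := abs_le.1 (hy i)
    have hη0 : 0 ≤ η := (abs_nonneg _).trans (hy i)
    set e := η / c with he
    have he0 : 0 ≤ e := by positivity
    have he1 : e ≤ 1 / 2 := by rw [he, div_le_iff₀ hc]; linarith
    have hec : η = e * c := by rw [he]; field_simp
    have hqi := hq i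
    have hq0 : 0 < q i := hc.trans_le hqi.1
    have h1 : η ≤ e * q i := by rw [hec]; nlinarith
    have h2 : (1 - e) * q i ≤ y i := by nlinarith
    have h3 : (1 - 2 * e) * q i ^ 2 ≤ y i ^ 2 := by
      have : ((1 - e) * q i) ^ 2 ≤ y i ^ 2 :=
        pow_le_pow_left₀ (mul_nonneg (by linarith) hq0.le) h2 2
      nlinarith [sq_nonneg (e * q i)]
    have h4 : 6 * e * q i ≤ 6 * e * C := by nlinarith
    rw [mul_div_assoc', sub_le_iff_le_add, div_le_iff₀ ht, add_mul, div_mul_cancel₀ _ ht.ne']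
    nlinarith [mul_nonneg he0 ht.le, mul_nonneg (mul_nonneg he0 ht.le) ht.le,
      mul_le_mul_of_nonneg_right h4 ht.le, mul_le_mul_of_nonneg_right hyi.2 ht.le,
      mul_le_mul_of_nonneg_right h1 ht.le]
  have h2 := Finset.sum_le_sum fun i (_ : i ∈ Finset.univ) => h i
  rw [Finset.sum_sub_distrib, ← Finset.mul_sum] at h2
  simp only [Finset.sum_const, Finset.card_univ, Fintype.card_fin, nsmul_eq_mul] at h2
  exact h2

lemma deviation_le_of_near {k : ℕ} {θ : M.Param} {q y : Fin n → ℝ} {c C η : ℝ} (hc : 0 < c)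
    (hr : ∀ i, c ≤ M.rate k θ i) (hq : ∀ i, |q i| ≤ C) (hη : η ≤ 1)
    (hy : ∀ i, |y i - q i| ≤ η) :
    M.deviation k y θ ≤ M.deviation k q θ + n * ((2 * C + 1) / c + 2) * η := by
  have h : ∀ i, (y i - M.rate k θ i) ^ 2 / M.rate k θ i ≤
      (q i - M.rate k θ i) ^ 2 / M.rate k θ i + ((2 * C + 1) / c + 2) * η := by
    intro i
    have ht := hc.trans_le (hr i)
    have hη0 : 0 ≤ η := (abs_nonneg _).trans (hy i)
    have hC : 0 ≤ C := (abs_nonneg _).trans (hq i)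
    have e : (y i - M.rate k θ i) ^ 2 / M.rate k θ i = (q i - M.rate k θ i) ^ 2 / M.rate k θ i +
        ((y i - q i) * (2 * q i + (y i - q i)) / M.rate k θ i - 2 * (y i - q i)) := by
      field_simp; ring
    rw [e, add_le_add_iff_left]
    have h1 : |(y i - q i) * (2 * q i + (y i - q i)) / M.rate k θ i| ≤ η * (2 * C + 1) / c := by
      rw [abs_div, abs_mul, abs_of_pos ht]
      have : |2 * q i + (y i - q i)| ≤ 2 * C + 1 := by
        refine (abs_add_le _ _).trans ?_
        rw [abs_mul, abs_two]
        linarith [hq i, hy i]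
      gcongr
      · exact hy i
      · exact hr i
    have h2 := le_of_abs_le h1
    have h3 := (abs_le.1 (hy i)).1
    have e2 : ((2 * C + 1) / c + 2) * η = η * (2 * C + 1) / c + 2 * η := by ring
    rw [e2]
    linarith
  have h2 := Finset.sum_le_sum fun i (_ : i ∈ Finset.univ) => h i
  rw [Finset.sum_add_distrib] at h2
  simp only [Finset.sum_const, Finset.card_univ, Fintype.card_fin, nsmul_eq_mul] at h2
  unfold deviation
  linarith

lemma abs_inv_sub_inv_le {a b c d : ℝ} (hc : 0 < c) (ha : c ≤ a) (hb : c ≤ b) (h : |a - b| ≤ d) :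
    |a⁻¹ - b⁻¹| ≤ d / c ^ 2 := by
  have ha0 := hc.trans_le ha
  have hb0 := hc.trans_le hb
  have e : a⁻¹ - b⁻¹ = -(a - b) / (a * b) := by field_simp; ring
  have hd : 0 ≤ d := (abs_nonneg _).trans h
  rw [e, abs_div, abs_neg, abs_of_pos (mul_pos ha0 hb0)]
  calc |a - b| / (a * b) ≤ d / (c * c) := by gcongr
    _ = d / c ^ 2 := by ring

/-- Perturbing the data changes the increments of the deviation in proportion to those of the
rates. -/
lemma abs_deviation_sub_sub_le {k : ℕ} {θ θ' : M.Param} (hθ : θ ∈ M.params) (hθ' : θ' ∈ M.params)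
    {q y : Fin n → ℝ} {c C L η : ℝ} (hc : 0 < c) (hq : ∀ i, |q i| ≤ C) (hη : η ≤ 1)
    (hy : ∀ i, |y i - q i| ≤ η) (hr : ∀ i, c ≤ M.rate k θ i) (hr' : ∀ i, c ≤ M.rate k θ' i)
    (hL : ∀ i, |M.rate k θ i - M.rate k θ' i| ≤ L) :
    |(M.deviation k y θ - M.deviation k y θ') - (M.deviation k q θ - M.deviation k q θ')| ≤
      n * ((2 * C + 1) * (L / c ^ 2)) * η := by
  -- In an increment in θ the data enter only through y²/λ, since the terms -2y and λ cancel; and y²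
  -- - q² = (y - q)(2q + (y - q)).
  have e : (M.deviation k y θ - M.deviation k y θ') -
      (M.deviation k q θ - M.deviation k q θ') =
      ∑ i, (y i - q i) * (2 * q i + (y i - q i)) *
        ((M.rate k θ i)⁻¹ - (M.rate k θ' i)⁻¹) := by
    unfold deviation
    rw [← Finset.sum_sub_distrib, ← Finset.sum_sub_distrib, ← Finset.sum_sub_distrib]
    refine Finset.sum_congr rfl fun i _ => ?_
    have := (M.rate_pos k θ hθ i).ne'
    have := (M.rate_pos k θ' hθ' i).ne'
    field_simp
    ring
  rw [e]
  refine (Finset.abs_sum_le_sum_abs _ _).trans ?_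
  calc _ ≤ ∑ _i : Fin n, η * (2 * C + 1) * (L / c ^ 2) := by
        refine Finset.sum_le_sum fun i _ => ?_
        rw [abs_mul, abs_mul]
        have hη0 : 0 ≤ η := (abs_nonneg _).trans (hy i)
        have hC0 : 0 ≤ C := (abs_nonneg _).trans (hq i)
        have h1 : |2 * q i + (y i - q i)| ≤ 2 * C + 1 := by
          refine (abs_add_le _ _).trans ?_
          rw [abs_mul, abs_two]
          linarith [hq i, hy i]
        have h2 := abs_inv_sub_inv_le hc (hr i) (hr' i) (hL i)
        gcongr
        exact hy i
    _ = _ := by simp; ring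

/-- Growth of the deviation from perturbed data around the best fit to the unperturbed ones. -/
lemma IsBestFit.exists_perturbed_growth (h : M.IsBestFit p b) {c C S : ℝ} (hc : 0 < c)
    (hp : ∀ k i, c ≤ p k i ∧ p k i ≤ C) (hS : ∀ᶠ k in atTop, M.deviation k (p k) (b k) ≤ S)
    {r₀ : ℝ} (hr₀ : 0 < r₀) :
    ∃ η₀ κ A : ℝ, 0 < η₀ ∧ 0 < κ ∧ 0 < A ∧ ∀ᶠ k in atTop, ∀ (y : Fin n → ℝ) (η : ℝ), 0 ≤ η →
      η ≤ η₀ → (∀ i, |y i - p k i| ≤ η) → ∀ θ ∈ M.params,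
        M.deviation k y (b k) - A * η ^ 2 ≤ M.deviation k y θ ∧
        ∀ W : ℝ, 0 ≤ W → W ≤ κ → M.deviation k y θ ≤ M.deviation k y (b k) + W →
          ‖θ - b k‖ < r₀ ∧ ‖θ - b k‖ ^ 2 ≤ A * (W + η ^ 2) := by
  obtain ⟨r₁, c₁, C₁, hr₁, hc₁, hC₁, hb⟩ := h.exists_rate_bounds
  have hpabs : ∀ k i, |p k i| ≤ C := fun k i => by
    rw [abs_of_pos (hc.trans_le (hp k i).1)]; exact (hp k i).2
  obtain ⟨r₂, a, hr₂, ha, hgrow⟩ := h.exists_quadratic_growth hpabs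
  obtain ⟨κ₀, hκ₀, hsep⟩ := h.separated (min r₀ (min r₁ r₂)) (by positivity)
  -- `V` bounds the perturbation of the deviation, `B` that of its increments near the best fit
  set V := 2 / c * (|S| + κ₀) + n * (6 / c * |C|) + n * ((2 * |C| + 1) / c₁ + 2) + 1 with hV
  have hV0 : 0 < V := by positivity
  set B := n * ((2 * |C| + 1) * (C₁ / c₁ ^ 2)) with hB
  have hB0 : 0 ≤ B := by positivity
  -- With Vη ≤ κ₀/2, half of the separation survives far from the best fit, and an excess of at most
  -- κ₀/4 then excludes such parameters. The last constant collects those of the two near bounds.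
  refine ⟨min (min 1 (c / 2)) (κ₀ / (2 * V)), κ₀ / 4, B ^ 2 / (2 * a) + B ^ 2 / a ^ 2 + 2 / a + 1,
    by positivity, by positivity, by positivity, ?_⟩
  filter_upwards [hS] with k hSk y η hη0 hη hy θ hθ
  have hη1 : η ≤ 1 := hη.trans ((min_le_left _ _).trans (min_le_left _ _))
  have hη2 : η ≤ c / 2 := hη.trans ((min_le_left _ _).trans (min_le_right _ _))
  have hη3 : V * η ≤ κ₀ / 2 := by
    have := hη.trans (min_le_right _ _)
    rw [le_div_iff₀ (by positivity)] at this
    linarith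
  have hbm := h.mem k
  have hbb := (hb k).2 (b k) (Metric.mem_ball_self hr₁)
  have hη2' : 0 ≤ η ^ 2 := sq_nonneg η
  by_cases hnear : ‖θ - b k‖ < min r₀ (min r₁ r₂)
  · have hn0 : ‖θ - b k‖ < r₀ := hnear.trans_le (min_le_left _ _)
    have hn1 : ‖θ - b k‖ < r₁ := hnear.trans_le ((min_le_right _ _).trans (min_le_left _ _))
    have hn2 : ‖θ - b k‖ < r₂ := hnear.trans_le ((min_le_right _ _).trans (min_le_right _ _))
    have hθb := (hb k).2 θ (by rwa [Metric.mem_ball, dist_eq_norm])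
    have hg := hgrow k θ hn2
    set t := ‖θ - b k‖ with ht
    have ht0 : 0 ≤ t := norm_nonneg _
    have hdiff := abs_deviation_sub_sub_le (k := k) hθ hbm hc₁ (C := |C|) (L := C₁ * t)
      (fun i => (hpabs k i).trans (le_abs_self C)) hη1 hy (fun i => (hθb.2 i).1)
      (fun i => (hbb.2 i).1) (fun i => (hθb.2 i).2.1)
    have eB : n * ((2 * |C| + 1) * (C₁ * t / c₁ ^ 2)) * η = B * η * t := by rw [hB]; ring
    rw [eB] at hdiff
    have hlow : M.deviation k y (b k) + a * t ^ 2 - B * η * t ≤ M.deviation k y θ := by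
      linarith [(abs_le.1 hdiff).1]
    -- Completing the square: half of the quadratic growth absorbs the perturbation, at a cost of
    -- order η².
    have hsq : B * η * t ≤ a / 2 * t ^ 2 + B ^ 2 / (2 * a) * η ^ 2 := by
      have : 0 ≤ (a * t - B * η) ^ 2 / (2 * a) := by positivity
      have e : (a * t - B * η) ^ 2 / (2 * a) = a / 2 * t ^ 2 + B ^ 2 / (2 * a) * η ^ 2 -
        B * η * t := by field_simp; ring
      linarith
    refine ⟨?_, fun W hW0 hW hdev => ⟨hn0, ?_⟩⟩
    · have h1 : 0 ≤ a / 2 * t ^ 2 := by positivity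
      have h2 : B ^ 2 / (2 * a) * η ^ 2 ≤
          (B ^ 2 / (2 * a) + B ^ 2 / a ^ 2 + 2 / a + 1) * η ^ 2 := by
        gcongr
        linarith [show 0 ≤ B ^ 2 / a ^ 2 + 2 / a by positivity]
      linarith
    · have h3 : a / 2 * t ^ 2 ≤ W + B ^ 2 / (2 * a) * η ^ 2 := by linarith
      have h4 : t ^ 2 ≤ 2 / a * W + B ^ 2 / a ^ 2 * η ^ 2 := by
        have := mul_le_mul_of_nonneg_left h3 (show 0 ≤ 2 / a by positivity)
        have e1 : 2 / a * (a / 2 * t ^ 2) = t ^ 2 := by field_simp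
        have e2 : 2 / a * (W + B ^ 2 / (2 * a) * η ^ 2) = 2 / a * W + B ^ 2 / a ^ 2 * η ^ 2 := by
          field_simp
        linarith
      rw [mul_add]
      refine h4.trans (add_le_add ?_ ?_)
      · gcongr
        linarith [show 0 ≤ B ^ 2 / (2 * a) + B ^ 2 / a ^ 2 by positivity]
      · gcongr
        linarith [show 0 ≤ B ^ 2 / (2 * a) + 2 / a by positivity]
  · push Not at hnear
    have h1 := hsep k θ hθ hnear
    have h2 := M.deviation_ge_of_near (k := k) hθ hc (hp k) hη2 hy
    have h3 := M.deviation_le_of_near (k := k) hc₁ (fun i => (hbb.2 i).1)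
      (fun i => (hpabs k i).trans (le_abs_self C)) hη1 hy
    have hd0 := M.deviation_nonneg (k := k) hbm (p k)
    have hfar : M.deviation k y (b k) + κ₀ / 2 ≤ M.deviation k y θ := by
      have e1 : (1 - 2 * (η / c)) * (M.deviation k (p k) (b k) + κ₀) ≤
          (1 - 2 * (η / c)) * M.deviation k (p k) θ := by
        refine mul_le_mul_of_nonneg_left h1 ?_
        have : η / c ≤ 1 / 2 := by rw [div_le_iff₀ hc]; linarith
        linarith
      have e2 : 2 * (η / c) * (M.deviation k (p k) (b k) + κ₀) ≤ 2 * (η / c) * (|S| + κ₀) := by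
        gcongr
        exact hSk.trans (le_abs_self S)
      have e3 : (n : ℝ) * (6 * (η / c) * C) ≤ n * (6 * (η / c) * |C|) := by
        gcongr
        exact le_abs_self C
      have e4 : V * η = 2 * (η / c) * (|S| + κ₀) + n * (6 * (η / c) * |C|) +
          n * ((2 * |C| + 1) / c₁ + 2) * η + η := by rw [hV]; ring
      linarith
    refine ⟨?_, fun W hW0 hW hdev => ?_⟩
    · have : 0 ≤ (B ^ 2 / (2 * a) + B ^ 2 / a ^ 2 + 2 / a + 1) * η ^ 2 := by positivity
      linarith
    · exfalso; linarith

end BinModel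

/-! ### Chi-square of data at distance of order √m from their means -/

namespace BinModel

variable {n : ℕ} {M : BinModel n} {p : ℕ → Fin n → ℝ} {b : ℕ → M.Param} {m : ℕ → ℝ}

/-- The part of the chi-square at the parameters `b` that is linear in the deviation of the data
from their means. -/
noncomputable def linearPart (M : BinModel n) (p : ℕ → Fin n → ℝ) (b : ℕ → M.Param) (m : ℕ → ℝ)
    (k : ℕ) (x : Fin n → ℝ) : ℝ :=
  2 * ∑ i, (p k i - M.rate k (b k) i) / M.rate k (b k) i * (x i - m k * p k i)

lemma chiSq_eq_add_linearPart {k : ℕ} (hm : 0 < m k) (hb : b k ∈ M.params) (x : Fin n → ℝ) :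
    M.chiSq m k (b k) x = m k * M.deviation k (p k) (b k) + M.linearPart p b m k x +
      ∑ i, (x i - m k * p k i) ^ 2 / (m k * M.rate k (b k) i) := by
  unfold chiSq deviation linearPart mean
  rw [Finset.mul_sum, Finset.mul_sum, ← Finset.sum_add_distrib, ← Finset.sum_add_distrib]
  refine Finset.sum_congr rfl fun i _ => ?_
  have := (M.rate_pos k (b k) hb i).ne'
  field_simp
  ring

lemma sq_le_of_near {K u t : ℝ} (ht : 0 ≤ t) (h : |u| ≤ K * √t) : u ^ 2 ≤ K ^ 2 * t := by
  calc u ^ 2 = |u| ^ 2 := (sq_abs u).symm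
    _ ≤ (K * √t) ^ 2 := by gcongr
    _ = K ^ 2 * t := by rw [mul_pow, Real.sq_sqrt ht]

lemma sum_sq_div_le {k : ℕ} (hm : 0 < m k) {c K : ℝ} (hc : 0 < c)
    (hr : ∀ i, c ≤ M.rate k (b k) i) {x : Fin n → ℝ}
    (hx : ∀ i, |x i - m k * p k i| ≤ K * √(m k)) :
    ∑ i, (x i - m k * p k i) ^ 2 / (m k * M.rate k (b k) i) ≤ n * (K ^ 2 / c) := by
  calc _ ≤ ∑ _i : Fin n, K ^ 2 / c := by
        refine Finset.sum_le_sum fun i _ => ?_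
        have h1 := sq_le_of_near hm.le (hx i)
        calc _ ≤ K ^ 2 * m k / (m k * c) := by
              gcongr
              exact hr i
          _ = K ^ 2 / c := by field_simp
    _ = _ := by simp

/-- The chi-square of data near their means, at and around the best fit. -/
lemma IsBestFit.exists_chiSq_growth (h : M.IsBestFit p b) {c C S : ℝ} (hc : 0 < c)
    (hp : ∀ k i, c ≤ p k i ∧ p k i ≤ C) (hS : ∀ᶠ k in atTop, M.deviation k (p k) (b k) ≤ S)
    (hm0 : ∀ k, 0 < m k) (hm : Tendsto m atTop atTop) {r₀ : ℝ} (hr₀ : 0 < r₀) {K : ℝ}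
    (hK : 0 < K) :
    ∃ κ A : ℝ, 0 < κ ∧ 0 < A ∧ ∀ᶠ k in atTop, ∀ x : Fin n → ℝ,
      (∀ i, |x i - m k * p k i| ≤ K * √(m k)) →
      |M.chiSq m k (b k) x -
        (m k * M.deviation k (p k) (b k) + M.linearPart p b m k x)| ≤ A ∧
      ∀ θ ∈ M.params, M.chiSq m k (b k) x - A ≤ M.chiSq m k θ x ∧
        ∀ W : ℝ, 0 ≤ W → W ≤ κ * m k → M.chiSq m k θ x ≤ M.chiSq m k (b k) x + W →
          ‖θ - b k‖ < r₀ ∧ m k * ‖θ - b k‖ ^ 2 ≤ A * (W + 1) := by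
  obtain ⟨η₀, κ, A, hη₀, hκ, hA, hev⟩ := h.exists_perturbed_growth hc hp hS hr₀
  obtain ⟨c₁, hc₁, hr⟩ := h.rate_lower
  refine ⟨κ, A * (K ^ 2 + 1) + n * (K ^ 2 / c₁), hκ, by positivity, ?_⟩
  have hsq : Tendsto (fun k => √(m k)) atTop atTop := Real.tendsto_sqrt_atTop.comp hm
  filter_upwards [hev, hsq.eventually_ge_atTop (K / η₀)] with k hk hbig x hx
  have hmk := hm0 k
  have hs : 0 < √(m k) := Real.sqrt_pos.2 hmk
  have hss : √(m k) ^ 2 = m k := Real.sq_sqrt hmk.le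
  have hnn : 0 ≤ n * (K ^ 2 / c₁) := by positivity
  constructor
  · rw [chiSq_eq_add_linearPart (p := p) hmk (h.mem k), add_sub_cancel_left, abs_of_nonneg]
    · have := sum_sq_div_le hmk hc₁ (hr k) hx
      linarith [show 0 ≤ A * (K ^ 2 + 1) by positivity]
    · exact Finset.sum_nonneg fun i _ => div_nonneg (sq_nonneg _)
        (mul_pos hmk (M.rate_pos k _ (h.mem k) i)).le
  intro θ hθ
  -- Per unit of exposure the perturbation is K/√m; its square times m is the constant K², which is
  -- why minimizing costs only O(1).
  obtain ⟨h1, h2⟩ := hk (fun i => x i / m k) (K / √(m k)) (by positivity)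
    (by rw [div_le_iff₀ hs]; rwa [div_le_iff₀ hη₀, mul_comm] at hbig)
    (fun i => by
      have e : x i / m k - p k i = (x i - m k * p k i) / m k := by field_simp
      rw [e, abs_div, abs_of_pos hmk, div_le_div_iff₀ hmk hs]
      have := hx i
      calc |x i - m k * p k i| * √(m k) ≤ K * √(m k) * √(m k) := by gcongr
        _ = K * m k := by rw [mul_assoc, ← sq, hss]) θ hθ
  have hη : m k * (K / √(m k)) ^ 2 = K ^ 2 := by rw [div_pow, hss]; field_simp
  rw [M.chiSq_eq_mul_deviation hmk, M.chiSq_eq_mul_deviation hmk]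
  constructor
  · have h3 := mul_le_mul_of_nonneg_left h1 hmk.le
    have e : m k * (M.deviation k (fun i => x i / m k) (b k) - A * (K / √(m k)) ^ 2) =
        m k * M.deviation k (fun i => x i / m k) (b k) - A * K ^ 2 := by
      rw [mul_sub, ← hη]; ring
    rw [e] at h3
    linarith
  · intro W hW0 hW hdev
    obtain ⟨h4, h5⟩ := h2 (W / m k) (by positivity) (by rwa [div_le_iff₀ hmk]) (by
      refine le_of_mul_le_mul_left ?_ hmk
      rw [mul_add, mul_div_cancel₀ _ hmk.ne']
      exact hdev)
    refine ⟨h4, ?_⟩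
    have h6 := mul_le_mul_of_nonneg_left h5 hmk.le
    have e : m k * (A * (W / m k + (K / √(m k)) ^ 2)) = A * (W + K ^ 2) := by
      rw [← hη]; field_simp
    rw [e] at h6
    refine h6.trans ?_
    calc A * (W + K ^ 2) ≤ A * (K ^ 2 + 1) * (W + 1) := by
          rw [mul_assoc]
          gcongr
          nlinarith [sq_nonneg K, mul_nonneg (sq_nonneg K) hW0]
      _ ≤ _ := by
          gcongr
          linarith

/-! ### Fits whose deviation per unit of exposure vanishes -/

/-- The parameters `b` predict rates that approach the true rates `p`, under uniform bounds. -/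
structure IsCloseFit (M : BinModel n) (p : ℕ → Fin n → ℝ) (b : ℕ → M.Param) (c C : ℝ) : Prop where
  pos : 0 < c
  mem : ∀ k, b k ∈ M.params
  le_rate : ∀ k i, c ≤ M.rate k (b k) i
  bounds : ∀ k i, c ≤ p k i ∧ p k i ≤ C
  pen_le : ∀ k, M.pen k (b k) ≤ C
  tendsto : Tendsto (fun k => M.deviation k (p k) (b k)) atTop (𝓝 0)

lemma IsTruth.exists_isCloseFit {a : ℕ → M.Param} (h : M.IsTruth a) :
    ∃ c C : ℝ, M.IsCloseFit (fun k => M.rate k (a k)) a c C := by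
  obtain ⟨c, C, hc, hb⟩ := h.rate_bounds
  obtain ⟨C', hC'⟩ := h.pen_bound
  refine ⟨c, max C C', hc, h.mem, fun k i => (hb k i).1,
    fun k i => ⟨(hb k i).1, (hb k i).2.trans (le_max_left _ _)⟩,
    fun k => (hC' k).trans (le_max_right _ _), ?_⟩
  simp [deviation]

lemma IsBestFit.exists_isCloseFit (h : M.IsBestFit p b) {c C : ℝ} (hc : 0 < c)
    (hp : ∀ k i, c ≤ p k i ∧ p k i ≤ C)
    (hdev : Tendsto (fun k => M.deviation k (p k) (b k)) atTop (𝓝 0)) :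
    ∃ c C : ℝ, M.IsCloseFit p b c C := by
  obtain ⟨c₁, hc₁, hr⟩ := h.rate_lower
  obtain ⟨r, C₁, hr1, hrC⟩ := h.smooth_near
  exact ⟨min c c₁, max C C₁, lt_min hc hc₁, h.mem, fun k i => (min_le_right _ _).trans (hr k i),
    fun k i => ⟨(min_le_left _ _).trans (hp k i).1, (hp k i).2.trans (le_max_left _ _)⟩,
    fun k => (((hrC k).2 _ (Metric.mem_ball_self hr1)).1).trans (le_max_right _ _), hdev⟩

namespace IsCloseFit

variable {c C : ℝ}

lemma upper_pos (h : M.IsCloseFit p b c C) (k : ℕ) : 0 ≤ C :=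
  (M.pen_nonneg k _ (h.mem k)).trans (h.pen_le k)

/-- Up to a constant, this ratio bounds the squared relative errors of all competing parameters. -/
lemma tendsto_one_add_div (h : M.IsCloseFit p b c C) (hm0 : ∀ k, 0 < m k)
    (hm : Tendsto m atTop atTop) :
    Tendsto (fun k => (1 + m k * M.deviation k (p k) (b k)) / m k) atTop (𝓝 0) := by
  have h1 := (tendsto_inv_atTop_zero.comp hm).add h.tendsto
  rw [add_zero] at h1
  refine h1.congr fun k => ?_
  have := (hm0 k).ne'
  simp only [Function.comp]
  field_simp

/-- The squared rate differences are bounded by a multiple of the deviation. -/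
lemma eventually_sq_sub_le (h : M.IsCloseFit p b c C) : ∀ᶠ k in atTop, ∀ i,
    (p k i - M.rate k (b k) i) ^ 2 ≤ (1 + 2 * C) * M.deviation k (p k) (b k) := by
  filter_upwards [h.tendsto.eventually (gt_mem_nhds one_pos)] with k hk i
  refine (M.sq_sub_le_rate_mul_deviation (h.mem k) (p k) i).trans ?_
  have := M.rate_le_of_deviation_le (h.mem k) hk.le (h.bounds k i).2
  have := M.deviation_nonneg (k := k) (h.mem k) (p k)
  gcongr

lemma eventually_abs_sub_le (h : M.IsCloseFit p b c C) {ε : ℝ} (hε : 0 < ε) :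
    ∀ᶠ k in atTop, ∀ i, |p k i - M.rate k (b k) i| ≤ ε := by
  have hC := h.upper_pos 0
  have h1 := h.tendsto.const_mul (1 + 2 * C)
  rw [mul_zero] at h1
  filter_upwards [h.eventually_sq_sub_le, h1.eventually (gt_mem_nhds (pow_pos hε 2))]
    with k hk h2 i
  exact abs_le_of_sq_le_sq ((hk i).trans h2.le) hε.le

/-- Supplies the size and closeness conditions under which the estimates for single bins apply at
`b`. -/
lemma eventually_near (h : M.IsCloseFit p b c C) (hm0 : ∀ k, 0 < m k)
    (hm : Tendsto m atTop atTop) (K : ℝ) : ∀ᶠ k in atTop, ∀ x : Fin n → ℝ,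
      (∀ i, |x i - m k * p k i| ≤ K * √(m k)) → ∀ i, m k * c / 2 ≤ x i ∧ 2 ≤ x i ∧
        |M.mean m k (b k) i - x i| ≤ x i / 2 := by
  have hc := h.pos
  have hsq : Tendsto (fun k => √(m k)) atTop atTop := Real.tendsto_sqrt_atTop.comp hm
  filter_upwards [h.eventually_abs_sub_le (show 0 < c / 8 by linarith),
    hsq.eventually_ge_atTop (16 * K / c), hm.eventually_ge_atTop (4 / c)] with k h1 h2 h3 x hx i
  have hmk := hm0 k
  have hs : 0 < √(m k) := Real.sqrt_pos.2 hmk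
  have hss : √(m k) * √(m k) = m k := Real.mul_self_sqrt hmk.le
  rw [div_le_iff₀ hc] at h2 h3
  have h4 : K * √(m k) ≤ m k * c / 16 := by nlinarith
  have h5 := abs_le.1 ((hx i).trans h4)
  have h6 := (h.bounds k i).1
  have h7 := abs_le.1 (h1 i)
  have h8 : m k * c ≤ m k * p k i := by gcongr
  refine ⟨by linarith, by linarith, ?_⟩
  rw [mean, abs_le]
  have h9 : m k * (p k i - M.rate k (b k) i) ≤ m k * (c / 8) := by gcongr; exact h7.2
  have h10 : m k * -(c / 8) ≤ m k * (p k i - M.rate k (b k) i) := by gcongr; exact h7.1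
  constructor <;> nlinarith

/-- Bounds for the deviations of data near their means, common to the four forms. -/
lemma exists_T_bounds (h : M.IsCloseFit p b c C) (hm0 : ∀ k, 0 < m k)
    (hm : Tendsto m atTop atTop) (K : ℝ) :
    ∃ B : ℝ, 0 < B ∧ ∀ᶠ k in atTop, ∀ x : Fin n → ℝ,
      (∀ i, |x i - m k * p k i| ≤ K * √(m k)) → ∀ v : Form,
        M.T m v k (b k) x ≤ B * (1 + m k * M.deviation k (p k) (b k)) ∧
        |M.Tmin m v k x - M.Tmin m .pearson k x| ≤
          B * (1 + m k * M.deviation k (p k) (b k)) *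
            √((1 + m k * M.deviation k (p k) (b k)) / m k) ∧
        ∀ θ ∈ M.params, M.T m v k θ x ≤ M.T m v k (b k) x →
          |M.T m v k θ x - M.T m .pearson k θ x| ≤
          B * (1 + m k * M.deviation k (p k) (b k)) *
            √((1 + m k * M.deviation k (p k) (b k)) / m k) := by
  have hc := h.pos
  have hC := h.upper_pos 0
  -- Each form is at most 7χ² plus the penalty plus 3n, and χ² is at most twice the deviation of the
  -- means plus twice the noise.
  set B₀ : ℝ := 14 + 14 * (n * (K ^ 2 / c)) + C + 3 * n with hB₀
  have hB₀0 : 0 < B₀ := by positivity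
  set B₁ : ℝ := B₀ + n + 1 with hB₁
  have hB₁0 : 0 < B₁ := by positivity
  set B : ℝ := B₀ + n * (48 * B₁ * √(2 * B₁ / c)) with hB
  have hBpos : 0 < B := by positivity
  refine ⟨B, hBpos, ?_⟩
  -- The threshold makes 12B₁(1 + D) at most mc/2, a lower bound for the counts.
  have hev := (h.tendsto_one_add_div hm0 hm).eventually
    (gt_mem_nhds (show 0 < c / (24 * B₁) by positivity))
  filter_upwards [h.eventually_near hm0 hm K, hm.eventually_ge_atTop (4 / c), hev]
    with k hk h2c hsmall x hx
  have hmk := hm0 k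
  have hbk := h.mem k
  set D := m k * M.deviation k (p k) (b k) with hD
  have hD0 : 0 ≤ D := mul_nonneg hmk.le (M.deviation_nonneg hbk _)
  have hnear := hk x hx
  have hchi : M.chiSq m k (b k) x ≤ 2 * D + 2 * (n * (K ^ 2 / c)) := by
    have h1 := sum_sq_div_le (M := M) (b := b) hmk hc (h.le_rate k) hx
    have h2 : M.chiSq m k (b k) x ≤
        2 * D + 2 * ∑ i, (x i - m k * p k i) ^ 2 / (m k * M.rate k (b k) i) := by
      rw [hD]
      unfold chiSq mean deviation
      rw [Finset.mul_sum, Finset.mul_sum, Finset.mul_sum, ← Finset.sum_add_distrib]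
      refine Finset.sum_le_sum fun i _ => ?_
      have hr := M.rate_pos k (b k) hbk i
      have e : 2 * (m k * ((p k i - M.rate k (b k) i) ^ 2 / M.rate k (b k) i)) =
          2 * (m k * (p k i - M.rate k (b k) i)) ^ 2 / (m k * M.rate k (b k) i) := by
        field_simp
      rw [e, mul_div_assoc', ← add_div]
      gcongr
      nlinarith [sq_nonneg ((x i - m k * p k i) - m k * (p k i - M.rate k (b k) i))]
    linarith
  have hT : ∀ w : Form, M.T m w k (b k) x ≤ B₀ * (1 + D) := by
    intro w
    have h1 := M.T_le_chiSq hmk hbk w (fun i => by linarith [(hnear i).2.1])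
      (fun i => (hnear i).2.2)
    have h2 := h.pen_le k
    have h3 : 14 * D ≤ B₀ * D := by
      gcongr
      rw [hB₀]
      linarith [show 0 ≤ 14 * (n * (K ^ 2 / c)) + C + 3 * n by positivity]
    rw [hB₀] at h3 ⊢
    linarith
  have hA2 : 2 ≤ m k * c / 2 := by
    rw [div_le_iff₀ hc] at h2c
    linarith
  have hQ : B₀ * (1 + D) + n + 1 ≤ B₁ * (1 + D) := by
    rw [hB₁]
    nlinarith [mul_nonneg (n.cast_nonneg (α := ℝ)) hD0]
  have hQA : 12 * (B₀ * (1 + D) + n + 1) ≤ m k * c / 2 := by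
    rw [div_lt_div_iff₀ hmk (by positivity)] at hsmall
    linarith
  have hBnd : n * (48 * (B₀ * (1 + D) + n + 1) * √((B₀ * (1 + D) + n + 1) / (m k * c / 2))) ≤
      B * (1 + D) * √((1 + D) / m k) := by
    have h1 : √((B₀ * (1 + D) + n + 1) / (m k * c / 2)) ≤ √(2 * B₁ / c) * √((1 + D) / m k) := by
      rw [← Real.sqrt_mul (by positivity)]
      refine Real.sqrt_le_sqrt ?_
      calc (B₀ * (1 + D) + n + 1) / (m k * c / 2) ≤ (B₁ * (1 + D)) / (m k * c / 2) := by gcongr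
        _ = _ := by field_simp
    calc _ ≤ n * (48 * (B₁ * (1 + D)) * (√(2 * B₁ / c) * √((1 + D) / m k))) := by gcongr
      _ = n * (48 * B₁ * √(2 * B₁ / c)) * (1 + D) * √((1 + D) / m k) := by ring
      _ ≤ _ := by
        gcongr
        linarith
  have hB00 : 0 ≤ B₀ * (1 + D) := by positivity
  intro v
  refine ⟨(hT v).trans ?_, ?_, fun θ hθ hle => ?_⟩
  · gcongr
    linarith [show 0 ≤ n * (48 * B₁ * √(2 * B₁ / c)) by positivity]
  · exact (M.abs_Tmin_sub_Tmin_pearson_le hmk hbk v (fun i => (hnear i).1) hA2 hT hB00 hQA).trans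
      hBnd
  · exact (M.abs_T_sub_T_pearson_le hmk hθ v v (fun i => (hnear i).1) hA2 (hle.trans (hT v))
      hB00 hQA).trans hBnd

/-- The difference between the forms is of smaller order than the minimal deviation. -/
lemma eventually_mul_sqrt_le (h : M.IsCloseFit p b c C) (hm0 : ∀ k, 0 < m k)
    (hm : Tendsto m atTop atTop) (B : ℝ) {ε : ℝ} (hε : 0 < ε) :
    ∀ᶠ k in atTop, B * (1 + m k * M.deviation k (p k) (b k)) *
      √((1 + m k * M.deviation k (p k) (b k)) / m k) ≤
        ε * (1 + m k * M.deviation k (p k) (b k)) := by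
  have h1 := ((Real.continuous_sqrt.tendsto 0).comp (h.tendsto_one_add_div hm0 hm)).const_mul B
  rw [Real.sqrt_zero, mul_zero] at h1
  filter_upwards [h1.eventually (gt_mem_nhds hε)] with k hk
  have hD0 : 0 ≤ m k * M.deviation k (p k) (b k) :=
    mul_nonneg (hm0 k).le (M.deviation_nonneg (h.mem k) _)
  simp only [Function.comp] at hk
  calc _ = (B * √((1 + m k * M.deviation k (p k) (b k)) / m k)) *
        (1 + m k * M.deviation k (p k) (b k)) := by ring
    _ ≤ _ := by gcongr

end IsCloseFit

end BinModel

/-! ### Linearization of the minimized statistics in the data -/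

namespace BinModel

variable {n : ℕ} {M : BinModel n} {p : ℕ → Fin n → ℝ} {b : ℕ → M.Param} {m : ℕ → ℝ} {c C : ℝ}

/-- First-order expansion of the deviation in the data, with the coefficients taken at `b`. -/
lemma abs_T_sub_T_sub_linearPart_le {k : ℕ} {θ : M.Param} {x : Fin n → ℝ} {c₁ K L U : ℝ}
    (v : Form) (hm : 0 < m k) (hc : 0 < c) (hc₁ : 0 < c₁)
    (hp : ∀ i, c ≤ p k i ∧ p k i ≤ C) (hx : ∀ i, |x i - m k * p k i| ≤ K * √(m k))
    (hK : K * √(m k) ≤ m k * c / 2) (hU : U ≤ 1 / 4)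
    (hu : ∀ i, (M.rate k θ i - p k i) ^ 2 ≤ U * c ^ 2)
    (hr : ∀ i, c₁ ≤ M.rate k θ i) (hrb : ∀ i, c₁ ≤ M.rate k (b k) i)
    (hL : ∀ i, |M.rate k θ i - M.rate k (b k) i| ≤ L) :
    |M.T m v k θ x - M.T m v k θ (fun i => m k * p k i) - M.linearPart p b m k x| ≤
      n * (5 * (K * √(m k)) * U + 5 * (K ^ 2 / c) + 1 + 2 * C * (L / c₁ ^ 2) * (K * √(m k))) := by
  have e : M.T m v k θ x - M.T m v k θ (fun i => m k * p k i) - M.linearPart p b m k x =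
      ∑ i, (v.term (x i) (M.mean m k θ i) - v.term (m k * p k i) (M.mean m k θ i) -
        2 * ((p k i - M.rate k (b k) i) / M.rate k (b k) i * (x i - m k * p k i))) := by
    unfold T linearPart
    rw [Finset.sum_sub_distrib, Finset.sum_sub_distrib, Finset.mul_sum]
    ring
  rw [e]
  refine (Finset.abs_sum_le_sum_abs _ _).trans ?_
  calc _ ≤ ∑ _i : Fin n, (5 * (K * √(m k)) * U + 5 * (K ^ 2 / c) + 1 +
        2 * C * (L / c₁ ^ 2) * (K * √(m k))) := Finset.sum_le_sum fun i _ => ?_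
    _ = _ := by rw [Finset.sum_const, Finset.card_univ, Fintype.card_fin, nsmul_eq_mul]
  have hpi := hp i
  have hp0 : 0 < p k i := hc.trans_le hpi.1
  have hN : 0 < m k * p k i := by positivity
  have hr0 := hc₁.trans_le (hr i)
  have hrb0 := hc₁.trans_le (hrb i)
  -- The relative errors of the prediction and of the datum, both with respect to the true mean.
  obtain ⟨u, hudef⟩ : ∃ u, u = (M.rate k θ i - p k i) / p k i := ⟨_, rfl⟩
  obtain ⟨e, hedef⟩ : ∃ e, e = (x i - m k * p k i) / (m k * p k i) := ⟨_, rfl⟩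
  have hmean : M.mean m k θ i = m k * p k i * (1 + u) := by
    rw [hudef, mean]; field_simp; ring
  have hxe : x i = m k * p k i * (1 + e) := by rw [hedef]; field_simp; ring
  have hxe' : m k * p k i * e = x i - m k * p k i := by rw [hedef]; field_simp
  have hmc : m k * c ≤ m k * p k i := by gcongr; exact hpi.1
  have hu2 : u ^ 2 ≤ U := by
    rw [hudef, div_pow, div_le_iff₀ (by positivity)]
    refine (hu i).trans ?_
    have hU0 : 0 ≤ U := by
      by_contra hcon
      push Not at hcon
      nlinarith [sq_nonneg (M.rate k θ i - p k i), hu i, pow_pos hc 2]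
    gcongr
    exact hpi.1
  have hu1 : |u| ≤ 1 / 2 := abs_le_of_sq_le_sq (by linarith) (by norm_num)
  have he1 : |e| ≤ 1 / 2 := by
    rw [hedef, abs_div, abs_of_pos hN, div_le_iff₀ hN]
    linarith [hx i]
  have key := v.abs_term_sub_term_le hN hu1 he1
  rw [← hmean, ← hxe, hxe'] at key
  have hlin : |2 * (m k * p k i - M.mean m k θ i) / M.mean m k θ i * (x i - m k * p k i) -
      2 * ((p k i - M.rate k (b k) i) / M.rate k (b k) i * (x i - m k * p k i))| ≤
        2 * C * (L / c₁ ^ 2) * (K * √(m k)) := by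
    have e3 : 2 * (m k * p k i - M.mean m k θ i) / M.mean m k θ i * (x i - m k * p k i) -
        2 * ((p k i - M.rate k (b k) i) / M.rate k (b k) i * (x i - m k * p k i)) =
        2 * p k i * ((M.rate k θ i)⁻¹ - (M.rate k (b k) i)⁻¹) * (x i - m k * p k i) := by
      rw [mean]; field_simp; ring
    rw [e3, abs_mul, abs_mul, abs_of_pos (show 0 < 2 * p k i by positivity)]
    have h1 := abs_inv_sub_inv_le hc₁ (hr i) (hrb i) (hL i)
    have h2 := hx i
    have h3 := hpi.2
    have hL0 : 0 ≤ L := (abs_nonneg _).trans (hL i)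
    have hC0 : 0 ≤ C := hp0.le.trans h3
    gcongr
  have hq1 : 5 * (m k * p k i) * |e| * u ^ 2 ≤ 5 * (K * √(m k)) * U := by
    have h1 : m k * p k i * |e| ≤ K * √(m k) := by
      rw [← abs_of_pos hN, ← abs_mul, hxe']; exact hx i
    calc 5 * (m k * p k i) * |e| * u ^ 2 = 5 * (m k * p k i * |e|) * u ^ 2 := by ring
      _ ≤ _ := by
        gcongr
        exact mul_nonneg (by norm_num) ((by positivity : 0 ≤ m k * p k i * |e|).trans h1)
  have hq2 : 5 * (m k * p k i) * e ^ 2 ≤ 5 * (K ^ 2 / c) := by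
    have h1 := sq_le_of_near hm.le (hx i)
    have e2 : m k * p k i * e ^ 2 = (x i - m k * p k i) ^ 2 / (m k * p k i) := by
      rw [← hxe']; field_simp
    have e3 : (x i - m k * p k i) ^ 2 / (m k * p k i) ≤ K ^ 2 / c := by
      calc _ ≤ K ^ 2 * m k / (m k * c) := by gcongr
        _ = K ^ 2 / c := by field_simp
    rw [mul_assoc, e2]
    linarith
  have := abs_sub_le (v.term (x i) (M.mean m k θ i) - v.term (m k * p k i) (M.mean m k θ i))
    (2 * (m k * p k i - M.mean m k θ i) / M.mean m k θ i * (x i - m k * p k i))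
    (2 * ((p k i - M.rate k (b k) i) / M.rate k (b k) i * (x i - m k * p k i)))
  linarith

/-- Parameters that fit the data at least as well as the best fit to the true means, in any form,
are close to it. -/
lemma IsBestFit.eventually_sq_norm_sub_le (h : M.IsBestFit p b) (hcf : M.IsCloseFit p b c C)
    (hm0 : ∀ k, 0 < m k) (hm : Tendsto m atTop atTop)
    (hD : Tendsto (fun k => m k * M.deviation k (p k) (b k)) atTop atTop)
    {r K ε : ℝ} (hr : 0 < r) (hK : 0 < K) (hε : 0 < ε) :
    ∀ᶠ k in atTop, ∀ x : Fin n → ℝ, (∀ i, |x i - m k * p k i| ≤ K * √(m k)) → ∀ v : Form,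
      ∀ θ ∈ M.params, M.T m v k θ x ≤ M.T m v k (b k) x →
        ‖θ - b k‖ < r ∧ m k * ‖θ - b k‖ ^ 2 ≤ ε * (m k * M.deviation k (p k) (b k)) := by
  have hC := hcf.upper_pos 0
  obtain ⟨κ, A, hκ, hA, hgrow⟩ := h.exists_chiSq_growth hcf.pos hcf.bounds (S := 1)
    ((hcf.tendsto.eventually (gt_mem_nhds one_pos)).mono fun _ h => h.le) hm0 hm hr hK
  obtain ⟨B, hB, hT⟩ := hcf.exists_T_bounds hm0 hm K
  -- Growth multiplies the excess 2ε₁(1 + D) by A, giving ε/4 (1 + D) ≤ ε/2 D; a large D absorbs the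
  -- constants in the other half.
  have hε₁ : 0 < ε / (8 * A) := by positivity
  filter_upwards [hgrow, hT, hcf.eventually_mul_sqrt_le hm0 hm B hε₁,
    hm.eventually_ge_atTop (2 * C / κ),
    (hcf.tendsto_one_add_div hm0 hm).eventually
      (gt_mem_nhds (show 0 < κ / (4 * (ε / (8 * A))) by positivity)),
    hD.eventually_ge_atTop 1, hD.eventually_ge_atTop (2 * (A * (C + 1)) / ε)]
    with k hk1 hk2 hE hmC hmD hD1 hD2 x hx v θ hθ hle
  have hmk := hm0 k
  set D := m k * M.deviation k (p k) (b k) with hDdef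
  set ε₁ := ε / (8 * A) with hε₁def
  have h1 := (((hk2 x hx v).2.2 θ hθ hle)).trans hE
  have h2 := (((hk2 x hx v).2.2 (b k) (hcf.mem k) le_rfl)).trans hE
  rw [M.T_pearson_eq] at h1 h2
  have h3 := M.pen_nonneg k θ hθ
  have h4 := hcf.pen_le k
  -- Both parameters have nearly their Pearson values, and the penalty is nonnegative at θ and at
  -- most C at `b k`; a sublevel condition in any form becomes one in χ² with excess C + o(D).
  have h5 : M.chiSq m k θ x ≤ M.chiSq m k (b k) x + (C + 2 * (ε₁ * (1 + D))) := by
    linarith [(abs_le.1 h1).1, (abs_le.1 h2).2]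
  have hW : C + 2 * (ε₁ * (1 + D)) ≤ κ * m k := by
    rw [div_le_iff₀ hκ] at hmC
    rw [div_lt_div_iff₀ hmk (by positivity)] at hmD
    linarith
  obtain ⟨h6, h7⟩ := ((hk1 x hx).2 θ hθ).2 _ (by positivity) hW h5
  refine ⟨h6, h7.trans ?_⟩
  rw [div_le_iff₀ hε] at hD2
  have e : A * (C + 2 * (ε₁ * (1 + D)) + 1) = A * (C + 1) + ε / 4 * (1 + D) := by
    rw [hε₁def]; field_simp; ring
  rw [e]
  nlinarith

set_option maxHeartbeats 1000000 in
/-- The minimized deviation of any form, as a function of data near their means, is linear up to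
an error of smaller order than the square root of the minimal deviation. -/
lemma IsBestFit.eventually_abs_Tmin_sub_le (h : M.IsBestFit p b) (hcf : M.IsCloseFit p b c C)
    (hm0 : ∀ k, 0 < m k) (hm : Tendsto m atTop atTop)
    (hD : Tendsto (fun k => m k * M.deviation k (p k) (b k)) atTop atTop)
    {K ε : ℝ} (hK : 0 < K) (hε : 0 < ε) :
    ∀ᶠ k in atTop, ∀ x : Fin n → ℝ, (∀ i, |x i - m k * p k i| ≤ K * √(m k)) → ∀ v : Form,
      |M.Tmin m v k x - M.Tmin m v k (fun i => m k * p k i) - M.linearPart p b m k x| ≤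
        ε * √(m k * M.deviation k (p k) (b k)) := by
  have hc := hcf.pos
  have hC := hcf.upper_pos 0
  obtain ⟨r, c₁, C₁, hr, hc₁, hC₁, hrb⟩ := h.exists_rate_bounds
  set L₃ : ℝ := n * (2 * C * (C₁ / c₁ ^ 2) * K) with hL₃
  have hL₃0 : 0 ≤ L₃ := by positivity
  set U : ℝ := 2 * (1 + 2 * C + C₁ ^ 2) / c ^ 2 with hU
  have hU0 : 0 < U := by positivity
  -- Chosen so that replacing the coefficients at θ by those at the best fit costs at most ε/3 √D.
  set α : ℝ := min 1 (ε / (3 * (L₃ + 1))) with hα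
  have hα0 : 0 < α := by positivity
  have hα1 : α ≤ 1 := min_le_left _ _
  have hαL : L₃ * α ≤ ε / 3 := by
    have h1 : α ≤ ε / (3 * (L₃ + 1)) := min_le_right _ _
    rw [le_div_iff₀ (by positivity)] at h1
    nlinarith
  have hsqD : Tendsto (fun k => √(m k * M.deviation k (p k) (b k))) atTop atTop :=
    Real.tendsto_sqrt_atTop.comp hD
  have hsqm : Tendsto (fun k => √(m k)) atTop atTop := Real.tendsto_sqrt_atTop.comp hm
  have hsqd := ((Real.continuous_sqrt.tendsto 0).comp hcf.tendsto).const_mul (n * (5 * K * U))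
  rw [Real.sqrt_zero, mul_zero] at hsqd
  have hUd := hcf.tendsto.const_mul U
  rw [mul_zero] at hUd
  filter_upwards [h.eventually_sq_norm_sub_le hcf hm0 hm hD hr hK (ε := α ^ 2) (by positivity),
    hcf.eventually_near hm0 hm K, hcf.eventually_sq_sub_le,
    hsqm.eventually_ge_atTop (2 * K / c), hUd.eventually (gt_mem_nhds (show (0 : ℝ) < 1 / 4 by norm_num)),
    hsqd.eventually (gt_mem_nhds (show 0 < ε / 3 by linarith)),
    hsqD.eventually_ge_atTop (3 * (n * (5 * (K ^ 2 / c) + 1)) / ε)]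
    with k hk hnear hδ hmK hdev hdev2 hDbig x hx v
  have hmk := hm0 k
  have hs : 0 < √(m k) := Real.sqrt_pos.2 hmk
  have hss : √(m k) * √(m k) = m k := Real.mul_self_sqrt hmk.le
  have hμ : ∀ i, |(fun i => m k * p k i) i - m k * p k i| ≤ K * √(m k) := fun i => by
    simp only [sub_self, abs_zero]; positivity
  have hx2 := fun i => (hnear x hx i).2.1
  have hμ2 := fun i => (hnear _ hμ i).2.1
  set d := M.deviation k (p k) (b k) with hd
  have hd0 : 0 ≤ d := M.deviation_nonneg (hcf.mem k) _
  -- The comparison of infima needs parameters that compete at x or at the mean. The mean lies in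
  -- the box too, so both kinds are near the best fit.
  have hmain : ∀ θ ∈ M.params, (M.T m v k θ x ≤ M.T m v k (b k) x ∨
      M.T m v k θ (fun i => m k * p k i) ≤ M.T m v k (b k) (fun i => m k * p k i)) →
      |M.T m v k θ x - M.T m v k θ (fun i => m k * p k i) - M.linearPart p b m k x| ≤
        ε * √(m k * d) := by
    intro θ hθ hor
    have hloc : ‖θ - b k‖ < r ∧ m k * ‖θ - b k‖ ^ 2 ≤ α ^ 2 * (m k * d) := by
      rcases hor with h1 | h1
      · exact hk x hx v θ hθ h1
      · exact hk _ hμ v θ hθ h1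
    set t := ‖θ - b k‖ with ht
    have hθr := (hrb k).2 θ (by rw [Metric.mem_ball, dist_eq_norm]; exact hloc.1)
    have hbr := (hrb k).2 (b k) (Metric.mem_ball_self hr)
    have ht0 : 0 ≤ t := norm_nonneg _
    have ht2 : t ^ 2 ≤ d := by
      have h1 : m k * t ^ 2 ≤ m k * d := hloc.2.trans (by
        have : α ^ 2 ≤ 1 := by nlinarith
        exact mul_le_of_le_one_left (by positivity) this)
      exact le_of_mul_le_mul_left h1 hmk
    have hmt : √(m k) * t ≤ α * √(m k * d) := by
      have : (√(m k) * t) ^ 2 ≤ (α * √(m k * d)) ^ 2 := by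
        rw [mul_pow, mul_pow, Real.sq_sqrt hmk.le, Real.sq_sqrt (by positivity)]
        exact hloc.2
      exact le_of_sq_le_sq this (by positivity)
    have key := abs_T_sub_T_sub_linearPart_le (θ := θ) (x := x) (U := U * d) v hmk hc hc₁
      (hcf.bounds k) hx (by
        rw [div_le_iff₀ hc] at hmK
        nlinarith) hdev.le (fun i => by
        have h1 := (hθr.2 i).2.1
        have h2 : (M.rate k θ i - M.rate k (b k) i) ^ 2 ≤ C₁ ^ 2 * d := by
          calc (M.rate k θ i - M.rate k (b k) i) ^ 2 ≤ (C₁ * t) ^ 2 :=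
                sq_le_sq.2 (by rwa [abs_of_nonneg (show 0 ≤ C₁ * t by positivity)])
            _ ≤ C₁ ^ 2 * d := by rw [mul_pow]; gcongr
        have h3 := hδ i
        have e : U * d * c ^ 2 = 2 * ((1 + 2 * C) * d + C₁ ^ 2 * d) := by
          rw [hU]; field_simp
        rw [e]
        nlinarith [sq_nonneg ((M.rate k θ i - M.rate k (b k) i) + (p k i - M.rate k (b k) i))])
      (fun i => (hθr.2 i).1) (fun i => (hbr.2 i).1) (fun i => (hθr.2 i).2.1)
    refine key.trans ?_
    -- Here √m · d = √d · √(md), and √d tends to 0: the nonlinearity in u is negligible against √D.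
    have e1 : n * (5 * (K * √(m k)) * (U * d)) = n * (5 * K * U) * √d * √(m k * d) := by
      rw [Real.sqrt_mul hmk.le]
      have : d = √d * √d := (Real.mul_self_sqrt hd0).symm
      nth_rewrite 1 [this]
      ring
    have e2 : n * (5 * K * U) * √d * √(m k * d) ≤ ε / 3 * √(m k * d) := by
      gcongr
      exact hdev2.le
    have e3 : n * (2 * C * (C₁ * t / c₁ ^ 2) * (K * √(m k))) ≤ ε / 3 * √(m k * d) := by
      calc n * (2 * C * (C₁ * t / c₁ ^ 2) * (K * √(m k))) = L₃ * (√(m k) * t) := by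
            rw [hL₃]; ring
        _ ≤ L₃ * (α * √(m k * d)) := by gcongr
        _ = L₃ * α * √(m k * d) := by ring
        _ ≤ _ := by gcongr
    have e4 : n * (5 * (K ^ 2 / c) + 1) ≤ ε / 3 * √(m k * d) := by
      rw [div_le_iff₀ hε] at hDbig
      linarith
    linarith
  exact abs_ciInf_sub_ciInf_sub_le (⟨b k, hcf.mem k⟩ : M.params) (M.bddBelow_T hmk v hx2)
    (M.bddBelow_T hmk v hμ2) fun θ => hmain θ θ.2

end BinModel

/-- Turns closeness of variances into closeness of scales: |σ² - s²| = |σ - s|(σ + s) ≥ |σ - s| s,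
and s = 0 forces σ = 0. -/
lemma abs_sub_le_of_sq {σ s ε : ℝ} (hσ : 0 ≤ σ) (hs : 0 ≤ s) (h : |σ ^ 2 - s ^ 2| ≤ ε * s ^ 2) :
    |σ - s| ≤ ε * s := by
  rcases hs.eq_or_lt with h0 | hpos
  · rw [← h0] at h ⊢
    have : σ ^ 2 = 0 := by simpa using h
    rw [pow_eq_zero_iff (by norm_num)] at this
    simp [this]
  · have e : |σ ^ 2 - s ^ 2| = |σ - s| * (σ + s) := by
      rw [show σ ^ 2 - s ^ 2 = (σ - s) * (σ + s) by ring, abs_mul,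
        abs_of_pos (show 0 < σ + s by linarith)]
    rw [e] at h
    refine le_of_mul_le_mul_right ?_ hpos
    calc |σ - s| * s ≤ |σ - s| * (σ + s) := by gcongr; linarith
      _ ≤ ε * s ^ 2 := h
      _ = ε * s * s := by ring

/-! ### Law of the linear part and bounds for the minima -/

namespace BinModel

variable {n : ℕ} {M : BinModel n} {p : ℕ → Fin n → ℝ} {b : ℕ → M.Param} {m : ℕ → ℝ} {c C : ℝ}

/-- The variance of the linear part, per unit of exposure and up to a factor of four. -/
noncomputable def linearVar (M : BinModel n) (p : ℕ → Fin n → ℝ) (b : ℕ → M.Param) (k : ℕ) : ℝ :=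
  ∑ i, ((p k i - M.rate k (b k) i) / M.rate k (b k) i) ^ 2 * p k i

lemma linearVar_nonneg (hp : ∀ k i, 0 < p k i) (k : ℕ) : 0 ≤ M.linearVar p b k :=
  Finset.sum_nonneg fun i _ => mul_nonneg (sq_nonneg _) (hp k i).le

section CentralLimit

variable {Ω : ℕ → Type*} [∀ k, MeasurableSpace (Ω k)] {P : ∀ k, Measure (Ω k)}
  [∀ k, IsProbabilityMeasure (P k)] {X : ∀ k, Ω k → Fin n → ℝ}

/-- The linear part is a multiple of an asymptotically standard normal sequence. -/
lemma exists_linearPart_eq (hX : IsCountData P X fun k i => m k * p k i) (hm0 : ∀ k, 0 < m k)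
    (hm : Tendsto m atTop atTop) (hc : 0 < c) (hp : ∀ k i, c ≤ p k i) :
    ∃ Z : ∀ k, Ω k → ℝ,
      (∀ k ω, M.linearPart p b m k (X k ω) = 2 * √(m k * M.linearVar p b k) * Z k ω) ∧
      ((∀ k, M.linearVar p b k = 0) ∨ (ApproxNormal P Z (fun _ => 0) (fun _ => 1) ∧
        ApproxNormal P (fun k ω => -Z k ω) (fun _ => 0) fun _ => 1)) ∧
      ∀ K : ℝ, 0 < K → ∃ A : ℝ, ∀ k, ∀ ω ∈ {ω | ∀ i, |X k ω i - m k * p k i| ≤ K * √(m k)},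
        |Z k ω| ≤ A := by
  have hp0 : ∀ k i, 0 < p k i := fun k i => hc.trans_le (hp k i)
  -- Without bins there is no weight vector of norm 1, but the linear part and its variance vanish.
  rcases Nat.eq_zero_or_pos n with rfl | hn
  · exact ⟨fun _ _ => 0, fun k ω => by simp [linearPart], Or.inl fun k => by simp [linearVar],
      fun K _ => ⟨0, fun k ω _ => by simp⟩⟩
  have hn' : (0 : ℝ) < n := by exact_mod_cast hn
  set a : ℕ → Fin n → ℝ := fun k i => (p k i - M.rate k (b k) i) / M.rate k (b k) i with ha
  have hv0 := fun k => M.linearVar_nonneg (b := b) hp0 k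
  -- Where the variance is 0 any unit vector will do, since Z is multiplied by 0 there.
  set w : ℕ → Fin n → ℝ := fun k i =>
    if M.linearVar p b k = 0 then (√n)⁻¹ else a k i * √(p k i) / √(M.linearVar p b k) with hw
  have hw1 : ∀ k, ∑ i, w k i ^ 2 = 1 := by
    intro k
    by_cases h0 : M.linearVar p b k = 0
    · simp only [hw, h0, if_true, Finset.sum_const, Finset.card_univ, Fintype.card_fin,
        nsmul_eq_mul, inv_pow, Real.sq_sqrt hn'.le]
      field_simp
    · simp only [hw, h0, if_false, div_pow, mul_pow, Real.sq_sqrt (hv0 k),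
        Real.sq_sqrt (hp0 k _).le]
      rw [← Finset.sum_div, div_eq_one_iff_eq h0]
      rfl
  have hwle : ∀ k i, |w k i| ≤ 1 := by
    intro k i
    rw [← sq_le_one_iff_abs_le_one, ← hw1 k]
    exact Finset.single_le_sum (f := fun i => w k i ^ 2) (fun _ _ => sq_nonneg _)
      (Finset.mem_univ i)
  have hl0 : ∀ k i, 0 < m k * p k i := fun k i => mul_pos (hm0 k) (hp0 k i)
  have hl : ∀ i, Tendsto (fun k => m k * p k i) atTop atTop := fun i =>
    tendsto_atTop_mono (fun k => mul_le_mul_of_nonneg_left (hp k i) (hm0 k).le)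
      (hm.atTop_mul_const hc)
  refine ⟨fun k ω => ∑ i, w k i * ((X k ω i - m k * p k i) / √(m k * p k i)), fun k ω => ?_,
    Or.inr ⟨hX.approxNormal_sum hl0 hl hw1, ?_⟩, fun K hK => ⟨n * (K / √c), fun k ω hω => ?_⟩⟩
  · rw [linearPart, Finset.mul_sum, Finset.mul_sum]
    refine Finset.sum_congr rfl fun i _ => ?_
    have hsp := Real.sqrt_pos.2 (hp0 k i)
    have hsm := Real.sqrt_pos.2 (hm0 k)
    by_cases h0 : M.linearVar p b k = 0
    · have hai : a k i = 0 := by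
        have h1 := (Finset.sum_eq_zero_iff_of_nonneg fun i _ =>
          mul_nonneg (sq_nonneg _) (hp0 k i).le).1 h0 i (Finset.mem_univ i)
        rcases mul_eq_zero.1 h1 with h2 | h2
        · exact pow_eq_zero_iff (by norm_num) |>.1 h2
        · exact absurd h2 (hp0 k i).ne'
      change 2 * (a k i * _) = _
      rw [hai, h0]
      simp
    · have hsv : 0 < √(M.linearVar p b k) := Real.sqrt_pos.2 (lt_of_le_of_ne (hv0 k) (Ne.symm h0))
      simp only [hw, h0, if_false]
      change 2 * (a k i * _) = _
      rw [Real.sqrt_mul (hm0 k).le, Real.sqrt_mul (hm0 k).le]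
      field_simp
  -- Reversing the weights gives the limit of -Z directly; it serves the exchanged hypotheses, where
  -- ΔT changes sign.
  · have := hX.approxNormal_sum hl0 hl (w := fun k i => -w k i) (fun k => by simpa using hw1 k)
    simpa [Finset.sum_neg_distrib] using this
  · refine (Finset.abs_sum_le_sum_abs _ _).trans ?_
    calc _ ≤ ∑ _i : Fin n, K / √c := by
          refine Finset.sum_le_sum fun i _ => ?_
          rw [abs_mul]
          have hsm := Real.sqrt_pos.2 (hm0 k)
          have hsc := Real.sqrt_pos.2 hc
          have h1 : |(X k ω i - m k * p k i) / √(m k * p k i)| ≤ K / √c := by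
            rw [abs_div, abs_of_pos (Real.sqrt_pos.2 (hl0 k i)), Real.sqrt_mul (hm0 k).le]
            calc _ ≤ K * √(m k) / (√(m k) * √c) := by
                  gcongr
                  · exact hω i
                  · exact hp k i
              _ = K / √c := by field_simp
          exact (mul_le_of_le_one_left (abs_nonneg _) (hwle k i)).trans h1
      _ = _ := by simp

end CentralLimit

lemma chiSqMin_le {k : ℕ} (hm : 0 < m k) {θ : M.Param} (hθ : θ ∈ M.params) (x : Fin n → ℝ) :
    M.chiSqMin m k x ≤ M.chiSq m k θ x :=
  ciInf_le (M.bddBelow_chiSq hm x) (⟨θ, hθ⟩ : M.params)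

lemma le_chiSqMin {k : ℕ} {θ : M.Param} (hθ : θ ∈ M.params) {x : Fin n → ℝ} {y : ℝ}
    (h : ∀ θ ∈ M.params, y ≤ M.chiSq m k θ x) : y ≤ M.chiSqMin m k x := by
  have : Nonempty M.params := ⟨⟨θ, hθ⟩⟩
  exact le_ciInf fun θ => h θ θ.2

lemma chiSqMin_eq_of_isMinOn {k : ℕ} (hm : 0 < m k) {θ : M.Param} (hθ : θ ∈ M.params)
    {x : Fin n → ℝ} (h : IsMinOn (fun θ => M.chiSq m k θ x) M.params θ) :
    M.chiSqMin m k x = M.chiSq m k θ x :=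
  le_antisymm (chiSqMin_le hm hθ x) (le_chiSqMin hθ fun _ h' => h h')

lemma Tmin_le {k : ℕ} (hm : 0 < m k) {θ : M.Param} (hθ : θ ∈ M.params) (v : Form) {x : Fin n → ℝ}
    (hx : ∀ i, 2 ≤ x i) : M.Tmin m v k x ≤ M.T m v k θ x :=
  ciInf_le (M.bddBelow_T hm v hx) (⟨θ, hθ⟩ : M.params)

lemma neg_le_Tmin {k : ℕ} (hm : 0 < m k) {θ : M.Param} (hθ : θ ∈ M.params) (v : Form)
    {x : Fin n → ℝ} (hx : ∀ i, 2 ≤ x i) : -(n : ℝ) ≤ M.Tmin m v k x := by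
  have : Nonempty M.params := ⟨⟨θ, hθ⟩⟩
  exact le_ciInf fun θ => M.neg_le_T hm θ.2 v hx

lemma chiSqMin_le_Tmin_pearson {k : ℕ} (hm : 0 < m k) {θ : M.Param} (hθ : θ ∈ M.params)
    (x : Fin n → ℝ) : M.chiSqMin m k x ≤ M.Tmin m .pearson k x := by
  have : Nonempty M.params := ⟨⟨θ, hθ⟩⟩
  refine le_ciInf fun θ => ?_
  rw [M.T_pearson_eq]
  linarith [chiSqMin_le (M := M) hm θ.2 x, M.pen_nonneg k θ θ.2]

/-- The minimized chi-square of data near their means. -/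
lemma IsBestFit.exists_chiSqMin_bounds (h : M.IsBestFit p b) {S : ℝ} (hc : 0 < c)
    (hp : ∀ k i, c ≤ p k i ∧ p k i ≤ C) (hS : ∀ᶠ k in atTop, M.deviation k (p k) (b k) ≤ S)
    (hm0 : ∀ k, 0 < m k) (hm : Tendsto m atTop atTop) {K : ℝ} (hK : 0 < K) :
    ∃ A : ℝ, 0 < A ∧ ∀ᶠ k in atTop, ∀ x : Fin n → ℝ,
      (∀ i, |x i - m k * p k i| ≤ K * √(m k)) →
      |M.chiSqMin m k x - (m k * M.deviation k (p k) (b k) + M.linearPart p b m k x)| ≤ A ∧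
      M.chiSq m k (b k) x ≤ M.chiSqMin m k x + A ∧
      ∀ θ ∈ M.params, M.chiSq m k θ x ≤ M.chiSq m k (b k) x → m k * ‖θ - b k‖ ^ 2 ≤ A := by
  obtain ⟨κ, A, hκ, hA, hev⟩ := h.exists_chiSq_growth hc hp hS hm0 hm one_pos hK
  refine ⟨2 * A, by positivity, ?_⟩
  filter_upwards [hev] with k hk x hx
  obtain ⟨h1, h2⟩ := hk x hx
  have h3 := chiSqMin_le (M := M) (hm0 k) (h.mem k) x
  have h4 : M.chiSq m k (b k) x - A ≤ M.chiSqMin m k x :=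
    le_chiSqMin (h.mem k) fun θ hθ => (h2 θ hθ).1
  have h5 := abs_le.1 h1
  refine ⟨abs_le.2 ⟨by linarith, by linarith⟩, by linarith, fun θ hθ hle => ?_⟩
  have := ((h2 θ hθ).2 0 le_rfl (mul_pos hκ (hm0 k)).le (by linarith)).2
  linarith

/-- The linear part is at most of the order of the square root of the minimal deviation. -/
lemma IsCloseFit.eventually_abs_linearPart_le (h : M.IsCloseFit p b c C) (hm0 : ∀ k, 0 < m k)
    {K : ℝ} : ∀ᶠ k in atTop, ∀ x : Fin n → ℝ,
      (∀ i, |x i - m k * p k i| ≤ K * √(m k)) → |M.linearPart p b m k x| ≤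
        2 * (n * (√(1 + 2 * C) / c * K)) * √(m k * M.deviation k (p k) (b k)) := by
  filter_upwards [h.eventually_sq_sub_le] with k hk x hx
  have hc := h.pos
  have hC := h.upper_pos k
  have hd := M.deviation_nonneg (k := k) (h.mem k) (p k)
  rw [linearPart, abs_mul, abs_two, mul_assoc]
  gcongr
  refine (Finset.abs_sum_le_sum_abs _ _).trans ?_
  calc _ ≤ ∑ _i : Fin n, √(1 + 2 * C) / c * K * √(m k * M.deviation k (p k) (b k)) := by
        refine Finset.sum_le_sum fun i _ => ?_
        have hr := hc.trans_le (h.le_rate k i)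
        have h1 : |p k i - M.rate k (b k) i| ≤ √(1 + 2 * C) * √(M.deviation k (p k) (b k)) := by
          rw [← Real.sqrt_mul (by linarith)]
          exact Real.abs_le_sqrt (hk i)
        rw [abs_mul, abs_div, abs_of_pos hr, Real.sqrt_mul (hm0 k).le]
        calc _ ≤ √(1 + 2 * C) * √(M.deviation k (p k) (b k)) / c * (K * √(m k)) := by
              gcongr
              · exact h.le_rate k i
              · exact hx i
          _ = _ := by ring
    _ = _ := by simp; ring

end BinModel

/-! ### Comparison of deviation and variance; bounds under the true hypothesis -/

namespace BinModel

variable {n : ℕ} {M : BinModel n} {p : ℕ → Fin n → ℝ} {b : ℕ → M.Param} {m : ℕ → ℝ} {c C : ℝ}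

lemma deviation_eq_zero_of_linearVar_eq_zero {k : ℕ} (hp : ∀ k i, 0 < p k i)
    (hb : b k ∈ M.params) (h : M.linearVar p b k = 0) : M.deviation k (p k) (b k) = 0 := by
  refine Finset.sum_eq_zero fun i _ => ?_
  have h1 := (Finset.sum_eq_zero_iff_of_nonneg fun i _ =>
    mul_nonneg (sq_nonneg _) (hp k i).le).1 h i (Finset.mem_univ i)
  have hr := (M.rate_pos k _ hb i).ne'
  rcases mul_eq_zero.1 h1 with h2 | h2
  · have h3 := pow_eq_zero_iff (by norm_num) |>.1 h2
    rcases div_eq_zero_iff.1 h3 with h4 | h4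
    · simp [h4]
    · exact absurd h4 hr
  · exact absurd h2 (hp k i).ne'

/-- Without CD3 the term s may be negative; this keeps the variance 4D̄ + 4ms at least a multiple of
D̄, so that it diverges with D̄. -/
lemma mul_deviation_le_linearVar {k : ℕ} {R : ℝ} (hc : 0 < c) (hp : ∀ i, c ≤ p k i)
    (hb : b k ∈ M.params) (hR : ∀ i, M.rate k (b k) i ≤ R) :
    c * M.deviation k (p k) (b k) ≤ R * M.linearVar p b k := by
  unfold deviation linearVar
  rw [Finset.mul_sum, Finset.mul_sum]
  refine Finset.sum_le_sum fun i _ => ?_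
  have hr := M.rate_pos k _ hb i
  have e : c * ((p k i - M.rate k (b k) i) ^ 2 / M.rate k (b k) i) =
      M.rate k (b k) i * (((p k i - M.rate k (b k) i) / M.rate k (b k) i) ^ 2 * c) := by
    field_simp
  rw [e]
  have := hr.le.trans (hR i)
  gcongr
  · exact hR i
  · exact hp i

/-- Bounds for the minimized deviations under the true hypothesis. -/
lemma IsTruth.exists_bounds {a : ℕ → M.Param} (h : M.IsTruth a) (hm0 : ∀ k, 0 < m k)
    (hm : Tendsto m atTop atTop) (K : ℝ) :
    ∃ B : ℝ, 0 < B ∧ ∀ᶠ k in atTop, ∀ x : Fin n → ℝ,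
      (∀ i, |x i - m k * M.rate k (a k) i| ≤ K * √(m k)) →
      (0 ≤ M.chiSqMin m k x ∧ M.chiSqMin m k x ≤ B) ∧ ∀ v : Form,
        |M.Tmin m v k x| ≤ B ∧ |M.Tmin m v k x - M.Tmin m .pearson k x| ≤ B * (√(m k))⁻¹ := by
  obtain ⟨c, C, hcf⟩ := h.exists_isCloseFit
  obtain ⟨B, hB, hev⟩ := hcf.exists_T_bounds hm0 hm K
  have hc := hcf.pos
  refine ⟨B + n * (K ^ 2 / c) + n, by positivity, ?_⟩
  filter_upwards [hev, hcf.eventually_near hm0 hm K] with k hk hnear x hx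
  have hmk := hm0 k
  have hx2 := fun i => (hnear x hx i).2.1
  -- The true hypothesis fits its own means exactly, so the general error (1 + D)√((1 + D)/m)
  -- becomes m^{-1/2}.
  have hdev : M.deviation k (M.rate k (a k)) (a k) = 0 := by simp [deviation]
  have hchi : M.chiSq m k (a k) x ≤ n * (K ^ 2 / c) :=
    sum_sq_div_le (M := M) (p := fun k => M.rate k (a k)) (b := a) hmk hc (hcf.le_rate k) hx
  have h0 : 0 ≤ n * (K ^ 2 / c) := by positivity
  have hn : (0 : ℝ) ≤ n := n.cast_nonneg
  refine ⟨⟨le_chiSqMin (h.mem k) fun θ hθ => M.chiSq_nonneg hmk hθ,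
    ((chiSqMin_le hmk (h.mem k) x).trans hchi).trans (by linarith)⟩, fun v => ?_⟩
  obtain ⟨h1, h2, -⟩ := hk x hx v
  rw [hdev] at h1 h2
  simp only [mul_zero, add_zero, mul_one] at h1 h2
  constructor
  · rw [abs_le]
    have h3 := neg_le_Tmin hmk (h.mem k) v hx2
    have h4 := Tmin_le hmk (h.mem k) v hx2
    constructor <;> linarith
  · refine h2.trans ?_
    rw [one_div, Real.sqrt_inv]
    gcongr
    linarith

end BinModel

/-! ### Leading terms and the difference of the minimized statistics -/

section Leading

variable {n : ℕ} {H₀ H₁ : BinModel n} {m : ℕ → ℝ} {η₀ : ℕ → H₀.Param} {ζ₀ : ℕ → H₁.Param}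

lemma D₁_eq (k : ℕ) : D₁ H₀ H₁ m η₀ ζ₀ k =
    m k * H₁.deviation k (H₀.rate k (η₀ k)) (ζ₀ k) := rfl

lemma D₂_eq_linearPart {k : ℕ} (hm : 0 < m k) (x : Fin n → ℝ) : D₂ H₀ H₁ m η₀ ζ₀ k x =
    H₁.linearPart (fun k => H₀.rate k (η₀ k)) ζ₀ m k x := by
  unfold D₂ BinModel.linearPart rateDiff
  rw [mul_assoc, Finset.mul_sum]
  congr 1
  refine Finset.sum_congr rfl fun i _ => ?_
  have hss : √(m k) * √(m k) = m k := Real.mul_self_sqrt hm.le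
  calc _ = (H₀.rate k (η₀ k) i - H₁.rate k (ζ₀ k) i) / H₁.rate k (ζ₀ k) i *
        ((√(m k) * √(m k)) * (x i / m k - H₀.rate k (η₀ k) i)) := by ring
    _ = _ := by rw [hss, mul_sub, mul_div_cancel₀ _ hm.ne']

lemma isLeast_D₁ (hm : ∀ k, 0 < m k) (hb : H₁.IsBestFit (fun k => H₀.rate k (η₀ k)) ζ₀) (k : ℕ) :
    IsLeast ((fun ζ => H₁.chiSq m k ζ (H₀.mean m k (η₀ k))) '' H₁.params)
      (D₁ H₀ H₁ m η₀ ζ₀ k) := by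
  have e : ∀ ζ, H₁.chiSq m k ζ (H₀.mean m k (η₀ k)) =
      m k * H₁.deviation k (H₀.rate k (η₀ k)) ζ := by
    intro ζ
    rw [H₁.chiSq_eq_mul_deviation (hm k)]
    congr 2
    ext i
    rw [BinModel.mean, mul_div_cancel_left₀ _ (hm k).ne']
  refine ⟨⟨ζ₀ k, hb.mem k, ?_⟩, ?_⟩
  · simp only [e]
    rfl
  · rintro _ ⟨ζ, hζ, rfl⟩
    simp only [e, D₁_eq]
    exact mul_le_mul_of_nonneg_left (hb.deviation_le k hζ) (hm k).le

lemma Dbar_eq (hm : ∀ k, 0 < m k) (hb : H₁.IsBestFit (fun k => H₀.rate k (η₀ k)) ζ₀) (k : ℕ) :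
    Dbar H₀ H₁ m η₀ k = m k * H₁.deviation k (H₀.rate k (η₀ k)) (ζ₀ k) := by
  obtain ⟨⟨ζ, hζ, h1⟩, h2⟩ := isLeast_D₁ hm hb k
  refine le_antisymm ?_ ?_
  · rw [← D₁_eq, ← h1]
    exact BinModel.chiSqMin_le (hm k) hζ _
  · rw [← D₁_eq]
    exact BinModel.le_chiSqMin hζ fun θ hθ => h2 ⟨θ, hθ, rfl⟩

lemma pearsonD_mean_eq (hm : ∀ k, 0 < m k) (ht : H₀.IsTruth η₀) (k : ℕ) :
    pearsonD H₀ H₁ m k (H₀.mean m k (η₀ k)) = Dbar H₀ H₁ m η₀ k := by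
  have h0 : H₀.chiSqMin m k (H₀.mean m k (η₀ k)) = 0 := by
    refine le_antisymm ?_ (BinModel.le_chiSqMin (ht.mem k) fun θ hθ => H₀.chiSq_nonneg (hm k) hθ)
    refine (BinModel.chiSqMin_le (hm k) (ht.mem k) _).trans ?_
    simp [BinModel.chiSq]
  rw [pearsonD, h0, sub_zero, Dbar]

/-- From π = τ + δ, (δ/τ)²π = δ²/τ + δ³/τ²: the term s arises because the counts have variance mπ
rather than mτ. -/
lemma deviation_add_sTerm (k : ℕ) (hb : ζ₀ k ∈ H₁.params) :
    H₁.deviation k (H₀.rate k (η₀ k)) (ζ₀ k) + sTerm H₀ H₁ η₀ ζ₀ k =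
      H₁.linearVar (fun k => H₀.rate k (η₀ k)) ζ₀ k := by
  unfold BinModel.deviation sTerm BinModel.linearVar rateDiff
  rw [← Finset.sum_add_distrib]
  refine Finset.sum_congr rfl fun i _ => ?_
  have := (H₁.rate_pos k _ hb i).ne'
  field_simp
  ring

/-- Each summand of s is δ/τ times the corresponding summand of the deviation. -/
lemma abs_mul_sTerm_le {k : ℕ} (hm : 0 < m k) (hb : ζ₀ k ∈ H₁.params) {c ε : ℝ} (hc : 0 < c)
    (hr : ∀ i, c ≤ H₁.rate k (ζ₀ k) i) (hε : 0 ≤ ε)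
    (hδ : ∀ i, |H₀.rate k (η₀ k) i - H₁.rate k (ζ₀ k) i| ≤ ε) :
    |m k * sTerm H₀ H₁ η₀ ζ₀ k| ≤
      ε / c * (m k * H₁.deviation k (H₀.rate k (η₀ k)) (ζ₀ k)) := by
  rw [abs_mul, abs_of_pos hm, mul_left_comm]
  gcongr
  unfold sTerm BinModel.deviation rateDiff
  rw [Finset.mul_sum]
  refine (Finset.abs_sum_le_sum_abs _ _).trans (Finset.sum_le_sum fun i _ => ?_)
  have hr0 := H₁.rate_pos k _ hb i
  set d := H₀.rate k (η₀ k) i - H₁.rate k (ζ₀ k) i with hd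
  have e : d ^ 3 / H₁.rate k (ζ₀ k) i ^ 2 = d / H₁.rate k (ζ₀ k) i *
      (d ^ 2 / H₁.rate k (ζ₀ k) i) := by field_simp
  rw [e, abs_mul, abs_of_nonneg (show 0 ≤ d ^ 2 / H₁.rate k (ζ₀ k) i by positivity), abs_div,
    abs_of_pos hr0]
  gcongr
  · exact hδ i
  · exact hr i

lemma exists_deviation_le (hb : H₁.IsBestFit (fun k => H₀.rate k (η₀ k)) ζ₀)
    (hA : ∀ i, (fun k => rateDiff H₀ H₁ η₀ ζ₀ k i) =O[atTop] (fun _ => (1 : ℝ))) :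
    ∃ S : ℝ, 0 < S ∧ ∀ᶠ k in atTop, H₁.deviation k (H₀.rate k (η₀ k)) (ζ₀ k) ≤ S := by
  obtain ⟨c, hc, hr⟩ := hb.rate_lower
  choose B hB using fun i => (hA i).bound
  refine ⟨1 + ∑ i, B i ^ 2 / c, by positivity, ?_⟩
  filter_upwards [eventually_all.2 hB] with k hk
  refine le_trans (Finset.sum_le_sum fun i _ => ?_) (le_add_of_nonneg_left zero_le_one)
  have h1 := hk i
  simp only [norm_one, mul_one, Real.norm_eq_abs] at h1
  have h2 : (H₀.rate k (η₀ k) i - H₁.rate k (ζ₀ k) i) ^ 2 ≤ B i ^ 2 := by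
    rw [← sq_abs]
    gcongr
    exact h1
  gcongr
  exact hr k i

/-- If the relative differences of the means vanish, so does the deviation per unit of exposure. -/
lemma tendsto_deviation_zero (hm : ∀ k, 0 < m k) (ht : H₀.IsTruth η₀)
    (hb : H₁.IsBestFit (fun k => H₀.rate k (η₀ k)) ζ₀)
    (hCD : ∀ i, (fun k => H₀.mean m k (η₀ k) i - H₁.mean m k (ζ₀ k) i) =o[atTop]
      (fun k => H₀.mean m k (η₀ k) i)) :
    Tendsto (fun k => H₁.deviation k (H₀.rate k (η₀ k)) (ζ₀ k)) atTop (𝓝 0) := by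
  obtain ⟨c, hc, hr⟩ := hb.rate_lower
  obtain ⟨c', C, hc', hbd⟩ := ht.rate_bounds
  have hδ : ∀ i, Tendsto (fun k => H₀.rate k (η₀ k) i - H₁.rate k (ζ₀ k) i) atTop (𝓝 0) := by
    intro i
    have h1 : (fun k => H₀.rate k (η₀ k) i - H₁.rate k (ζ₀ k) i) =o[atTop]
        (fun k => H₀.rate k (η₀ k) i) := by
      rw [isLittleO_iff]
      intro ε hε
      filter_upwards [isLittleO_iff.1 (hCD i) hε] with k hk
      simp only [BinModel.mean, ← mul_sub, norm_mul] at hk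
      have hmk : 0 < ‖m k‖ := norm_pos_iff.2 (hm k).ne'
      refine le_of_mul_le_mul_left ?_ hmk
      linarith
    have h2 : (fun k => H₀.rate k (η₀ k) i) =O[atTop] (fun _ => (1 : ℝ)) := by
      refine IsBigO.of_bound C (Eventually.of_forall fun k => ?_)
      rw [Real.norm_of_nonneg (hc'.le.trans (hbd k i).1)]
      simpa using (hbd k i).2
    exact (isLittleO_one_iff ℝ).1 (h1.trans_isBigO h2)
  have hsum : Tendsto (fun k => ∑ i, (H₀.rate k (η₀ k) i - H₁.rate k (ζ₀ k) i) ^ 2 / c) atTop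
      (𝓝 0) := by
    have := tendsto_finsetSum (Finset.univ : Finset (Fin n)) fun i _ =>
      ((hδ i).pow 2).div_const c
    simpa using this
  refine squeeze_zero (fun k => BinModel.deviation_nonneg (hb.mem k) _) (fun k => ?_) hsum
  refine Finset.sum_le_sum fun i _ => ?_
  gcongr
  exact hr k i

/-- The four forms of the difference of the minimized deviations, for data near their means, when
the hypotheses are close but their minimal deviation diverges. -/
lemma eventually_deltaT_bounds (hm0 : ∀ k, 0 < m k) (hm : Tendsto m atTop atTop)
    (ht : H₀.IsTruth η₀) (hb : H₁.IsBestFit (fun k => H₀.rate k (η₀ k)) ζ₀)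
    (hdev : Tendsto (fun k => H₁.deviation k (H₀.rate k (η₀ k)) (ζ₀ k)) atTop (𝓝 0))
    (hD : Tendsto (fun k => m k * H₁.deviation k (H₀.rate k (η₀ k)) (ζ₀ k)) atTop atTop)
    {K ε : ℝ} (hK : 0 < K) (hε : 0 < ε) :
    ∀ᶠ k in atTop, ∀ x : Fin n → ℝ, (∀ i, |x i - m k * H₀.rate k (η₀ k) i| ≤ K * √(m k)) →
      ∀ v : Form,
      m k * H₁.deviation k (H₀.rate k (η₀ k)) (ζ₀ k) / 2 ≤ pearsonD H₀ H₁ m k x ∧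
      m k * H₁.deviation k (H₀.rate k (η₀ k)) (ζ₀ k) / 2 ≤ H₁.Tmin m .pearson k x ∧
      |H₁.Tmin m v k x - H₁.Tmin m .pearson k x| ≤
        ε * (m k * H₁.deviation k (H₀.rate k (η₀ k)) (ζ₀ k)) ∧
      |DeltaT H₀ H₁ m v k x - pearsonD H₀ H₁ m k x| ≤
        ε * (m k * H₁.deviation k (H₀.rate k (η₀ k)) (ζ₀ k)) ∧
      |DeltaT H₀ H₁ m v k x - DeltaT H₀ H₁ m v k (H₀.mean m k (η₀ k)) -
        H₁.linearPart (fun k => H₀.rate k (η₀ k)) ζ₀ m k x| ≤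
        ε * √(m k * H₁.deviation k (H₀.rate k (η₀ k)) (ζ₀ k)) := by
  obtain ⟨c', C', hc', hbd⟩ := ht.rate_bounds
  obtain ⟨c, C, hcf⟩ := hb.exists_isCloseFit hc' hbd hdev
  have hC := hcf.upper_pos 0
  obtain ⟨B₁, hB₁, hT⟩ := hcf.exists_T_bounds hm0 hm K
  obtain ⟨B₀, hB₀, hT₀⟩ := ht.exists_bounds hm0 hm K
  obtain ⟨A, hA, hchi⟩ := hb.exists_chiSqMin_bounds hc' hbd (S := 1)
    ((hdev.eventually (gt_mem_nhds one_pos)).mono fun _ h => h.le) hm0 hm hK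
  set L := 2 * (n * (√(1 + 2 * C) / c * K)) with hL
  have hsqD := Real.tendsto_sqrt_atTop.comp hD
  filter_upwards [hT, hT₀, hchi, hcf.eventually_mul_sqrt_le hm0 hm B₁ (ε := ε / 4) (by linarith),
    hcf.eventually_abs_linearPart_le hm0 (K := K), hcf.eventually_near hm0 hm K,
    hb.eventually_abs_Tmin_sub_le hcf hm0 hm hD hK (half_pos hε), hD.eventually_ge_atTop 1,
    hD.eventually_ge_atTop (8 * (A + B₀)), hD.eventually_ge_atTop (2 * (A + C + 2 * B₀) / ε),
    hsqD.eventually_ge_atTop (8 * L), hsqD.eventually_ge_atTop (4 * B₀ / ε)]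
    with k k1 k2 k3 k4 k5 k6 k7 d1 d2 d3 d4 d5 x hx v
  have hmk := hm0 k
  simp only [Function.comp] at d4 d5
  set D := m k * H₁.deviation k (H₀.rate k (η₀ k)) (ζ₀ k) with hDdef
  set l := H₁.linearPart (fun k => H₀.rate k (η₀ k)) ζ₀ m k x with hl
  rw [div_le_iff₀ hε] at d3 d5
  have hx2 := fun i => (k6 x hx i).2.1
  have hμ : ∀ i, |H₀.mean m k (η₀ k) i - m k * H₀.rate k (η₀ k) i| ≤ K * √(m k) := fun i => by
    simp only [BinModel.mean, sub_self, abs_zero]; positivity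
  obtain ⟨⟨c0, c0'⟩, c1⟩ := k2 x hx
  obtain ⟨c2, c3, -⟩ := k3 x hx
  have c4 := (k1 x hx v).2.1.trans k4
  have c5 := abs_le.1 (c1 v).1
  have c6 := abs_le.1 ((k2 _ hμ).2 v).1
  have c7 := abs_le.1 (k7 x hx v)
  -- Since the linear part is of order √D, it takes at most D/8; the bounded errors take another
  -- D/8, leaving more than D/2.
  have c8 : |l| ≤ D / 8 := by
    refine (k5 x hx).trans ?_
    have hs : √D * √D = D := Real.mul_self_sqrt (by linarith)
    nlinarith [Real.sqrt_nonneg D]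
  have c9 := abs_le.1 c8
  have c10 := abs_le.1 c2
  have c11 := BinModel.chiSqMin_le_Tmin_pearson (M := H₁) hmk (hb.mem k) x
  have c12 : H₁.Tmin m .pearson k x ≤ H₁.chiSqMin m k x + A + C := by
    refine (BinModel.Tmin_le hmk (hb.mem k) .pearson hx2).trans ?_
    rw [H₁.T_pearson_eq]
    linarith [hcf.pen_le k]
  have c13 := abs_le.1 c4
  have e14 : ε / 4 * (1 + D) ≤ ε / 2 * D := by nlinarith
  have hεD : 0 ≤ ε * D := by positivity
  refine ⟨?_, ?_, ?_, ?_, ?_⟩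
  · rw [pearsonD]; linarith
  · linarith
  · exact c4.trans (by linarith)
  · rw [DeltaT, pearsonD, abs_le]
    constructor <;> linarith
  -- The minimum under H₀ is bounded at x and at the mean, so it contributes at most 2B₀ ≤ ε/2 √D.
  · have hμe : H₀.mean m k (η₀ k) = fun i => m k * H₀.rate k (η₀ k) i := rfl
    rw [DeltaT, DeltaT, abs_le]
    rw [hμe] at c6 ⊢
    constructor <;> linarith

end Leading

/-! ### Normal approximations -/

section Conclusions

variable {n : ℕ} {H₀ H₁ : BinModel n} {m : ℕ → ℝ} {η₀ : ℕ → H₀.Param} {ζ₀ : ℕ → H₁.Param}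
  {Ω : ℕ → Type*} [∀ k, MeasurableSpace (Ω k)] {P : ∀ k, Measure (Ω k)}
  [∀ k, IsProbabilityMeasure (P k)] {X : ∀ k, Ω k → Fin n → ℝ}

lemma exists_prob_near (hm0 : ∀ k, 0 < m k) (hm : Tendsto m atTop atTop) (ht : H₀.IsTruth η₀)
    (hX : IsCountData P X (fun k => H₀.mean m k (η₀ k))) {ε : ℝ} (hε : 0 < ε) :
    ∃ K : ℝ, 0 < K ∧ ∀ᶠ k in atTop,
      (P k).real {ω | ∀ i, |X k ω i - m k * H₀.rate k (η₀ k) i| ≤ K * √(m k)}ᶜ ≤ ε := by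
  obtain ⟨c, C, hc, hb⟩ := ht.rate_bounds
  exact hX.exists_near hm0 hm hc (C := C) (fun k i =>
    ⟨mul_le_mul_of_nonneg_left (hb k i).1 (hm0 k).le,
      mul_le_mul_of_nonneg_left (hb k i).2 (hm0 k).le⟩) hε

/-- Asymptotic normality of the linear part, with equivalent scales and negligible errors. -/
lemma approxNormal_of_linearPart (hm0 : ∀ k, 0 < m k) (hm : Tendsto m atTop atTop)
    (ht : H₀.IsTruth η₀) (hb : ∀ k, ζ₀ k ∈ H₁.params)
    (hX : IsCountData P X (fun k => H₀.mean m k (η₀ k))) {Y : ∀ k, Ω k → ℝ} {a s t v : ℕ → ℝ}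
    (ht0 : ∀ k, 0 ≤ t k) {g : ℝ} (hg : g = 1 ∨ g = -1)
    (hs0 : ∀ k, 0 ≤ s k)
    (hsz : ∀ k, m k * H₁.deviation k (H₀.rate k (η₀ k)) (ζ₀ k) = 0 → s k = 0)
    (hs : ∀ ε : ℝ, 0 < ε → ∀ᶠ k in atTop,
      |t k ^ 2 * (4 * m k * H₁.linearVar (fun k => H₀.rate k (η₀ k)) ζ₀ k) - s k ^ 2| ≤
        ε * s k ^ 2)
    (hY : ∀ K : ℝ, 0 < K → ∀ ε : ℝ, 0 < ε → ∀ᶠ k in atTop, ∀ ω,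
      (∀ i, |X k ω i - m k * H₀.rate k (η₀ k) i| ≤ K * √(m k)) →
      |Y k ω - (a k + g * (t k * H₁.linearPart (fun k => H₀.rate k (η₀ k)) ζ₀ m k (X k ω)))| ≤
        ε * s k)
    (hv : ∀ᶠ k in atTop, v k = s k ^ 2) : ApproxNormal P Y a v := by
  obtain ⟨c, C, hc, hbd⟩ := ht.rate_bounds
  have hp0 : ∀ k i, 0 < H₀.rate k (η₀ k) i := fun k i => hc.trans_le (hbd k i).1
  obtain ⟨Z, hZ1, hZ2, hZ3⟩ := BinModel.exists_linearPart_eq (M := H₁) (b := ζ₀)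
    (p := fun k => H₀.rate k (η₀ k)) hX hm0 hm hc (fun k i => (hbd k i).1)
  have hlv := fun k => BinModel.linearVar_nonneg (M := H₁) (b := ζ₀) hp0 k
  have hsq : ∀ k, (2 * √(m k * H₁.linearVar (fun k => H₀.rate k (η₀ k)) ζ₀ k)) ^ 2 =
      4 * m k * H₁.linearVar (fun k => H₀.rate k (η₀ k)) ζ₀ k := fun k => by
    rw [mul_pow, Real.sq_sqrt (mul_nonneg (hm0 k).le (hlv k))]; ring
  -- `σ` is the exact scale of the linear part multiplied by `t`, `s` the equivalent scale of the
  -- target law, and `g` the sign. If the variance vanishes for all k, so do the deviation and hence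
  -- `s`.
  refine approxNormal_of_good
    (G := fun K k => {ω | ∀ i, |X k ω i - m k * H₀.rate k (η₀ k) i| ≤ K * √(m k)})
    (Z := fun k ω => g * Z k ω) (s := s)
    (σ := fun k => t k * (2 * √(m k * H₁.linearVar (fun k => H₀.rate k (η₀ k)) ζ₀ k)))
    (fun ε hε => exists_prob_near hm0 hm ht hX hε) ?_ ?_ hs0 ?_ ?_ hv
  · rcases hZ2 with h0 | ⟨h1, h2⟩
    · refine Or.inl fun k => hsz k ?_
      rw [BinModel.deviation_eq_zero_of_linearVar_eq_zero (p := fun k => H₀.rate k (η₀ k)) hp0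
        (hb k) (h0 k), mul_zero]
    · right
      rcases hg with rfl | rfl
      · simpa using h1
      · simpa using h2
  · intro K hK
    obtain ⟨A, hA⟩ := hZ3 K hK
    refine ⟨A, Eventually.of_forall fun k ω hω => ?_⟩
    have : |g| = 1 := by rcases hg with rfl | rfl <;> simp
    rw [abs_mul, this, one_mul]
    exact hA k ω hω
  · intro ε hε
    filter_upwards [hs ε hε] with k hk
    refine abs_sub_le_of_sq (mul_nonneg (ht0 k) (by positivity)) (hs0 k) ?_
    rw [mul_pow, hsq]
    exact hk
  · intro K hK ε hε
    filter_upwards [hY K hK ε hε] with k hk ω hω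
    have := hk ω hω
    rw [hZ1] at this
    convert this using 3
    ring

section

variable (hm0 : ∀ k, 0 < m k) (hm : Tendsto m atTop atTop) (ht : H₀.IsTruth η₀)
  (hb : H₁.IsBestFit (fun k => H₀.rate k (η₀ k)) ζ₀)
  (hX : IsCountData P X (fun k => H₀.mean m k (η₀ k)))

lemma four_mul_linearVar_eq (hm0 : ∀ k, 0 < m k)
    (hb : H₁.IsBestFit (fun k => H₀.rate k (η₀ k)) ζ₀) (k : ℕ) :
    4 * m k * H₁.linearVar (fun k => H₀.rate k (η₀ k)) ζ₀ k =
      4 * Dbar H₀ H₁ m η₀ k + 4 * m k * sTerm H₀ H₁ η₀ ζ₀ k := by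
  rw [← deviation_add_sTerm k (hb.mem k), Dbar_eq hm0 hb]
  ring

lemma linearVar_nonneg_of_isTruth (ht : H₀.IsTruth η₀) (k : ℕ) :
    0 ≤ H₁.linearVar (fun k => H₀.rate k (η₀ k)) ζ₀ k :=
  BinModel.linearVar_nonneg (fun k i => H₀.rate_pos k _ (ht.mem k) i) k

lemma linearVar_eq_zero_of_mul_deviation {k : ℕ} (hm : 0 < m k) (hb : ζ₀ k ∈ H₁.params)
    (h : m k * H₁.deviation k (H₀.rate k (η₀ k)) (ζ₀ k) = 0) :
    H₁.linearVar (fun k => H₀.rate k (η₀ k)) ζ₀ k = 0 := by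
  have h1 : H₁.deviation k (H₀.rate k (η₀ k)) (ζ₀ k) = 0 :=
    (mul_eq_zero.1 h).resolve_left hm.ne'
  refine Finset.sum_eq_zero fun i _ => ?_
  have h2 := H₁.sq_sub_le_rate_mul_deviation (k := k) hb (H₀.rate k (η₀ k)) i
  rw [h1, mul_zero] at h2
  have h3 : H₀.rate k (η₀ k) i - H₁.rate k (ζ₀ k) i = 0 :=
    pow_eq_zero_iff (by norm_num) |>.1 (le_antisymm h2 (sq_nonneg _))
  simp [h3]

include hm0 hm ht hb hX

lemma approxNormal_D₂_div : ApproxNormal P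
    (fun k ω => D₂ H₀ H₁ m η₀ ζ₀ k (X k ω) / (2 * √(m k))) (fun _ => 0)
    (fun k => Dbar H₀ H₁ m η₀ k / m k + sTerm H₀ H₁ η₀ ζ₀ k) := by
  have hlv := fun k => linearVar_nonneg_of_isTruth (H₁ := H₁) (ζ₀ := ζ₀) ht k
  refine approxNormal_of_linearPart hm0 hm ht hb.mem hX (t := fun k => (2 * √(m k))⁻¹)
    (s := fun k => √(H₁.linearVar (fun k => H₀.rate k (η₀ k)) ζ₀ k))
    (fun k => by positivity) (Or.inl rfl) (fun k => Real.sqrt_nonneg _)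
    (fun k hk => by rw [linearVar_eq_zero_of_mul_deviation (hm0 k) (hb.mem k) hk, Real.sqrt_zero])
    (fun ε hε => Eventually.of_forall fun k => ?_)
    (fun K hK ε hε => Eventually.of_forall fun k ω _ => ?_) (Eventually.of_forall fun k => ?_)
  · have e : (2 * √(m k))⁻¹ ^ 2 * (4 * m k * H₁.linearVar (fun k => H₀.rate k (η₀ k)) ζ₀ k) =
        H₁.linearVar (fun k => H₀.rate k (η₀ k)) ζ₀ k := by
      rw [inv_pow, mul_pow, Real.sq_sqrt (hm0 k).le]
      have := (hm0 k).ne'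
      field_simp
      norm_num
    rw [e, Real.sq_sqrt (hlv k), sub_self, abs_zero]
    have := hlv k
    positivity
  · rw [D₂_eq_linearPart (hm0 k)]
    have e : ∀ y z : ℝ, y / z - (0 + 1 * (z⁻¹ * y)) = 0 := fun y z => by rw [div_eq_mul_inv]; ring
    rw [e, abs_zero]
    positivity
  · rw [Real.sq_sqrt (hlv k), ← deviation_add_sTerm k (hb.mem k), Dbar_eq hm0 hb,
      mul_div_cancel_left₀ _ (hm0 k).ne']

/-- Variables close to `D₁ + D₂` are approximately normal. -/
lemma approxNormal_of_near {Y : ∀ k, Ω k → ℝ}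
    (hY : ∀ K : ℝ, 0 < K → ∀ ε : ℝ, 0 < ε → ∀ᶠ k in atTop, ∀ ω,
      (∀ i, |X k ω i - m k * H₀.rate k (η₀ k) i| ≤ K * √(m k)) →
      |Y k ω - (D₁ H₀ H₁ m η₀ ζ₀ k + D₂ H₀ H₁ m η₀ ζ₀ k (X k ω))| ≤
        ε * √(4 * Dbar H₀ H₁ m η₀ k + 4 * m k * sTerm H₀ H₁ η₀ ζ₀ k)) :
    ApproxNormal P Y (Dbar H₀ H₁ m η₀)
      (fun k => 4 * Dbar H₀ H₁ m η₀ k + 4 * m k * sTerm H₀ H₁ η₀ ζ₀ k) := by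
  have hlv := fun k => linearVar_nonneg_of_isTruth (H₁ := H₁) (ζ₀ := ζ₀) ht k
  have h4 : ∀ k, 0 ≤ 4 * Dbar H₀ H₁ m η₀ k + 4 * m k * sTerm H₀ H₁ η₀ ζ₀ k := fun k => by
    rw [← four_mul_linearVar_eq hm0 hb]
    have := hm0 k
    have := hlv k
    positivity
  refine approxNormal_of_linearPart hm0 hm ht hb.mem hX (t := fun _ => 1)
    (s := fun k => √(4 * Dbar H₀ H₁ m η₀ k + 4 * m k * sTerm H₀ H₁ η₀ ζ₀ k))
    (fun k => zero_le_one) (Or.inl rfl) (fun k => Real.sqrt_nonneg _)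
    (fun k hk => ?_) (fun ε hε => Eventually.of_forall fun k => ?_)
    (fun K hK ε hε => ?_) (Eventually.of_forall fun k => ?_)
  · rw [← four_mul_linearVar_eq hm0 hb,
      linearVar_eq_zero_of_mul_deviation (hm0 k) (hb.mem k) hk, mul_zero, Real.sqrt_zero]
  · rw [four_mul_linearVar_eq hm0 hb, Real.sq_sqrt (h4 k), one_pow, one_mul, sub_self, abs_zero]
    exact mul_nonneg hε.le (h4 k)
  · filter_upwards [hY K hK ε hε] with k hk ω hω
    have := hk ω hω
    rw [D₂_eq_linearPart (hm0 k), D₁_eq, ← Dbar_eq hm0 hb] at this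
    rwa [one_mul, one_mul]
  · rw [Real.sq_sqrt (h4 k)]

/-- As `approxNormal_of_near`, for hypotheses with close means. -/
lemma approxNormal_of_near_of_close
    (hs : (fun k => m k * sTerm H₀ H₁ η₀ ζ₀ k) =o[atTop] Dbar H₀ H₁ m η₀) {Y : ∀ k, Ω k → ℝ}
    (hY : ∀ K : ℝ, 0 < K → ∀ ε : ℝ, 0 < ε → ∀ᶠ k in atTop, ∀ ω,
      (∀ i, |X k ω i - m k * H₀.rate k (η₀ k) i| ≤ K * √(m k)) →
      |Y k ω - (D₁ H₀ H₁ m η₀ ζ₀ k + D₂ H₀ H₁ m η₀ ζ₀ k (X k ω))| ≤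
        ε * √(4 * Dbar H₀ H₁ m η₀ k)) :
    ApproxNormal P Y (Dbar H₀ H₁ m η₀) (fun k => 4 * Dbar H₀ H₁ m η₀ k) := by
  have hD0 : ∀ k, 0 ≤ Dbar H₀ H₁ m η₀ k := fun k => by
    rw [Dbar_eq hm0 hb]
    exact mul_nonneg (hm0 k).le (BinModel.deviation_nonneg (hb.mem k) _)
  have h4 : ∀ k, 0 ≤ 4 * Dbar H₀ H₁ m η₀ k := fun k => by linarith [hD0 k]
  refine approxNormal_of_linearPart hm0 hm ht hb.mem hX (t := fun _ => 1)
    (s := fun k => √(4 * Dbar H₀ H₁ m η₀ k))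
    (fun k => zero_le_one) (Or.inl rfl) (fun k => Real.sqrt_nonneg _)
    (fun k hk => ?_) (fun ε hε => ?_)
    (fun K hK ε hε => ?_) (Eventually.of_forall fun k => ?_)
  · rw [Dbar_eq hm0 hb, hk, mul_zero, Real.sqrt_zero]
  · filter_upwards [isLittleO_iff.1 hs hε] with k hk
    rw [four_mul_linearVar_eq hm0 hb, Real.sq_sqrt (h4 k), one_pow, one_mul, add_sub_cancel_left,
      mul_assoc, abs_mul]
    rw [Real.norm_eq_abs, Real.norm_of_nonneg (hD0 k)] at hk
    rw [abs_of_pos (show (0 : ℝ) < 4 by norm_num)]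
    linarith
  · filter_upwards [hY K hK ε hε] with k hk ω hω
    have := hk ω hω
    rw [D₂_eq_linearPart (hm0 k), D₁_eq, ← Dbar_eq hm0 hb] at this
    rwa [one_mul, one_mul]
  · rw [Real.sq_sqrt (h4 k)]

/-- Asymptotic normality of the difference of the minimized deviations, up to a sign. -/
lemma approxNormal_deltaT
    (hdev : Tendsto (fun k => H₁.deviation k (H₀.rate k (η₀ k)) (ζ₀ k)) atTop (𝓝 0))
    (hs : (fun k => m k * sTerm H₀ H₁ η₀ ζ₀ k) =o[atTop] Dbar H₀ H₁ m η₀)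
    (hD : Tendsto (Dbar H₀ H₁ m η₀) atTop atTop) (v : Form)
    (hequiv : (fun k => DeltaT H₀ H₁ m v k (H₀.mean m k (η₀ k))) ~[atTop] Dbar H₀ H₁ m η₀)
    {g : ℝ} (hg : g = 1 ∨ g = -1) :
    ApproxNormal P (fun k ω => g * DeltaT H₀ H₁ m v k (X k ω))
      (fun k => g * DeltaT H₀ H₁ m v k (H₀.mean m k (η₀ k)))
      (fun k => 4 * |DeltaT H₀ H₁ m v k (H₀.mean m k (η₀ k))|) := by
  have hDe : Dbar H₀ H₁ m η₀ = fun k => m k * H₁.deviation k (H₀.rate k (η₀ k)) (ζ₀ k) :=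
    funext fun k => Dbar_eq hm0 hb k
  have hD' := hD
  rw [hDe] at hD'
  have hgabs : |g| = 1 := by rcases hg with rfl | rfl <;> simp
  have hdist : ∀ ε : ℝ, 0 < ε → ∀ᶠ k in atTop,
      |DeltaT H₀ H₁ m v k (H₀.mean m k (η₀ k)) - Dbar H₀ H₁ m η₀ k| ≤
        ε * Dbar H₀ H₁ m η₀ k := by
    intro ε hε
    filter_upwards [isLittleO_iff.1 hequiv.isLittleO hε, hD.eventually_ge_atTop 0] with k hk h0
    simpa [abs_of_nonneg h0] using hk
  have h4 : ∀ k, 0 ≤ 4 * |DeltaT H₀ H₁ m v k (H₀.mean m k (η₀ k))| := fun k => by positivity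
  -- the scale is `0` where the minimal deviation vanishes, which occurs only finitely often
  refine approxNormal_of_linearPart hm0 hm ht hb.mem hX (t := fun _ => 1)
    (s := fun k => if Dbar H₀ H₁ m η₀ k = 0 then 0 else
      √(4 * |DeltaT H₀ H₁ m v k (H₀.mean m k (η₀ k))|))
    (fun k => zero_le_one) hg (fun k => by split_ifs <;> positivity)
    (fun k hk => ?_) (fun ε hε => ?_)
    (fun K hK ε hε => ?_) ?_
  · rw [← Dbar_eq hm0 hb] at hk
    simp [hk]
  · filter_upwards [isLittleO_iff.1 hs (show 0 < ε / 4 by linarith),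
      hdist (ε / 4) (by linarith), hdist (1 / 2) (by norm_num), hD.eventually_gt_atTop 0]
      with k h1 h2 h3 h0
    rw [if_neg h0.ne', four_mul_linearVar_eq hm0 hb, Real.sq_sqrt (h4 k), one_pow, one_mul]
    rw [Real.norm_eq_abs, Real.norm_of_nonneg h0.le] at h1
    set T := DeltaT H₀ H₁ m v k (H₀.mean m k (η₀ k))
    have h5 := abs_le.1 h3
    have hT : 0 < T := by linarith
    have h6 := abs_le.1 h1
    have h7 := abs_le.1 h2
    rw [abs_of_pos hT, abs_le]
    have h8 : ε * Dbar H₀ H₁ m η₀ k ≤ ε * (2 * T) := by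
      gcongr
      linarith
    constructor <;> linarith
  · filter_upwards [eventually_deltaT_bounds hm0 hm ht hb hdev hD' hK hε,
      hdist (1 / 2) (by norm_num), hD.eventually_gt_atTop 0] with k hk h3 h0 ω hω
    have h9 := (hk _ hω v).2.2.2.2
    rw [← Dbar_eq hm0 hb] at h9
    have h5 := abs_le.1 h3
    rw [if_neg h0.ne', one_mul, ← mul_add, ← mul_sub, abs_mul, hgabs, one_mul, ← sub_sub]
    refine h9.trans ?_
    gcongr
    have := le_abs_self (DeltaT H₀ H₁ m v k (H₀.mean m k (η₀ k)))
    linarith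
  · filter_upwards [hD.eventually_gt_atTop 0] with k h0
    rw [if_neg h0.ne', Real.sq_sqrt (h4 k)]

end

lemma isLittleO_mul_sTerm (hm0 : ∀ k, 0 < m k) (ht : H₀.IsTruth η₀)
    (hb : H₁.IsBestFit (fun k => H₀.rate k (η₀ k)) ζ₀)
    (hdev : Tendsto (fun k => H₁.deviation k (H₀.rate k (η₀ k)) (ζ₀ k)) atTop (𝓝 0)) :
    (fun k => m k * sTerm H₀ H₁ η₀ ζ₀ k) =o[atTop] Dbar H₀ H₁ m η₀ := by
  obtain ⟨c', C', hc', hbd⟩ := ht.rate_bounds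
  obtain ⟨c, C, hcf⟩ := hb.exists_isCloseFit hc' hbd hdev
  have hc := hcf.pos
  rw [isLittleO_iff]
  intro ε hε
  filter_upwards [hcf.eventually_abs_sub_le (show 0 < ε * c by positivity)] with k hk
  have h1 := abs_mul_sTerm_le (hm0 k) (hb.mem k) hc (hcf.le_rate k) (by positivity) hk
  rw [mul_div_cancel_right₀ _ hc.ne', ← Dbar_eq hm0 hb] at h1
  rw [Real.norm_eq_abs]
  exact h1.trans (by gcongr; exact Real.le_norm_self _)

lemma isEquivalent_deltaT_mean (hm0 : ∀ k, 0 < m k) (hm : Tendsto m atTop atTop)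
    (ht : H₀.IsTruth η₀) (hb : H₁.IsBestFit (fun k => H₀.rate k (η₀ k)) ζ₀)
    (hdev : Tendsto (fun k => H₁.deviation k (H₀.rate k (η₀ k)) (ζ₀ k)) atTop (𝓝 0))
    (hD : Tendsto (Dbar H₀ H₁ m η₀) atTop atTop) (v : Form) :
    (fun k => DeltaT H₀ H₁ m v k (H₀.mean m k (η₀ k))) ~[atTop] Dbar H₀ H₁ m η₀ := by
  have hDe : Dbar H₀ H₁ m η₀ = fun k => m k * H₁.deviation k (H₀.rate k (η₀ k)) (ζ₀ k) :=
    funext fun k => Dbar_eq hm0 hb k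
  have hD' := hD
  rw [hDe] at hD'
  rw [IsEquivalent, isLittleO_iff]
  intro ε hε
  filter_upwards [eventually_deltaT_bounds hm0 hm ht hb hdev hD' one_pos hε] with k hk
  -- The mean itself is admissible data, and D(μ⁰) = D̄.
  have := (hk (H₀.mean m k (η₀ k)) (fun i => by
    simp only [BinModel.mean, sub_self, abs_zero]; positivity) v).2.2.2.1
  rw [pearsonD_mean_eq hm0 ht, ← Dbar_eq hm0 hb] at this
  rw [Pi.sub_apply, Real.norm_eq_abs]
  exact this.trans (by gcongr; exact Real.le_norm_self _)

end Conclusions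

/-! ### The theorem -/

theorem mainTheorem1 {n : ℕ} (H₀ H₁ : BinModel n)
    (m : ℕ → ℝ) (hm_pos : ∀ k, 0 < m k) (hm : Tendsto m atTop atTop)
    {Ω : ℕ → Type*} [∀ k, MeasurableSpace (Ω k)]
    (P : ∀ k, Measure (Ω k)) [∀ k, IsProbabilityMeasure (P k)]
    (X : ∀ k, Ω k → Fin n → ℝ) :
    -- `H₀` is the correct hypothesis
    (∀ (η₀ : ℕ → H₀.Param) (ζ₀ : ℕ → H₁.Param),
      H₀.IsTruth η₀ →
      H₁.IsBestFit (fun k => H₀.rate k (η₀ k)) ζ₀ →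
      IsCountData P X (fun k => H₀.mean m k (η₀ k)) →
      -- [A0]
      (∀ i, (fun k => rateDiff H₀ H₁ η₀ ζ₀ k i) =O[atTop] (fun _ => (1 : ℝ))) →
      -- `D` in terms of the minimizers, and the rate of the fit under `H₁`
      (∀ (ηhat : ∀ k, Ω k → H₀.Param) (ζhat : ∀ k, Ω k → H₁.Param),
        (∀ k ω, ηhat k ω ∈ H₀.params ∧
          IsMinOn (fun η => H₀.chiSq m k η (X k ω)) H₀.params (ηhat k ω)) →
        (∀ k ω, ζhat k ω ∈ H₁.params ∧
          IsMinOn (fun ζ => H₁.chiSq m k ζ (X k ω)) H₁.params (ζhat k ω)) →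
        (∀ k ω, pearsonD H₀ H₁ m k (X k ω) =
          H₁.chiSq m k (ζhat k ω) (X k ω) - H₀.chiSq m k (ηhat k ω) (X k ω))) ∧
      (∀ ζhat : ∀ k, Ω k → H₁.Param,
        (∀ k ω, ζhat k ω ∈ H₁.params ∧
          IsMinOn (fun ζ => H₁.chiSq m k ζ (X k ω)) H₁.params (ζhat k ω)) →
        IsBigOInProb P (fun k ω => ‖ζhat k ω - ζ₀ k‖) (fun k => (√(m k))⁻¹)) ∧
      -- the leading terms
      (∀ k, IsLeast ((fun ζ => H₁.chiSq m k ζ (H₀.mean m k (η₀ k))) '' H₁.params)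
        (D₁ H₀ H₁ m η₀ ζ₀ k)) ∧
      (∀ k, D₁ H₀ H₁ m η₀ ζ₀ k = Dbar H₀ H₁ m η₀ k ∧
        pearsonD H₀ H₁ m k (H₀.mean m k (η₀ k)) = Dbar H₀ H₁ m η₀ k) ∧
      (fun k => Dbar H₀ H₁ m η₀ k) =O[atTop] m ∧
      IsBigOInProb P (fun k ω => D₂ H₀ H₁ m η₀ ζ₀ k (X k ω)) (fun k => √(m k)) ∧
      -- `D = D₁ + D₂ + O_p(1)`
      IsBigOInProb P (fun k ω => pearsonD H₀ H₁ m k (X k ω) -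
        (D₁ H₀ H₁ m η₀ ζ₀ k + D₂ H₀ H₁ m η₀ ζ₀ k (X k ω))) (fun _ => 1) ∧
      -- `D₂ / (2 √m) ≈ N(0, D̄ / m + s)` and `D₁ + D₂ ≈ N(D̄, 4 D̄ + 4 m s)`
      ApproxNormal P (fun k ω => D₂ H₀ H₁ m η₀ ζ₀ k (X k ω) / (2 * √(m k)))
        (fun _ => 0) (fun k => Dbar H₀ H₁ m η₀ k / m k + sTerm H₀ H₁ η₀ ζ₀ k) ∧
      ApproxNormal P (fun k ω => D₁ H₀ H₁ m η₀ ζ₀ k + D₂ H₀ H₁ m η₀ ζ₀ k (X k ω))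
        (Dbar H₀ H₁ m η₀)
        (fun k => 4 * Dbar H₀ H₁ m η₀ k + 4 * m k * sTerm H₀ H₁ η₀ ζ₀ k) ∧
      -- where the `O_p(1)` term is of relatively small order, so is the law of `D`
      (Tendsto (Dbar H₀ H₁ m η₀) atTop atTop →
        ApproxNormal P (fun k ω => pearsonD H₀ H₁ m k (X k ω)) (Dbar H₀ H₁ m η₀)
          (fun k => 4 * Dbar H₀ H₁ m η₀ k + 4 * m k * sTerm H₀ H₁ η₀ ζ₀ k)) ∧
      -- the four forms of `T_{H₀}` agree up to `O_p(m^{-1/2})`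
      (∀ v : Form, IsBigOInProb P
        (fun k ω => H₀.Tmin m v k (X k ω) - H₀.Tmin m .pearson k (X k ω))
        (fun k => (√(m k))⁻¹)) ∧
      -- consequences of [CD3]
      ((∀ i, (fun k => H₀.mean m k (η₀ k) i - H₁.mean m k (ζ₀ k) i) =o[atTop]
          (fun k => H₀.mean m k (η₀ k) i)) →
        (fun k => m k * sTerm H₀ H₁ η₀ ζ₀ k) =o[atTop] Dbar H₀ H₁ m η₀ ∧
        ApproxNormal P (fun k ω => D₁ H₀ H₁ m η₀ ζ₀ k + D₂ H₀ H₁ m η₀ ζ₀ k (X k ω))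
          (Dbar H₀ H₁ m η₀) (fun k => 4 * Dbar H₀ H₁ m η₀ k) ∧
        (Tendsto (Dbar H₀ H₁ m η₀) atTop atTop →
          ApproxNormal P (fun k ω => pearsonD H₀ H₁ m k (X k ω)) (Dbar H₀ H₁ m η₀)
            (fun k => 4 * Dbar H₀ H₁ m η₀ k) ∧
          ∀ v : Form,
            IsLittleOInProb P
              (fun k ω => H₁.Tmin m v k (X k ω) - H₁.Tmin m .pearson k (X k ω))
              (fun k ω => H₁.Tmin m .pearson k (X k ω)) ∧
            IsLittleOInProb P
              (fun k ω => DeltaT H₀ H₁ m v k (X k ω) - pearsonD H₀ H₁ m k (X k ω))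
              (fun k ω => pearsonD H₀ H₁ m k (X k ω)) ∧
            (fun k => DeltaT H₀ H₁ m v k (H₀.mean m k (η₀ k))) ~[atTop] Dbar H₀ H₁ m η₀ ∧
            ApproxNormal P (fun k ω => DeltaT H₀ H₁ m v k (X k ω))
              (fun k => DeltaT H₀ H₁ m v k (H₀.mean m k (η₀ k)))
              (fun k => 4 * |DeltaT H₀ H₁ m v k (H₀.mean m k (η₀ k))|)))) ∧
    -- `H₁` is the correct hypothesis
    (∀ (ζ₀ : ℕ → H₁.Param) (η₀ : ℕ → H₀.Param),
      H₁.IsTruth ζ₀ →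
      H₀.IsBestFit (fun k => H₁.rate k (ζ₀ k)) η₀ →
      IsCountData P X (fun k => H₁.mean m k (ζ₀ k)) →
      (∀ i, (fun k => H₁.mean m k (ζ₀ k) i - H₀.mean m k (η₀ k) i) =o[atTop]
          (fun k => H₁.mean m k (ζ₀ k) i)) →
      Tendsto (Dbar H₁ H₀ m ζ₀) atTop atTop →
      ∀ v : Form, ApproxNormal P (fun k ω => DeltaT H₀ H₁ m v k (X k ω))
        (fun k => DeltaT H₀ H₁ m v k (H₁.mean m k (ζ₀ k)))
        (fun k => 4 * |DeltaT H₀ H₁ m v k (H₁.mean m k (ζ₀ k))|)) := by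
  have hstep : ∀ {H₀ H₁ : BinModel n} {η₀ : ℕ → H₀.Param} {ζ₀ : ℕ → H₁.Param},
      H₀.IsTruth η₀ → H₁.IsBestFit (fun k => H₀.rate k (η₀ k)) ζ₀ →
      IsCountData P X (fun k => H₀.mean m k (η₀ k)) →
      (∀ i, (fun k => H₀.mean m k (η₀ k) i - H₁.mean m k (ζ₀ k) i) =o[atTop]
          (fun k => H₀.mean m k (η₀ k) i)) →
      Tendsto (Dbar H₀ H₁ m η₀) atTop atTop → ∀ (v : Form) {g : ℝ}, g = 1 ∨ g = -1 →
      ApproxNormal P (fun k ω => g * DeltaT H₀ H₁ m v k (X k ω))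
        (fun k => g * DeltaT H₀ H₁ m v k (H₀.mean m k (η₀ k)))
        (fun k => 4 * |DeltaT H₀ H₁ m v k (H₀.mean m k (η₀ k))|) := by
    intro H₀ H₁ η₀ ζ₀ ht hb hX hCD hD v g hg
    have hdev := tendsto_deviation_zero hm_pos ht hb hCD
    exact approxNormal_deltaT hm_pos hm ht hb hX hdev (isLittleO_mul_sTerm hm_pos ht hb hdev) hD v
      (isEquivalent_deltaT_mean hm_pos hm ht hb hdev hD v) hg
  refine ⟨fun η₀ ζ₀ ht hb hX hA => ?_, fun ζ₀ η₀ ht hb hX hCD hD v => ?_⟩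
  swap
  -- Exchanging the hypotheses negates ΔT and preserves its absolute value.
  · have h1 := hstep ht hb hX hCD hD v (g := -1) (Or.inr rfl)
    have e : ∀ k x, DeltaT H₀ H₁ m v k x = -1 * DeltaT H₁ H₀ m v k x := fun k x => by
      unfold DeltaT; ring
    have ea : ∀ k x, |DeltaT H₀ H₁ m v k x| = |DeltaT H₁ H₀ m v k x| := fun k x => by
      rw [e, abs_mul]; simp
    simp only [ea]
    simpa only [e] using h1
  obtain ⟨c, C, hc, hbd⟩ := ht.rate_bounds
  obtain ⟨S, hS0, hS⟩ := exists_deviation_le hb hA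
  obtain ⟨c₁, hc₁, hr₁⟩ := hb.rate_lower
  have hG := fun ε (hε : 0 < ε) => exists_prob_near hm_pos hm ht hX hε
  have hsq : ∀ k, 0 < √(m k) := fun k => Real.sqrt_pos.2 (hm_pos k)
  have hDe : Dbar H₀ H₁ m η₀ = fun k => m k * H₁.deviation k (H₀.rate k (η₀ k)) (ζ₀ k) :=
    funext fun k => Dbar_eq hm_pos hb k
  have hD0 : ∀ k, 0 ≤ Dbar H₀ H₁ m η₀ k := fun k => by
    rw [Dbar_eq hm_pos hb]
    exact mul_nonneg (hm_pos k).le (BinModel.deviation_nonneg (hb.mem k) _)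
  -- The deterministic core of D = D₁ + D₂ + O_p(1), used for the order and for both laws of D.
  have hexp : ∀ K : ℝ, 0 < K → ∃ A : ℝ, 0 < A ∧ ∀ᶠ k in atTop, ∀ x : Fin n → ℝ,
      (∀ i, |x i - m k * H₀.rate k (η₀ k) i| ≤ K * √(m k)) →
      |pearsonD H₀ H₁ m k x - (D₁ H₀ H₁ m η₀ ζ₀ k + D₂ H₀ H₁ m η₀ ζ₀ k x)| ≤ A := by
    intro K hK
    obtain ⟨A, hA, h1⟩ := hb.exists_chiSqMin_bounds hc hbd hS hm_pos hm hK
    obtain ⟨B, hB, h2⟩ := ht.exists_bounds hm_pos hm K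
    refine ⟨A + B, by positivity, ?_⟩
    filter_upwards [h1, h2] with k h1 h2 x hx
    have h3 := abs_le.1 (h1 x hx).1
    have h4 := (h2 x hx).1
    rw [D₂_eq_linearPart (hm_pos k), D₁_eq, pearsonD, abs_le]
    constructor <;> linarith
  refine ⟨fun ηhat ζhat hη hζ k ω => ?_, fun ζhat hζ => ?_, isLeast_D₁ hm_pos hb,
    fun k => ⟨(Dbar_eq hm_pos hb k).symm, pearsonD_mean_eq hm_pos ht k⟩, ?_, ?_, ?_,
    approxNormal_D₂_div hm_pos hm ht hb hX, ?_, fun hD => ?_, fun v => ?_, fun hCD => ?_⟩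
  · rw [pearsonD, BinModel.chiSqMin_eq_of_isMinOn (hm_pos k) (hη k ω).1 (hη k ω).2,
      BinModel.chiSqMin_eq_of_isMinOn (hm_pos k) (hζ k ω).1 (hζ k ω).2]
  · refine isBigOInProb_of_good hG fun K hK => ?_
    obtain ⟨A, hA, h1⟩ := hb.exists_chiSqMin_bounds hc hbd hS hm_pos hm hK
    refine ⟨√A, ?_⟩
    filter_upwards [h1] with k hk ω hω
    have h2 := (hk _ hω).2.2 _ (hζ k ω).1 ((hζ k ω).2 (hb.mem k))
    rw [abs_norm, ← div_eq_mul_inv, le_div_iff₀ (hsq k)]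
    refine Real.le_sqrt_of_sq_le ?_
    rw [mul_pow, Real.sq_sqrt (hm_pos k).le]
    linarith
  · rw [hDe]
    refine IsBigO.of_bound S ?_
    filter_upwards [hS] with k hk
    have h0 := BinModel.deviation_nonneg (k := k) (hb.mem k) (H₀.rate k (η₀ k))
    have := hm_pos k
    rw [Real.norm_of_nonneg (by positivity), Real.norm_of_nonneg this.le, mul_comm]
    gcongr
  · refine isBigOInProb_of_good hG fun K hK => ?_
    -- From (π - τ)² ≤ τ · deviation, the deviation being at most S and therefore τ ≤ S + 2C.
    have hR : ∀ᶠ k in atTop, ∀ i, |H₀.rate k (η₀ k) i - H₁.rate k (ζ₀ k) i| ≤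
        √((S + 2 * C) * S) := by
      filter_upwards [hS] with k hk i
      refine Real.abs_le_sqrt ((H₁.sq_sub_le_rate_mul_deviation (hb.mem k) _ i).trans ?_)
      have h1 := H₁.rate_le_of_deviation_le (hb.mem k) hk (hbd k i).2
      have h2 := (H₁.rate_pos k _ (hb.mem k) i).le
      have h3 := BinModel.deviation_nonneg (k := k) (hb.mem k) (H₀.rate k (η₀ k))
      have h4 := h2.trans h1
      gcongr
    refine ⟨2 * (n * (√((S + 2 * C) * S) / c₁ * K)), ?_⟩
    filter_upwards [hR] with k hk ω hω
    rw [D₂_eq_linearPart (hm_pos k), BinModel.linearPart, abs_mul, abs_two, mul_assoc]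
    gcongr
    refine (Finset.abs_sum_le_sum_abs _ _).trans ?_
    calc _ ≤ ∑ _i : Fin n, √((S + 2 * C) * S) / c₁ * (K * √(m k)) := by
          refine Finset.sum_le_sum fun i _ => ?_
          rw [abs_mul, abs_div, abs_of_pos (H₁.rate_pos k _ (hb.mem k) i)]
          gcongr
          · exact hk i
          · exact hr₁ k i
          · exact hω i
      _ = _ := by
          rw [Finset.sum_const, Finset.card_univ, Fintype.card_fin, nsmul_eq_mul]
          ring
  · refine isBigOInProb_of_good hG fun K hK => ?_
    obtain ⟨A, hA, h1⟩ := hexp K hK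
    refine ⟨A, ?_⟩
    filter_upwards [h1] with k hk ω hω
    rw [mul_one]
    exact hk _ hω
  · refine approxNormal_of_near hm_pos hm ht hb hX fun K hK ε hε =>
      Eventually.of_forall fun k ω _ => ?_
    rw [sub_self, abs_zero]
    positivity
  · refine approxNormal_of_near hm_pos hm ht hb hX fun K hK ε hε => ?_
    obtain ⟨A, hA, h1⟩ := hexp K hK
    -- The variance is at least c/(S + 2|C|) times D̄, so its square root eventually dominates the
    -- bounded remainder.
    have hlim : Tendsto (fun k => √(4 * Dbar H₀ H₁ m η₀ k + 4 * m k * sTerm H₀ H₁ η₀ ζ₀ k))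
        atTop atTop := by
      refine Real.tendsto_sqrt_atTop.comp ?_
      have hR0 : 0 < S + 2 * |C| := by positivity
      refine tendsto_atTop_mono' _ ?_ (hD.const_mul_atTop (show 0 < c / (S + 2 * |C|) by positivity))
      filter_upwards [hS] with k hk
      rw [← four_mul_linearVar_eq hm_pos hb]
      have h2 := BinModel.mul_deviation_le_linearVar (M := H₁) (b := ζ₀)
        (p := fun k => H₀.rate k (η₀ k)) hc (fun i => (hbd k i).1) (hb.mem k)
        (fun i => (H₁.rate_le_of_deviation_le (hb.mem k) hk (hbd k i).2).trans
          (show S + 2 * C ≤ S + 2 * |C| by linarith [le_abs_self C]))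
      have h3 := linearVar_nonneg_of_isTruth (H₁ := H₁) (ζ₀ := ζ₀) ht k
      have hmk := hm_pos k
      rw [Dbar_eq hm_pos hb, div_mul_eq_mul_div, div_le_iff₀ hR0]
      have h4 := mul_le_mul_of_nonneg_left h2 hmk.le
      have h5 : 0 ≤ m k * ((S + 2 * |C|) *
        H₁.linearVar (fun k => H₀.rate k (η₀ k)) ζ₀ k) := by positivity
      linarith
    filter_upwards [h1, hlim.eventually_ge_atTop (A / ε)] with k hk h2 ω hω
    rw [div_le_iff₀ hε] at h2
    linarith [hk _ hω]
  · refine isBigOInProb_of_good hG fun K hK => ?_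
    obtain ⟨B, hB, h2⟩ := ht.exists_bounds hm_pos hm K
    refine ⟨B, ?_⟩
    filter_upwards [h2] with k hk ω hω
    exact ((hk _ hω).2 v).2
  have hdev := tendsto_deviation_zero hm_pos ht hb hCD
  have hs := isLittleO_mul_sTerm hm_pos ht hb hdev
  refine ⟨hs, ?_, fun hD => ⟨?_, fun v => ?_⟩⟩
  · refine approxNormal_of_near_of_close hm_pos hm ht hb hX hs fun K hK ε hε =>
      Eventually.of_forall fun k ω _ => ?_
    rw [sub_self, abs_zero]
    positivity
  · refine approxNormal_of_near_of_close hm_pos hm ht hb hX hs fun K hK ε hε => ?_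
    obtain ⟨A, hA, h1⟩ := hexp K hK
    have hlim : Tendsto (fun k => √(4 * Dbar H₀ H₁ m η₀ k)) atTop atTop :=
      Real.tendsto_sqrt_atTop.comp (hD.const_mul_atTop (by norm_num))
    filter_upwards [h1, hlim.eventually_ge_atTop (A / ε)] with k hk h2 ω hω
    rw [div_le_iff₀ hε] at h2
    linarith [hk _ hω]
  · have hD' := hD
    rw [hDe] at hD'
    refine ⟨isLittleOInProb_of_good hG fun K hK ε hε => ?_,
      isLittleOInProb_of_good hG fun K hK ε hε => ?_,
      isEquivalent_deltaT_mean hm_pos hm ht hb hdev hD v, ?_⟩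
    -- Half of ε, because the statistic compared with is at least D̄/2 on the box.
    · filter_upwards [eventually_deltaT_bounds hm_pos hm ht hb hdev hD' hK (half_pos hε)]
        with k hk ω hω
      obtain ⟨-, h1, h2, -, -⟩ := hk _ hω v
      refine h2.trans ?_
      rw [div_mul_comm, mul_comm]
      gcongr
      exact h1.trans (le_abs_self _)
    · filter_upwards [eventually_deltaT_bounds hm_pos hm ht hb hdev hD' hK (half_pos hε)]
        with k hk ω hω
      obtain ⟨h1, -, -, h2, -⟩ := hk _ hω v
      refine h2.trans ?_
      rw [div_mul_comm, mul_comm]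
      gcongr
      exact h1.trans (le_abs_self _)
    · simpa using hstep ht hb hX hCD hD v (g := 1) (Or.inl rfl)
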